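/- Let $K$ be a finite abelian group with character group $K^*$, let $r\ge 1$, let $\Bbbk\in K$, and let $R=\mathbb{Z}_r\times_\beta K$ be the set of pairs $(a,k)$ with $a\in\mathbb{Z}_r$ (represented by $0\le a\le r-1$), $k\in K$, with addition $(a,k)+(b,l)=(a+b,\,k+l+\beta(a,b))$, where $\beta(a,b)=\Bbbk$ if $a+b\ge r$ (sum of the representatives) and $\beta(a,b)=0$ otherwise; so $|R|=r|K|$. Let $u$ be a nonzero complex number. Let $\bigwedge^{\infty/2}_0V$ be the charge-zero part of the infinite wedge on $V=\bigoplus_{k\in\mathbb{Z}+1/2}\mathbb{C}\,\underline{k}$, with its orthonormal basis $v_\lambda$, fermionic operators $\psi_k,\psi_k^*$, and $E_{ij}={:}\psi_i\psi_j^*{:}$, the normal ordering being $\psi_i\psi^*_j$ for $j>0$ and $-\psi^*_j\psi_i$ for $j<0$. Put $\varsigma(x)=e^{x/2}-e^{-x/2}$, $\mathcal{S}(x)=\varsigma(x)/x$ and $$\mathcal{E}_m(x)=\sum_{k\in\mathbb{Z}+\frac12}e^{x(k-\frac m2)}E_{k-m,k}+\frac{\delta_{m,0}}{\varsigma(x)}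 .$$ On $\bigotimes_{\gamma\in K^*}\bigwedge^{\infty/2}_0V$ let $\mathcal{E}^\gamma_m$ denote $\mathcal{E}_m$ acting on the factor labelled $\gamma$. Write $(x+1)_n=(x+1)\cdots(x+n)$ for $n\ge0$ and $(x+1)_n=(x(x-1)\cdots(x+n+1))^{-1}$ for $n\le 0$. For each $\gamma\in K^*$ fix an $r$-th root $(\gamma(-\Bbbk)r)^{1/r}$ and let $(\gamma(-\Bbbk)r)^{a/r}$ be its $a$-th power. For $0\le a\le r-1$ and $\mathfrak{r}=(a,k)\in R$ define $$\mathcal{A}^\gamma_{a/r}(z,u)=\frac{z(\gamma(-\Bbbk)r)^{a/r}}{z+a}\,\mathcal{S}(|R|uz)^{\frac{z+a}{r}}\sum_{i\in\mathbb{Z}}\frac{z^i\,\mathcal{S}(|R|uz)^i}{(1+\frac{z+a}{r})_i}\,\mathcal{E}^\gamma_{ir+a}(|K|uz),\qquad \mathcal{A}_{\mathfrak{r}}(z,u)=\sum_{\gamma\in K^*}\gamma(-k)\,\mathcal{A}^\gamma_{a/r}(z,u).$$ The matrix elements of these operators in the basis $\bigotimes_\gamma v_{\lambda^\gamma}$ are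 expanded as formal Laurent series in $z$ at $z=0$ (the power of $\mathcal S$ being $\exp(\frac{z+a}{r}\log\mathcal{S})$). In each product of the coefficient of $z^p$ of one such operator with the coefficient of $w^q$ of another, in either order, every matrix element is a finite sum, so that commutators are defined as formal series in $z$ and $w$, infinite in both directions. Let $$\delta(z,-w)=\frac1w\sum_{n\in\mathbb{Z}}\Big(-\frac zw\Big)^n ,$$ and let $\delta_r(n)$ be $1$ if $r\mid n$ and $0$ otherwise. Then for all $\gamma,\gamma'\in K^*$ and $0\le a,b\le r-1$, $$[\mathcal{A}^{\gamma}_{a/r}(z,u),\mathcal{A}^{\gamma'}_{b/r}(w,u)]=\delta_{\gamma,\gamma'}\,\delta_r(a+b)\,\gamma(\Bbbk)^{-(a+b)/r}\,zw\,\delta(z,-w)\cdot\mathrm{Id},$$ and for all $\mathfrak{r}_1,\mathfrak{r}_2\in R$, $$[\mathcal{A}_{\mathfrak{r}_1}(z,u),\mathcal{A}_{\mathfrak{r}_2}(w,u)]=\delta_{\mathfrak{r}_1,-\mathfrak{r}_2}\,|K|\,zw\,\delta(z,-w)\cdot\mathrm{Id}.$$ -/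

import Mathlib

namespace OrbifoldFock

open scoped LaurentSeries PowerSeries

/-! ## The infinite wedge

The integer `n` stands for the half-integer `n + 1/2`, so that `n < 0` means a negative
half-integer. -/

/-- A basis vector `i₁ ∧ i₂ ∧ ⋯` of the infinite wedge, recorded as the set of half-integers that
occur in it. The set agrees with the set of negative half-integers up to finitely many elements. -/
@[ext]
structure Wedge where
  occ : Set ℤ
  finite_diff : (symmDiff occ (Set.Iio 0)).Finite

namespace Wedge

/-- The basis vector with `j` added. -/
def add (S : Wedge) (j : ℤ) : Wedge where
  occ := insert j S.occ
  finite_diff := by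
    refine (S.finite_diff.insert j).subset ?_
    intro x hx
    simp only [Set.mem_symmDiff, Set.mem_insert_iff, Set.mem_Iio] at hx ⊢
    tauto

/-- The basis vector with `j` removed. -/
def remove (S : Wedge) (j : ℤ) : Wedge where
  occ := S.occ \ {j}
  finite_diff := by
    refine (S.finite_diff.insert j).subset ?_
    intro x hx
    simp only [Set.mem_symmDiff, Set.mem_insert_iff, Set.mem_sdiff, Set.mem_singleton_iff,
      Set.mem_Iio] at hx ⊢
    tauto

/-- The sign of moving `j` past all larger entries of the (decreasing) wedge. -/
noncomputable def sign (S : Wedge) (j : ℤ) : ℂ := (-1) ^ {n ∈ S.occ | j < n}.ncard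

/-- The charge: the number of positive half-integers that occur, minus the number of negative
half-integers that are missing. -/
noncomputable def charge (S : Wedge) : ℤ :=
  ((S.occ \ Set.Iio 0).ncard : ℤ) - ((Set.Iio 0 \ S.occ).ncard : ℤ)

end Wedge

/-- The infinite wedge space (all charges): finite linear combinations of the basis vectors. -/
abbrev InfWedge := Wedge →₀ ℂ

open Classical in
/-- The fermionic creation operator `ψ_j`. -/
noncomputable def psi (j : ℤ) : InfWedge →ₗ[ℂ] InfWedge :=
  Finsupp.linearCombination ℂ fun S : Wedge =>
    if j ∈ S.occ then 0 else Finsupp.single (S.add j) (S.sign j)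

open Classical in
/-- The fermionic annihilation operator `ψ*_j`. -/
noncomputable def psiStar (j : ℤ) : InfWedge →ₗ[ℂ] InfWedge :=
  Finsupp.linearCombination ℂ fun S : Wedge =>
    if j ∈ S.occ then Finsupp.single (S.remove j) (S.sign j) else 0

/-- `E_{i,j} = :ψ_i ψ*_j:`, with the normal ordering that is `ψ_i ψ*_j` for `j` positive and
`-ψ*_j ψ_i` for `j` negative. -/
noncomputable def normalE (i j : ℤ) : InfWedge →ₗ[ℂ] InfWedge :=
  if 0 ≤ j then psi i ∘ₗ psiStar j else -(psiStar j ∘ₗ psi i)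

/-- The orthonormal basis `v_λ` of the charge zero part of the infinite wedge. -/
abbrev State := {S : Wedge // S.charge = 0}

/-! ## Formal series in `z`

Operators that depend on `z` are given by their matrices in the basis `v_λ` (rows index the output,
columns the input), with entries in the field `ℂ⸨X⸩` of formal Laurent series in `z = X`. -/

/-- `e ^ (c z)`. -/
noncomputable def expSeries (c : ℂ) : ℂ⟦X⟧ := PowerSeries.rescale c (PowerSeries.exp ℂ)

/-- `ς(c z) = e ^ (c z / 2) - e ^ (- c z / 2)`. -/
noncomputable def sigmaSeries (c : ℂ) : ℂ⟦X⟧ := expSeries (c / 2) - expSeries (-(c / 2))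

/-- `𝒮(c z)`, where `𝒮(x) = ς(x) / x`. -/
noncomputable def sSeries (c : ℂ) : ℂ⟦X⟧ :=
  PowerSeries.rescale c (PowerSeries.mk fun n => PowerSeries.coeff (n + 1) (sigmaSeries 1))

/-- The defining property of `𝒮(c z)`: `c z 𝒮(c z) = ς(c z)`. -/
theorem X_mul_sSeries (c : ℂ) :
    PowerSeries.C c * PowerSeries.X * sSeries c = sigmaSeries c := by
  ext n
  rw [mul_assoc, PowerSeries.coeff_C_mul]
  cases n with
  | zero =>
    simp only [sigmaSeries, expSeries, PowerSeries.coeff_zero_X_mul, mul_zero, map_sub,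
      PowerSeries.coeff_rescale, pow_zero, sub_self]
  | succ n =>
    simp only [PowerSeries.coeff_succ_X_mul, sSeries, sigmaSeries, expSeries,
      PowerSeries.coeff_rescale, PowerSeries.coeff_mk, map_sub]
    have h1 : (c / 2) = c * (1 / 2) := by ring
    have h2 : -(c / 2) = c * (-(1 / 2)) := by ring
    rw [h2, h1, mul_pow, mul_pow]
    ring

/-- The formal power `f ^ g = exp (g log f)`, for a power series `f` with constant term `1`. -/
noncomputable def formalPow (f g : ℂ⟦X⟧) : ℂ⟦X⟧ :=
  (PowerSeries.exp ℂ).subst (g * PowerSeries.logOf f)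

/-- The variable `z` as a Laurent series. -/
noncomputable def zVar : ℂ⸨X⸩ := ((PowerSeries.X : ℂ⟦X⟧) : ℂ⸨X⸩)

/-- A constant as a Laurent series. -/
noncomputable def const (c : ℂ) : ℂ⸨X⸩ := ((PowerSeries.C c : ℂ⟦X⟧) : ℂ⸨X⸩)

/-- The Pochhammer symbol `(x + 1)_n` for `n ∈ ℤ`: it is `(x + 1) ⋯ (x + n)` for `n ≥ 0`, and
`(x (x - 1) ⋯ (x + n + 1))⁻¹` for `n ≤ 0`. -/
noncomputable def poch (x : ℂ⸨X⸩) : ℤ → ℂ⸨X⸩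
  | Int.ofNat n => ∏ j ∈ Finset.range n, (x + ((j + 1 : ℕ) : ℂ⸨X⸩))
  | Int.negSucc n => (∏ j ∈ Finset.range (n + 1), (x - (j : ℂ⸨X⸩)))⁻¹

open Classical in
/-- The matrix of `ℰ_m(c z) = ∑_k e ^ (c z (k - m / 2)) E_{k - m, k} + δ_{m,0} / ς(c z)`, the sum
being over the half-integers `k`, on the charge zero part of the infinite wedge. -/
noncomputable def opE (m : ℤ) (c : ℂ) : Matrix State State ℂ⸨X⸩ := fun T S =>
  (∑ᶠ n : ℤ, ((expSeries (c * (((n : ℂ) + 1 / 2) - (m : ℂ) / 2)) : ℂ⟦X⟧) : ℂ⸨X⸩) *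
      const (normalE (n - m) n (Finsupp.single (S : Wedge) 1) (T : Wedge)))
    + (if m = 0 ∧ T = S then ((sigmaSeries c : ℂ⟦X⟧) : ℂ⸨X⸩)⁻¹ else 0)

/-! ## The group `R = ℤ_r ×_β K` -/

/-- The extension `ℤ_r ×_β K` of `ℤ_r` by `K` with the cocycle `β` that is `𝕜` when adding the
representatives in `{0, …, r - 1}` carries over, and `0` otherwise. -/
@[ext]
structure CocycleExt (r : ℕ) {K : Type*} (𝕜 : K) where
  fst : ZMod r
  snd : K

namespace CocycleExt

variable {r : ℕ} {K : Type*} [AddCommGroup K] {𝕜 : K}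

/-- The cocycle `β`. -/
def cocycle (𝕜 : K) (a b : ZMod r) : K := if r ≤ a.val + b.val then 𝕜 else 0

instance : Zero (CocycleExt r 𝕜) := ⟨⟨0, 0⟩⟩

instance : Add (CocycleExt r 𝕜) :=
  ⟨fun x y => ⟨x.fst + y.fst, x.snd + y.snd + cocycle 𝕜 x.fst y.fst⟩⟩

instance : Neg (CocycleExt r 𝕜) :=
  ⟨fun x => ⟨-x.fst, -x.snd - cocycle 𝕜 (-x.fst) x.fst⟩⟩

theorem zero_def : (0 : CocycleExt r 𝕜) = ⟨0, 0⟩ := rfl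

theorem add_def (x y : CocycleExt r 𝕜) :
    x + y = ⟨x.fst + y.fst, x.snd + y.snd + cocycle 𝕜 x.fst y.fst⟩ := rfl

theorem neg_def (x : CocycleExt r 𝕜) :
    -x = ⟨-x.fst, -x.snd - cocycle 𝕜 (-x.fst) x.fst⟩ := rfl

theorem cocycle_comm (a b : ZMod r) : cocycle 𝕜 a b = cocycle 𝕜 b a := by
  simp [cocycle, Nat.add_comm]

theorem cocycle_zero [NeZero r] (a : ZMod r) : cocycle 𝕜 0 a = 0 := by
  have := ZMod.val_lt a
  simp [cocycle, this]

theorem cocycle_assoc [NeZero r] (a b c : ZMod r) :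
    cocycle 𝕜 a b + cocycle 𝕜 (a + b) c = cocycle 𝕜 b c + cocycle 𝕜 a (b + c) := by
  have ha := ZMod.val_lt a
  have hb := ZMod.val_lt b
  have hc := ZMod.val_lt c
  have key : ∀ x y : ZMod r, x.val < r → y.val < r →
      (x.val + y.val < r ∧ (x + y).val = x.val + y.val) ∨
        (r ≤ x.val + y.val ∧ (x + y).val = x.val + y.val - r) := by
    intro x y hx hy
    rw [ZMod.val_add]
    rcases lt_or_ge (x.val + y.val) r with h | h
    · exact Or.inl ⟨h, Nat.mod_eq_of_lt h⟩
    · refine Or.inr ⟨h, ?_⟩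
      rw [Nat.mod_eq_sub_mod h, Nat.mod_eq_of_lt (by omega)]
  have hab := key a b ha hb
  have hbc := key b c hb hc
  simp only [cocycle]
  split_ifs <;> first | omega | simp

instance [NeZero r] : AddCommGroup (CocycleExt r 𝕜) where
  add_assoc x y z := by
    have h := cocycle_assoc (𝕜 := 𝕜) x.fst y.fst z.fst
    simp only [add_def, CocycleExt.mk.injEq]
    refine ⟨add_assoc _ _ _, ?_⟩
    calc _ = x.snd + y.snd + z.snd
          + (cocycle 𝕜 x.fst y.fst + cocycle 𝕜 (x.fst + y.fst) z.fst) := by abel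
      _ = _ := by rw [h]; abel
  zero_add x := by
    ext <;> simp [add_def, zero_def, cocycle_zero]
  add_zero x := by
    ext <;> simp [add_def, zero_def, cocycle_comm x.fst, cocycle_zero]
  add_comm x y := by
    ext
    · simp [add_def, add_comm]
    · simp [add_def, add_comm, cocycle_comm x.fst]
  neg_add_cancel x := by
    ext
    · simp [add_def, zero_def, neg_def]
    · simp only [add_def, zero_def, neg_def]
      abel
  nsmul := nsmulRec
  zsmul := zsmulRec

end CocycleExt

/-! ## The operators `𝒜` -/

section Operators

variable {K : Type*} [AddCommGroup K] [Finite K]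

/-- The basis `v_λ̄ = ⊗_γ v_{λ^γ}` of the tensor product, over the characters `γ` of `K`, of
copies of the charge zero part of the infinite wedge. -/
abbrev FockBasis (K : Type*) [AddCommGroup K] := AddChar K ℂ → State

open Classical in
/-- The matrix of `M^γ = Id ⊗ ⋯ ⊗ M ⊗ ⋯ ⊗ Id`, with `M` on the component labelled `γ`. -/
noncomputable def onComponent (γ : AddChar K ℂ) (M : Matrix State State ℂ⸨X⸩) :
    Matrix (FockBasis K) (FockBasis K) ℂ⸨X⸩ := fun T S =>
  if ∀ γ', γ' ≠ γ → T γ' = S γ' then M (T γ) (S γ) else 0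

/-- The matrix of `𝒜^γ_{a/r}(z, u)`. Here `ρ` is the chosen `r`-th root of `γ(-𝕜) r`, the group
`R` has order `r |K|`, and the entry is
`(z ρ^a / (z + a)) 𝒮(|R| u z) ^ ((z + a) / r)
  ∑_i z^i 𝒮(|R| u z)^i / (1 + (z + a) / r)_i ⬝ ℰ^γ_{i r + a}(|K| u z)`.
In each entry at most one summand is nonzero. -/
noncomputable def opA (r : ℕ) (ρ : ℂ) (u : ℂ) (γ : AddChar K ℂ) (a : ℕ) :
    Matrix (FockBasis K) (FockBasis K) ℂ⸨X⸩ := fun T S =>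
  let S_R : ℂ⟦X⟧ := sSeries ((r : ℂ) * (Nat.card K : ℂ) * u)
  let e : ℂ⟦X⟧ := PowerSeries.C ((r : ℂ)⁻¹) * (PowerSeries.X + PowerSeries.C (a : ℂ))
  zVar * const (ρ ^ a) / (zVar + const (a : ℂ)) * ((formalPow S_R e : ℂ⟦X⟧) : ℂ⸨X⸩) *
    ∑ᶠ i : ℤ, zVar ^ i * ((S_R : ℂ⟦X⟧) : ℂ⸨X⸩) ^ i / poch ((e : ℂ⟦X⟧) : ℂ⸨X⸩) i *
      onComponent γ (opE (i * (r : ℤ) + (a : ℤ)) ((Nat.card K : ℂ) * u)) T S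

/-- The matrix of `𝒜_𝔯(z, u) = ∑_γ γ(-k) 𝒜^γ_{a/r}(z, u)` for `𝔯 = (a, k) ∈ ℤ_r ×_β K`, where
`0 ≤ a ≤ r - 1`, and where `ρ γ` is the chosen `r`-th root of `γ(-𝕜) r`. -/
noncomputable def opAR {r : ℕ} {𝕜 : K} (ρ : AddChar K ℂ → ℂ) (u : ℂ) (x : CocycleExt r 𝕜) :
    Matrix (FockBasis K) (FockBasis K) ℂ⸨X⸩ :=
  ∑ γ : AddChar K ℂ, γ (-x.snd) • opA r (ρ γ) u γ x.fst.val

end Operators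

/-! ## Formal commutators -/

/-- Formal series `∑_{k, l ∈ ℤ} c_{k, l} z^k w^l`, infinite in all directions. -/
abbrev BiSeries := ℤ → ℤ → ℂ

/-- `δ(z, -w) = (1 / w) ∑_{n ∈ ℤ} (-z / w)^n`. -/
noncomputable def deltaSeries : BiSeries := fun k l => if k + l = -1 then (-1) ^ k else 0

/-- Multiplication of a formal series by `z w`. -/
noncomputable def mulZW (f : BiSeries) : BiSeries := fun k l => f (k - 1) (l - 1)

/-- The coefficient of `z^k` of an operator: a matrix of complex numbers. -/
def coeffOp {ι : Type*} (M : Matrix ι ι ℂ⸨X⸩) (k : ℤ) : Matrix ι ι ℂ := fun T S => (M T S).coeff k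

/-- The composition of two operators is defined: every entry of the product of the (infinite)
matrices is a finite sum. -/
def Composable {ι : Type*} (M N : Matrix ι ι ℂ) : Prop :=
  ∀ T S, (Function.support fun U => M T U * N U S).Finite

/-- The composition of two operators given by infinite matrices. -/
noncomputable def comp {ι : Type*} (M N : Matrix ι ι ℂ) : Matrix ι ι ℂ :=
  fun T S => ∑ᶠ U, M T U * N U S

open Classical in
/-- `[M(z), N(w)] = f(z, w) Id` as formal series in `z` and `w`: for all `k` and `l`, the
compositions of the coefficient of `z^k` in `M(z)` with the coefficient of `w^l` in `N(w)` are
defined in both orders, and their commutator is the coefficient of `z^k w^l` in `f` times the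
identity. -/
def HasCommutator {ι : Type*} (M N : Matrix ι ι ℂ⸨X⸩) (f : BiSeries) : Prop :=
  ∀ k l : ℤ, Composable (coeffOp M k) (coeffOp N l) ∧ Composable (coeffOp N l) (coeffOp M k) ∧
    comp (coeffOp M k) (coeffOp N l) - comp (coeffOp N l) (coeffOp M k)
      = f k l • (1 : Matrix ι ι ℂ)

end OrbifoldFock

open OrbifoldFock

/-!
Put `c = |R| u`, `κ = |K| u = c / r`, `x = (z + a) / r`, `y = (w + b) / r`, `p i = 1 / (1 + x)_i`
and `q j = 1 / (1 + y)_j`. Operators on different tensor factors commute, so only `γ = γ'`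
matters. The commutator of the `i`-th summand of `𝒜_{a/r}(z)` with the `j`-th summand of
`𝒜_{b/r}(w)` consists of operators `E_{n - M, n}` with `M = (i + j) r + a + b` and, if `M = 0`, of
a scalar. The energy grading allows only finitely many pairs `(i, j)` to contribute to a given
matrix element of a given coefficient, and these have a common `N = i + j`.

*The coefficient of `E_{n - M, n}` is zero.* Up to a factor that depends only on `N`, it is the
sum over `i + j = N` of
`z ^ i w ^ j ξ ^ i η ^ j p i q j (1 - e ^ (κ (j r + b) z - κ (i r + a) w))`,
where `e ^ (c z) - 1 = c z ξ` and `1 - e ^ (-c w) = c w η`. Since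
`(j r + b) z - (i r + a) w = r ((y + j) z - (x + i) w)`,
the exponential is `e ^ (c z (y + j)) e ^ (-c w (x + i))`. From `p (i - 1) = (x + i) p i` follows
the binomial theorem
`p i e ^ (-c w (x + i)) = ∑ₘ (e ^ (-c w) - 1) ^ m / m! ⬝ p (i - m)`
(`modX_mul_expOf`), and likewise for `q`. If `V L i j` is the part of degree `L` of the product of
the two expansions (`binomPart`), then
`(L + 1) V (L + 1) i j = (e ^ (c z) - 1) V L i (j - 1) + (e ^ (-c w) - 1) V L (i - 1) j`.
So `∑ V L / (L + 1)` is a discrete primitive: the sum over `i` telescopes (`modX_phiSeries`), and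
its ends have arbitrarily high order in `z` or in `w` (`shiftedSum_termA`).

*The scalar.* Now `N r + a + b = 0`. The sum over `n` is geometric, and `ς(κ (z + w))` times the
`i`-th term is the telescoping difference found above (`sigmaSeries_mul_termB`). Dividing by
`z + w` leaves a multiple of `δ(z, -w)`, given by the value of the primitive at `z = -w`
(`sum_coeff_residue`). There the two exponents `x + i` and `y + j`, with `i + j = N - 1` in the
primitive, add up to `-1`, so the `V L` form a geometric series (`binomPart_neg_neg`),
`∑ V L / (L + 1)` is a logarithm, and all factors cancel except for the one that
is asserted (`residue_eq`, `shiftedSum_termB`).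

The relations for `𝒜_𝔯` follow by the orthogonality of characters.

A formal series in `z` and `w` is a power series in `w` over the polynomials in `z / w`, so that
restricting to `z = -w` is evaluating these polynomials at `-1`. Infinite sums are avoided by
truncating at a power of the variable, that is, by working modulo `X ^ D`.
-/

namespace OrbifoldFock

open PowerSeries Finset
open scoped LaurentSeries

/-! ### Formal exponentials and logarithms -/

section FormalExp

variable {A : Type*} [CommRing A]

/-- A linear differential equation `f' = p f` has at most one solution with a given constant
term. -/
theorem eq_of_derivative_eq_mul [IsAddTorsionFree A] {f g p : A⟦X⟧}
    (hf : d⁄dX A f = p * f) (hg : d⁄dX A g = p * g)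
    (h0 : constantCoeff f = constantCoeff g) : f = g := by
  have key : ∀ n, ∀ m ≤ n, coeff m f = coeff m g := by
    intro n
    induction n with
    | zero =>
      intro m hm
      obtain rfl : m = 0 := by omega
      simpa using h0
    | succ n ih =>
      intro m hm
      rcases Nat.lt_or_ge m (n + 1) with h | h
      · exact ih m (by omega)
      obtain rfl : m = n + 1 := by omega
      have h1 := congrArg (coeff n) hf
      have h2 := congrArg (coeff n) hg
      rw [coeff_derivative, coeff_mul] at h1 h2
      have h3 : coeff (n + 1) f * ((n : A) + 1) = coeff (n + 1) g * ((n : A) + 1) := by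
        rw [h1, h2]
        refine sum_congr rfl fun x hx => ?_
        rw [ih x.2 (by have := mem_antidiagonal.1 hx; omega)]
      rw [← Nat.cast_succ, mul_comm, ← nsmul_eq_mul, mul_comm, ← nsmul_eq_mul] at h3
      exact (smul_right_inj (Nat.succ_ne_zero n)).mp h3
  ext n
  exact key n n le_rfl

theorem derivative_rescale (a : A) (f : A⟦X⟧) :
    d⁄dX A (rescale a f) = C a * rescale a (d⁄dX A f) := by
  ext n
  simp only [coeff_derivative, coeff_rescale, coeff_C_mul]
  ring

variable [Algebra ℚ A]

/-- The exponential `e ^ g` of a power series `g` without constant term. -/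
noncomputable def expOf (g : A⟦X⟧) : A⟦X⟧ := (exp A).subst g

theorem derivative_expOf {g : A⟦X⟧} (hg : constantCoeff g = 0) :
    d⁄dX A (expOf g) = d⁄dX A g * expOf g := by
  rw [expOf, derivative_subst (HasSubst.of_constantCoeff_zero' hg), derivative_exp, mul_comm]

theorem constantCoeff_expOf {g : A⟦X⟧} (hg : constantCoeff g = 0) :
    constantCoeff (expOf g) = 1 := by
  have hs := HasSubst.of_constantCoeff_zero' hg
  have h : expOf g = 1 + (exp A - 1).subst g := by
    rw [subst_sub hs, expOf]
    have : (1 : A⟦X⟧).subst g = (1 : A⟦X⟧) := by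
      rw [← coe_substAlgHom hs, map_one]
    rw [this]; ring
  rw [h, map_add, map_one]
  have := constantCoeff_subst_eq_zero (a := g) hg (exp A - 1) (by simp)
  have h2 : constantCoeff ((exp A - 1).subst g) = 0 := this
  rw [h2, add_zero]

theorem derivative_logOf {f : A⟦X⟧} (hf : constantCoeff f = 1) :
    f * d⁄dX A (logOf f) = d⁄dX A f := by
  have hs : HasSubst (f - 1 : A⟦X⟧) := HasSubst.of_constantCoeff_zero' (by simp [hf])
  have h1 : (1 + X : A⟦X⟧) * d⁄dX A (log A) = 1 := by
    rw [deriv_log]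
    ext n
    rw [add_mul, one_mul, map_add]
    cases n with
    | zero => simp
    | succ n => rw [coeff_succ_X_mul]; simp [pow_succ, coeff_one]
  have h2 := congrArg (subst (f - 1)) h1
  rw [subst_mul hs, subst_add hs, subst_X hs, ← coe_substAlgHom hs, map_one, coe_substAlgHom] at h2
  rw [logOf_eq, derivative_subst hs, map_sub]
  have h3 : (1 + (f - 1) : A⟦X⟧) = f := by ring
  rw [h3] at h2
  rw [← mul_assoc, h2]
  simp

variable [IsAddTorsionFree A]

theorem expOf_add {g h : A⟦X⟧} (hg : constantCoeff g = 0) (hh : constantCoeff h = 0) :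
    expOf (g + h) = expOf g * expOf h := by
  have hgh : constantCoeff (g + h) = 0 := by rw [map_add, hg, hh, add_zero]
  refine eq_of_derivative_eq_mul (p := d⁄dX A (g + h)) (derivative_expOf hgh) ?_ ?_
  · rw [Derivation.leibniz, derivative_expOf hg, derivative_expOf hh, map_add]
    simp only [smul_eq_mul]
    ring
  · rw [map_mul, constantCoeff_expOf hg, constantCoeff_expOf hh, constantCoeff_expOf hgh, one_mul]

theorem expOf_zero : expOf (0 : A⟦X⟧) = 1 :=
  eq_of_derivative_eq_mul (p := 0) (by rw [derivative_expOf (by simp)]; simp) (by simp)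
    (by rw [constantCoeff_expOf (by simp)]; simp)

theorem expOf_C_mul_X (a : A) : expOf (C a * X) = rescale a (exp A) := by
  have h0 : constantCoeff (C a * X : A⟦X⟧) = 0 := by simp
  refine eq_of_derivative_eq_mul (p := C a) ?_ ?_ ?_
  · rw [derivative_expOf h0, Derivation.leibniz]
    simp
  · rw [derivative_rescale, derivative_exp]
  · rw [constantCoeff_expOf h0, ← coeff_zero_eq_constantCoeff_apply, coeff_rescale]
    simp

theorem rescale_expOf (a : A) {g : A⟦X⟧} (hg : constantCoeff g = 0) :
    rescale a (expOf g) = expOf (rescale a g) := by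
  have hc : ∀ f : A⟦X⟧, constantCoeff (rescale a f) = constantCoeff f := by
    intro f
    rw [← coeff_zero_eq_constantCoeff_apply, coeff_rescale]
    simp
  have h0 : constantCoeff (rescale a g) = 0 := by rw [hc, hg]
  refine eq_of_derivative_eq_mul (p := d⁄dX A (rescale a g)) ?_ (derivative_expOf h0) ?_
  · rw [derivative_rescale, derivative_rescale, derivative_expOf hg, map_mul, mul_assoc]
  · rw [hc, constantCoeff_expOf hg, constantCoeff_expOf h0]

theorem expOf_logOf {f : A⟦X⟧} (hf : constantCoeff f = 1) : expOf (logOf f) = f := by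
  have h0 := constantCoeff_logOf hf
  refine eq_of_derivative_eq_mul (derivative_expOf h0) ?_ ?_
  · rw [mul_comm, derivative_logOf hf]
  · rw [constantCoeff_expOf h0, hf]

end FormalExp

/-! ### The binomial theorem with a formal exponent -/

section Truncation

variable {A : Type*} [CommRing A]

/-- Reduction modulo `X ^ D`. -/
noncomputable def modX (D : ℕ) : A⟦X⟧ →+* A⟦X⟧ ⧸ Ideal.span {(X : A⟦X⟧) ^ D} :=
  Ideal.Quotient.mk _

theorem modX_eq_iff {D : ℕ} {f g : A⟦X⟧} :
    modX D f = modX D g ↔ ∀ n < D, coeff n f = coeff n g := by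
  rw [modX, Ideal.Quotient.eq, Ideal.mem_span_singleton, X_pow_dvd_iff]
  simp only [map_sub, sub_eq_zero]

theorem modX_eq_zero_of_dvd {D n : ℕ} {f : A⟦X⟧} (h : (X : A⟦X⟧) ^ n ∣ f) (hn : D ≤ n) :
    modX D f = 0 := by
  rw [modX, Ideal.Quotient.eq_zero_iff_mem, Ideal.mem_span_singleton]
  exact (pow_dvd_pow X hn).trans h

theorem modX_eq_sum_coeff (D : ℕ) (f : A⟦X⟧) :
    modX D f = modX D (∑ d ∈ range D, C (coeff d f) * X ^ d) := by
  rw [modX_eq_iff]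
  intro n hn
  simp [coeff_X_pow, hn]

/-- A product of two families of increasing order, summed over a square or over a triangle. -/
theorem modX_sum_antidiagonal (D : ℕ) (f g : ℕ → A⟦X⟧) (hf : ∀ n, (X : A⟦X⟧) ^ n ∣ f n)
    (hg : ∀ n, (X : A⟦X⟧) ^ n ∣ g n) :
    modX D (∑ L ∈ range D, ∑ x ∈ antidiagonal L, f x.1 * g x.2)
      = modX D (∑ m ∈ range D, f m) * modX D (∑ n ∈ range D, g n) := by
  rw [← map_mul, sum_mul_sum, ← sum_product', sum_sigma', map_sum, map_sum]
  refine sum_of_injOn (fun x => x.2) ?_ ?_ ?_ ?_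
  · rintro ⟨L, m, n⟩ h ⟨L', m', n'⟩ h' heq
    simp only [coe_sigma, Set.mem_sigma_iff, mem_coe, HasAntidiagonal.mem_antidiagonal,
      mem_range] at h h'
    simp only [Prod.mk.injEq] at heq
    obtain ⟨rfl, rfl⟩ := heq
    obtain ⟨-, rfl⟩ := h
    obtain ⟨-, rfl⟩ := h'
    rfl
  · rintro ⟨L, m, n⟩ h
    simp only [coe_sigma, Set.mem_sigma_iff, mem_coe, HasAntidiagonal.mem_antidiagonal, mem_range,
      mem_product] at h ⊢
    omega
  · rintro ⟨m, n⟩ h hn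
    have hD : D ≤ m + n := by
      by_contra hlt
      exact hn ⟨⟨m + n, m, n⟩, by simp; omega, rfl⟩
    exact modX_eq_zero_of_dvd (n := m + n) (by rw [pow_add]; exact mul_dvd_mul (hf m) (hg n)) hD
  · rintro ⟨L, m, n⟩ h
    rfl

end Truncation

section Binomial

/-- The constant `1 / n!` as a power series. -/
noncomputable def invFact (A : Type*) [CommRing A] [Algebra ℚ A] (n : ℕ) : A⟦X⟧ :=
  C (algebraMap ℚ A (1 / n.factorial))

variable {A : Type*} [CommRing A] [Algebra ℚ A]

theorem succ_mul_invFact (n : ℕ) : ((n + 1 : ℕ) : A⟦X⟧) * invFact A (n + 1) = invFact A n := by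
  have h : ((n + 1 : ℕ) : A⟦X⟧) = C (algebraMap ℚ A ((n + 1 : ℕ) : ℚ)) := by
    simp
  rw [h, invFact, invFact, ← map_mul, ← map_mul]
  congr 2
  have : ((n + 1 : ℕ) : ℚ) ≠ 0 := by positivity
  rw [Nat.factorial_succ]
  push_cast
  have h2 : (n.factorial : ℚ) ≠ 0 := by positivity
  field_simp

theorem invFact_zero : invFact A 0 = 1 := by simp [invFact]

theorem modX_expOf (D : ℕ) {g : A⟦X⟧} (hg : constantCoeff g = 0) :
    modX D (expOf g) = modX D (∑ d ∈ range D, invFact A d * g ^ d) := by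
  rw [modX_eq_iff]
  intro n hn
  have hdvd : ∀ d, (X : A⟦X⟧) ^ d ∣ g ^ d := fun d => pow_dvd_pow_of_dvd (X_dvd_iff.2 hg) d
  rw [expOf, coeff_subst' (HasSubst.of_constantCoeff_zero' hg), map_sum]
  rw [finsum_eq_sum_of_support_subset (s := range D)]
  · refine sum_congr rfl fun d _ => ?_
    rw [invFact, coeff_C_mul, coeff_exp, smul_eq_mul]
  · intro d hd
    rw [Function.mem_support] at hd
    simp only [coe_range, Set.mem_Iio]
    by_contra hlt
    apply hd
    rw [X_pow_dvd_iff.1 (hdvd d) n (by omega), smul_zero]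

/-- The coefficients of `e ^ (α t) = ∑ₘ (α choose m) (e ^ t - 1) ^ m`. -/
theorem sum_coeff_exp_sub_one_pow (α : A) {d M : ℕ} (hd : d < M) :
    ∑ m ∈ range M, algebraMap ℚ A (coeff d ((exp ℚ - 1) ^ m) * (1 / m.factorial))
        * Polynomial.aeval α (descPochhammer ℚ m)
      = algebraMap ℚ A (1 / d.factorial) * α ^ d := by
  have hz : ∀ m, d < m → coeff d ((exp ℚ - 1 : ℚ⟦X⟧) ^ m) = 0 := by
    intro m hm
    exact X_pow_dvd_iff.1 (pow_dvd_pow_of_dvd (X_dvd_iff.2 (by simp)) m) d hm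
  -- Both sides are polynomials in `α`, so it suffices to compare them at natural numbers.
  have hpoly : ∑ m ∈ range M, Polynomial.C (coeff d ((exp ℚ - 1 : ℚ⟦X⟧) ^ m) * (1 / m.factorial))
        * descPochhammer ℚ m = Polynomial.C (1 / d.factorial : ℚ) * Polynomial.X ^ d := by
    refine Polynomial.eq_of_infinite_eval_eq _ _
      (Set.Infinite.mono ?_ (Set.infinite_range_of_injective (Nat.cast_injective (R := ℚ))))
    rintro _ ⟨N, rfl⟩
    simp only [Set.mem_ofPred_eq, Polynomial.eval_finsetSum, Polynomial.eval_mul,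
      Polynomial.eval_C, Polynomial.eval_pow, Polynomial.eval_X,
      descPochhammer_eval_eq_descFactorial]
    have h1 : coeff d (exp ℚ ^ N) = (1 / d.factorial : ℚ) * (N : ℚ) ^ d := by
      rw [exp_pow_eq_rescale_exp, coeff_rescale, coeff_exp, mul_comm]; rfl
    rw [← h1]
    have h2 : exp ℚ ^ N = ∑ m ∈ range (N + 1), (exp ℚ - 1) ^ m * (N.choose m : ℚ⟦X⟧) := by
      have := add_pow (exp ℚ - 1) 1 N
      simpa using this
    have h3 : ∀ m, coeff d ((exp ℚ - 1) ^ m * (N.choose m : ℚ⟦X⟧))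
        = coeff d ((exp ℚ - 1 : ℚ⟦X⟧) ^ m) * (1 / m.factorial) * (N.descFactorial m : ℚ) := by
      intro m
      have : (N.choose m : ℚ⟦X⟧) = C (N.choose m : ℚ) := by simp
      rw [this, coeff_mul_C, Nat.descFactorial_eq_factorial_mul_choose]
      push_cast
      have h2 : (m.factorial : ℚ) ≠ 0 := by positivity
      field_simp
    rw [h2, map_sum]
    simp only [h3]
    rcases le_total M (N + 1) with h | h
    · refine sum_subset (range_subset_range.2 h) fun m _ hm => ?_
      rw [hz m (by simp at hm; omega)]; simp
    · refine (sum_subset (range_subset_range.2 h) fun m _ hm => ?_).symm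
      rw [Nat.descFactorial_eq_zero_iff_lt.2 (by simp at hm; omega)]; simp
  have := congrArg (Polynomial.aeval α) hpoly
  simpa [map_sum] using this

/-- The binomial theorem for the formal exponent `α`: if `p i = 1 / Γ(1 + α + i)`, then
`p i e ^ (v t (α + i)) = ∑ₘ (e ^ (v t) - 1) ^ m / m! ⬝ p (i - m)`. -/
theorem modX_mul_expOf (D : ℕ) (v : A) (α : A⟦X⟧) (p : ℤ → A⟦X⟧)
    (hp : ∀ i, p (i - 1) = (α + (i : A⟦X⟧)) * p i) (i : ℤ) :
    modX D (p i * expOf (C v * X * (α + (i : A⟦X⟧))))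
      = modX D (∑ m ∈ range D, invFact A m * (rescale v (exp A) - 1) ^ m * p (i - m)) := by
  have hpm : ∀ m : ℕ, p (i - m)
      = p i * Polynomial.aeval (α + (i : A⟦X⟧)) (descPochhammer ℚ m) := by
    intro m
    induction m with
    | zero => simp
    | succ m ih =>
      have h1 : (i - ((m + 1 : ℕ) : ℤ)) = (i - m) - 1 := by push_cast; ring
      rw [h1, hp, ih, descPochhammer_succ_right, map_mul, map_sub, Polynomial.aeval_X, map_natCast]
      push_cast
      ring
  have hcoeff : ∀ m d, coeff d ((rescale v (exp A) - 1) ^ m)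
      = v ^ d * algebraMap ℚ A (coeff d ((exp ℚ - 1) ^ m)) := by
    intro m d
    have : (rescale v (exp A) - 1) ^ m
        = rescale v (PowerSeries.map (algebraMap ℚ A) ((exp ℚ - 1) ^ m)) := by
      simp [map_pow, map_sub]
    rw [this, coeff_rescale, coeff_map]
  have hq : ∀ q : ℚ, C (algebraMap ℚ A q) = algebraMap ℚ A⟦X⟧ q := fun q => by
    rw [PowerSeries.algebraMap_apply]
  have h1 : ∀ m, modX D (invFact A m * (rescale v (exp A) - 1) ^ m * p (i - m))
      = modX D (∑ d ∈ range D, (C v * X) ^ d * p i *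
        (algebraMap ℚ A⟦X⟧ (coeff d ((exp ℚ - 1) ^ m) * (1 / m.factorial)) *
          Polynomial.aeval (α + (i : A⟦X⟧)) (descPochhammer ℚ m))) := by
    intro m
    rw [map_mul, map_mul, modX_eq_sum_coeff D ((rescale v (exp A) - 1) ^ m), ← map_mul, ← map_mul,
      hpm, mul_sum, sum_mul]
    refine congrArg (modX D) (sum_congr rfl fun d _ => ?_)
    rw [hcoeff, invFact, hq, map_mul, hq, map_mul, map_pow]
    ring
  have h2 : modX D (∑ m ∈ range D, invFact A m * (rescale v (exp A) - 1) ^ m * p (i - m))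
      = modX D (∑ m ∈ range D, ∑ d ∈ range D, (C v * X) ^ d * p i *
        (algebraMap ℚ A⟦X⟧ (coeff d ((exp ℚ - 1) ^ m) * (1 / m.factorial)) *
          Polynomial.aeval (α + (i : A⟦X⟧)) (descPochhammer ℚ m))) := by
    rw [map_sum, map_sum]
    exact sum_congr rfl fun m _ => h1 m
  rw [h2, map_mul, modX_expOf D (by simp), sum_comm, ← map_mul, mul_sum]
  refine congrArg (modX D) (sum_congr rfl fun d hd => ?_)
  rw [← mul_sum, sum_coeff_exp_sub_one_pow _ (mem_range.1 hd), invFact, hq,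
    mul_pow (C v * X) (α + (i : A⟦X⟧))]
  ring

end Binomial

/-! ### The discrete primitive -/

section Telescoping

variable {A : Type*} [CommRing A] [Algebra ℚ A]

/-- The part of degree `L` in `P` and `Q` of the product of the binomial expansions
`∑ₙ P ^ n / n! ⬝ q (j - n)` and `∑ₘ Q ^ m / m! ⬝ p (i - m)`. -/
noncomputable def binomPart (P Q : A⟦X⟧) (p q : ℤ → A⟦X⟧) (L : ℕ) (i j : ℤ) : A⟦X⟧ :=
  ∑ x ∈ antidiagonal L,
    invFact A x.1 * Q ^ x.1 * p (i - x.1) * (invFact A x.2 * P ^ x.2 * q (j - x.2))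

variable (P Q : A⟦X⟧) (p q : ℤ → A⟦X⟧)

theorem binomPart_zero (i j : ℤ) : binomPart P Q p q 0 i j = p i * q j := by
  simp [binomPart, invFact_zero]

theorem succ_mul_binomPart (L : ℕ) (i j : ℤ) :
    ((L + 1 : ℕ) : A⟦X⟧) * binomPart P Q p q (L + 1) i j
      = P * binomPart P Q p q L i (j - 1) + Q * binomPart P Q p q L (i - 1) j := by
  have hsplit : ((L + 1 : ℕ) : A⟦X⟧) * binomPart P Q p q (L + 1) i j
      = (∑ x ∈ antidiagonal (L + 1), invFact A x.1 * Q ^ x.1 * p (i - x.1) *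
          ((x.2 : A⟦X⟧) * invFact A x.2 * P ^ x.2 * q (j - x.2)))
        + ∑ x ∈ antidiagonal (L + 1), (x.1 : A⟦X⟧) * invFact A x.1 * Q ^ x.1 * p (i - x.1) *
          (invFact A x.2 * P ^ x.2 * q (j - x.2)) := by
    rw [binomPart, mul_sum, ← sum_add_distrib]
    refine sum_congr rfl fun x hx => ?_
    rw [← HasAntidiagonal.mem_antidiagonal.1 hx]
    push_cast
    ring
  rw [hsplit, Nat.sum_antidiagonal_succ', Nat.sum_antidiagonal_succ, binomPart, binomPart,
    mul_sum, mul_sum]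
  simp only [Nat.cast_zero, zero_mul, mul_zero, zero_add]
  congr 1
  · refine sum_congr rfl fun x _ => ?_
    have h1 : (j - ((x.2 + 1 : ℕ) : ℤ)) = j - 1 - x.2 := by push_cast; ring
    rw [succ_mul_invFact, h1, pow_succ]
    ring
  · refine sum_congr rfl fun x _ => ?_
    have h1 : (i - ((x.1 + 1 : ℕ) : ℤ)) = i - 1 - x.1 := by push_cast; ring
    rw [succ_mul_invFact, h1, pow_succ]
    ring

/-- The constant `1 / (L + 1)` as a power series. -/
noncomputable def invSucc (A : Type*) [CommRing A] [Algebra ℚ A] (L : ℕ) : A⟦X⟧ :=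
  C (algebraMap ℚ A (1 / ((L + 1 : ℕ) : ℚ)))

theorem invSucc_mul (L : ℕ) : invSucc A L * ((L + 1 : ℕ) : A⟦X⟧) = 1 := by
  have h : ((L + 1 : ℕ) : A⟦X⟧) = C (algebraMap ℚ A ((L + 1 : ℕ) : ℚ)) := by simp
  rw [h, invSucc, ← map_mul, ← map_mul, one_div, inv_mul_cancel₀ (by positivity)]
  simp

/-- The weighted sum of the parts `binomPart`, the weight being `1 / (L + 1)`; the telescoping
identity `modX_sub_mul_exp_eq` shows that its differences are the terms of the commutator. -/
noncomputable def primitive (D : ℕ) (N i : ℤ) : A⟦X⟧ :=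
  ∑ L ∈ range D, invSucc A L * binomPart P Q p q L i (N - 1 - i)

theorem sum_binomPart_succ (D : ℕ) (N i : ℤ) :
    ∑ L ∈ range D, binomPart P Q p q (L + 1) i (N - i)
      = P * primitive P Q p q D N i + Q * primitive P Q p q D N (i - 1) := by
  rw [primitive, primitive, mul_sum, mul_sum, ← sum_add_distrib]
  refine sum_congr rfl fun L _ => ?_
  have h1 : N - i - 1 = N - 1 - i := by ring
  have h2 : N - 1 - (i - 1) = N - i := by ring
  have h := succ_mul_binomPart P Q p q L i (N - i)
  rw [h1] at h
  rw [h2]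
  calc _ = invSucc A L * ((L + 1 : ℕ) : A⟦X⟧) * binomPart P Q p q (L + 1) i (N - i) := by
        rw [invSucc_mul, one_mul]
    _ = _ := by rw [mul_assoc, h]; ring

variable [IsAddTorsionFree A]

/-- If `p i = 1 / Γ(1 + x + i)` and `q j = 1 / Γ(1 + y + j)`, then the terms
`p i q j (1 - e ^ (v t (x + i)) e ^ (v' t (y + j)))` with `i + j = N` are differences. -/
theorem modX_sub_mul_exp_eq (D : ℕ) (v v' : A) (x y : A⟦X⟧)
    (hp : ∀ i, p (i - 1) = (x + (i : A⟦X⟧)) * p i) (hq : ∀ i, q (i - 1) = (y + (i : A⟦X⟧)) * q i)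
    (N i : ℤ) :
    modX D (p i * q (N - i) * (1 - expOf (C v * X * (x + (i : A⟦X⟧))
        + C v' * X * (y + ((N - i : ℤ) : A⟦X⟧)))))
      = modX D (-((rescale v' (exp A) - 1) *
            primitive (rescale v' (exp A) - 1) (rescale v (exp A) - 1) p q D N i
          + (rescale v (exp A) - 1) *
            primitive (rescale v' (exp A) - 1) (rescale v (exp A) - 1) p q D N (i - 1))) := by
  have hX : ∀ a : A, (X : A⟦X⟧) ∣ rescale a (exp A) - 1 := by
    intro a
    rw [X_dvd_iff, map_sub, ← coeff_zero_eq_constantCoeff_apply, coeff_rescale]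
    simp
  have hdvd : ∀ (a : A) (f : ℕ → A⟦X⟧) (n : ℕ),
      (X : A⟦X⟧) ^ n ∣ invFact A n * (rescale a (exp A) - 1) ^ n * f n := fun a f n =>
    Dvd.dvd.mul_right (Dvd.dvd.mul_left (pow_dvd_pow_of_dvd (hX a) n) _) _
  have h1 := modX_sum_antidiagonal (D + 1)
    (fun m => invFact A m * (rescale v (exp A) - 1) ^ m * p (i - m))
    (fun n => invFact A n * (rescale v' (exp A) - 1) ^ n * q (N - i - n))
    (hdvd v fun m => p (i - m)) (hdvd v' fun n => q (N - i - n))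
  rw [← modX_mul_expOf (D + 1) v x p hp i, ← modX_mul_expOf (D + 1) v' y q hq (N - i), ← map_mul,
    sum_range_succ'] at h1
  have h2 := sum_binomPart_succ (rescale v' (exp A) - 1) (rescale v (exp A) - 1) p q D N i
  have h3 := binomPart_zero (rescale v' (exp A) - 1) (rescale v (exp A) - 1) p q i (N - i)
  unfold binomPart at h2 h3
  rw [h2, h3] at h1
  rw [modX_eq_iff] at h1 ⊢
  intro n hn
  have h4 := h1 n (by omega)
  rw [expOf_add (by simp) (by simp), mul_sub, mul_one, map_sub, map_neg]
  rw [map_add] at h4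
  have h5 : p i * q (N - i) * (expOf (C v * X * (x + (i : A⟦X⟧)))
        * expOf (C v' * X * (y + ((N - i : ℤ) : A⟦X⟧))))
      = p i * expOf (C v * X * (x + (i : A⟦X⟧)))
        * (q (N - i) * expOf (C v' * X * (y + ((N - i : ℤ) : A⟦X⟧)))) := by ring
  rw [h5, ← h4]
  ring

end Telescoping

section Residue

variable {A : Type*} [CommRing A] [Algebra ℚ A]

/-- When `x + y + i + j = -1`, all parts of `binomPart (-Y) (-Y)` are given by the geometric
series, because `(1 - Y) ^ (x + i) (1 - Y) ^ (y + j) = (1 - Y) ^ (-1)`. -/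
theorem binomPart_neg_neg (Y x y : A⟦X⟧) (p q : ℤ → A⟦X⟧)
    (hp : ∀ i, p (i - 1) = (x + (i : A⟦X⟧)) * p i) (hq : ∀ i, q (i - 1) = (y + (i : A⟦X⟧)) * q i)
    {i j : ℤ} (h : x + (i : A⟦X⟧) + (y + (j : A⟦X⟧)) = -1) (L : ℕ) :
    binomPart (-Y) (-Y) p q L i j = Y ^ L * (p i * q j) := by
  have key : ∀ (L : ℕ) (i j : ℤ), binomPart (-Y) (-Y) p q L i j
      = (-Y) ^ L * invFact A L * (∏ l ∈ range L, (x + (i : A⟦X⟧) + (y + (j : A⟦X⟧)) - l))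
        * (p i * q j) := by
    intro L
    induction L with
    | zero => intro i j; simp [binomPart_zero, invFact_zero]
    | succ L ih =>
      intro i j
      have h1 := succ_mul_binomPart (-Y) (-Y) p q L i j
      rw [ih, ih, hp, hq] at h1
      have h2 : ∀ f : A⟦X⟧, f = invSucc A L * (((L + 1 : ℕ) : A⟦X⟧) * f) := by
        intro f; rw [← mul_assoc, invSucc_mul, one_mul]
      rw [h2 (binomPart _ _ _ _ _ _ _), h1, ← succ_mul_invFact L, prod_range_succ']
      have h3 : ∏ l ∈ range L, (x + (i : A⟦X⟧) + (y + ((j - 1 : ℤ) : A⟦X⟧)) - l)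
          = ∏ l ∈ range L, (x + (i : A⟦X⟧) + (y + (j : A⟦X⟧)) - ((l + 1 : ℕ) : A⟦X⟧)) :=
        prod_congr rfl fun l _ => by push_cast; ring
      have h4 : ∏ l ∈ range L, (x + ((i - 1 : ℤ) : A⟦X⟧) + (y + (j : A⟦X⟧)) - l)
          = ∏ l ∈ range L, (x + (i : A⟦X⟧) + (y + (j : A⟦X⟧)) - ((l + 1 : ℕ) : A⟦X⟧)) :=
        prod_congr rfl fun l _ => by push_cast; ring
      rw [h3, h4]
      have h5 := invSucc_mul (A := A) L
      linear_combination ((-Y) ^ (L + 1) * invFact A (L + 1) * (x + (i : A⟦X⟧) + (y + (j : A⟦X⟧)))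
        * (∏ l ∈ range L, (x + (i : A⟦X⟧) + (y + (j : A⟦X⟧)) - ((l + 1 : ℕ) : A⟦X⟧)))
        * (p i * q j)) * h5
  rw [key, h]
  have h6 : ∀ L : ℕ, invFact A L * ∏ l ∈ range L, (-1 - (l : A⟦X⟧)) = (-1) ^ L := by
    intro L
    induction L with
    | zero => simp [invFact_zero]
    | succ L ih =>
      rw [prod_range_succ, pow_succ, ← ih, ← succ_mul_invFact L]
      push_cast
      ring
  calc _ = (-Y) ^ L * (invFact A L * ∏ l ∈ range L, (-1 - (l : A⟦X⟧))) * (p i * q j) := by ring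
    _ = _ := by rw [h6, ← mul_pow]; ring

/-- The logarithm series `∑ Yᴸ⁺¹ / (L + 1) = -log (1 - Y)` at `Y = 1 - e ^ (-c t)`. -/
theorem modX_sum_invSucc_mul_pow [IsAddTorsionFree A] (D : ℕ) (c : A) {Y : A⟦X⟧}
    (hY : Y = 1 - rescale (-c) (exp A)) :
    modX D (∑ L ∈ range D, invSucc A L * Y ^ (L + 1)) = modX D (C c * X) := by
  have h0 : constantCoeff Y = 0 := by
    rw [hY, map_sub, ← coeff_zero_eq_constantCoeff_apply, ← coeff_zero_eq_constantCoeff_apply,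
      coeff_rescale]
    simp
  have hdY : d⁄dX A Y = C c * (1 - Y) := by
    rw [hY, map_sub, derivative_rescale, derivative_exp]
    simp
  have hd : d⁄dX A (∑ L ∈ range D, invSucc A L * Y ^ (L + 1)) = C c * (1 - Y ^ D) := by
    rw [map_sum, ← mul_neg_geom_sum, mul_sum, mul_sum]
    refine sum_congr rfl fun L _ => ?_
    rw [Derivation.leibniz, derivative_pow, hdY]
    have h1 : d⁄dX A (invSucc A L) = 0 := derivative_C
    have h2 := invSucc_mul (A := A) L
    rw [h1, smul_zero, add_zero, smul_eq_mul, Nat.add_sub_cancel]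
    linear_combination (Y ^ L * (C c * (1 - Y))) * h2
  rw [modX_eq_iff]
  intro n hn
  cases n with
  | zero =>
    rw [coeff_zero_eq_constantCoeff_apply, coeff_zero_eq_constantCoeff_apply, map_sum]
    simp [h0]
  | succ n =>
    have h1 := congrArg (coeff n) hd
    have h2 : coeff n (Y ^ D) = 0 :=
      X_pow_dvd_iff.1 (pow_dvd_pow_of_dvd (X_dvd_iff.2 h0) D) n (by omega)
    rw [coeff_derivative, coeff_C_mul, map_sub, h2, sub_zero] at h1
    have h3 : coeff n (1 : A⟦X⟧) * ((n : A) + 1) = coeff n (1 : A⟦X⟧) := by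
      rw [coeff_one]; split_ifs with h <;> simp [h]
    have h4 : coeff (n + 1) (C c * X : A⟦X⟧) = c * coeff n (1 : A⟦X⟧) := by
      rw [coeff_C_mul, coeff_X, coeff_one]; simp
    rw [h4]
    have h5 : coeff (n + 1) (∑ L ∈ range D, invSucc A L * Y ^ (L + 1)) * ((n : A) + 1)
        = c * coeff n (1 : A⟦X⟧) * ((n : A) + 1) := by rw [h1, mul_assoc, h3]
    rw [← Nat.cast_succ, mul_comm, ← nsmul_eq_mul, mul_comm, ← nsmul_eq_mul] at h5
    exact (smul_right_inj (Nat.succ_ne_zero n)).mp h5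

end Residue

/-! ### Series in two variables -/

section TwoVariables

/-- A ring of series in two variables `z` and `w`: the power series variable is `w`, and the
polynomial variable is the ratio `z / w`. -/
abbrev TwoVar := (Polynomial ℂ)⟦X⟧

/-- The substitution of `a w` into a power series in one variable, where `a` is a polynomial in
`z / w`. -/
noncomputable def substVar (a : Polynomial ℂ) : ℂ⟦X⟧ →+* TwoVar :=
  (rescale a).comp (PowerSeries.map Polynomial.C)

theorem coeff_substVar (a : Polynomial ℂ) (f : ℂ⟦X⟧) (n : ℕ) :
    coeff n (substVar a f) = a ^ n * Polynomial.C (coeff n f) := by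
  simp [substVar, coeff_rescale]

/-- A series in `z`, as a series in `z` and `w`. -/
noncomputable abbrev inZ : ℂ⟦X⟧ →+* TwoVar := substVar Polynomial.X

/-- A series in `w`, as a series in `z` and `w`. -/
noncomputable abbrev inW : ℂ⟦X⟧ →+* TwoVar := substVar 1

theorem substVar_C (a : Polynomial ℂ) (c : ℂ) :
    substVar a (C c) = C (Polynomial.C c) := by
  ext1 n
  rw [coeff_substVar, coeff_C, coeff_C]
  split_ifs with h
  · simp [h]
  · simp

theorem substVar_X (a : Polynomial ℂ) : substVar a X = C a * X := by
  ext1 n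
  rw [coeff_substVar, coeff_C_mul, coeff_X, coeff_X]
  split_ifs with h
  · simp [h]
  · simp

theorem substVar_expSeries (c : ℂ) (a : Polynomial ℂ) :
    substVar a (expSeries c) = rescale (a * Polynomial.C c) (exp (Polynomial ℂ)) := by
  ext1 n
  rw [coeff_substVar, expSeries, coeff_rescale, coeff_rescale, coeff_exp, coeff_exp, mul_pow,
    map_mul, map_pow, mul_assoc]
  congr 2

theorem expSeries_mul (c d : ℂ) : expSeries c * expSeries d = expSeries (c + d) :=
  exp_mul_exp_eq_exp_add c d

theorem expSeries_zero : expSeries 0 = 1 := by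
  simp [expSeries]

/-- The series whose part of total degree `n` in `z` and `w` is a polynomial: those in the image
of `ℂ⟦z, w⟧`. -/
noncomputable def polySeries : Subring TwoVar where
  carrier := {F | ∀ n, (coeff n F).natDegree ≤ n}
  mul_mem' {F G} hF hG n := by
    rw [coeff_mul]
    refine Polynomial.natDegree_sum_le_of_forall_le _ _ fun x hx => ?_
    refine Polynomial.natDegree_mul_le.trans ?_
    rw [← HasAntidiagonal.mem_antidiagonal.1 hx]
    exact add_le_add (hF _) (hG _)
  one_mem' n := by
    rw [coeff_one]; split_ifs <;> simp
  add_mem' {F G} hF hG n := by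
    rw [map_add]
    exact (Polynomial.natDegree_add_le _ _).trans (max_le (hF n) (hG n))
  zero_mem' n := by simp
  neg_mem' {F} hF n := by
    rw [map_neg, Polynomial.natDegree_neg]
    exact hF n

theorem substVar_mem_polySeries {a : Polynomial ℂ} (ha : a.natDegree ≤ 1) (f : ℂ⟦X⟧) :
    substVar a f ∈ polySeries := by
  intro n
  rw [coeff_substVar]
  refine (Polynomial.natDegree_mul_C_le _ _).trans (Polynomial.natDegree_pow_le.trans ?_)
  nlinarith

theorem inZ_mem (f : ℂ⟦X⟧) : inZ f ∈ polySeries := substVar_mem_polySeries (by simp) f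

theorem inW_mem (f : ℂ⟦X⟧) : inW f ∈ polySeries := substVar_mem_polySeries (by simp) f

theorem C_mem_polySeries (c : ℚ) : C (algebraMap ℚ (Polynomial ℂ) c) ∈ polySeries := by
  intro n
  rw [coeff_C]
  split_ifs
  · have : algebraMap ℚ (Polynomial ℂ) c = Polynomial.C (algebraMap ℚ ℂ c) :=
      (RingHom.congr_fun (RingHom.ext_rat (algebraMap ℚ (Polynomial ℂ))
        ((Polynomial.C).comp (algebraMap ℚ ℂ))) c)
    rw [this]; simp
  · simp

theorem coeff_inZ_mul_inW (f g : ℂ⟦X⟧) (n p : ℕ) :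
    (coeff n (inZ f * inW g)).coeff p = if p ≤ n then coeff p f * coeff (n - p) g else 0 := by
  rw [coeff_mul, Polynomial.finsetSum_coeff]
  have h : ∀ x ∈ antidiagonal n, (coeff x.1 (inZ f) * coeff x.2 (inW g)).coeff p
      = if p = x.1 then coeff x.1 f * coeff x.2 g else 0 := by
    intro x _
    rw [coeff_substVar, coeff_substVar, one_pow, one_mul, mul_assoc, ← Polynomial.C_mul,
      mul_comm, Polynomial.coeff_C_mul, Polynomial.coeff_X_pow]
    split_ifs <;> simp
  rw [sum_congr rfl h]
  rw [Nat.sum_antidiagonal_eq_sum_range_succ_mk, Finset.sum_ite_eq]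
  simp only [mem_range, Nat.lt_succ_iff]

/-- The coefficient of `z ^ k` in a power series, for an integer `k`. -/
noncomputable def intCoeff (f : ℂ⟦X⟧) (k : ℤ) : ℂ := ((f : ℂ⟦X⟧) : ℂ⸨X⸩).coeff k

theorem intCoeff_of_neg (f : ℂ⟦X⟧) {k : ℤ} (hk : k < 0) : intCoeff f k = 0 := by
  rw [intCoeff, PowerSeries.coeff_coe, if_pos hk]

theorem intCoeff_natCast (f : ℂ⟦X⟧) (k : ℕ) : intCoeff f k = coeff k f := by
  rw [intCoeff, PowerSeries.coeff_coe, if_neg (by omega)]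
  simp

/-- The coefficient of `z ^ p w ^ q` of a series in two variables. -/
noncomputable def biCoeff (p q : ℕ) : TwoVar →+ ℂ :=
  (Polynomial.lcoeff ℂ p).toAddMonoidHom.comp
    (coeff (R := Polynomial ℂ) (p + q)).toAddMonoidHom

theorem biCoeff_apply (p q : ℕ) (F : TwoVar) : biCoeff p q F = (coeff (p + q) F).coeff p := rfl

theorem biCoeff_mul (f g : ℂ⟦X⟧) (p q : ℕ) :
    biCoeff p q (inZ f * inW g) = coeff p f * coeff q g := by
  rw [biCoeff_apply, coeff_inZ_mul_inW, if_pos (by omega), Nat.add_sub_cancel_left]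

/-- The coefficient of `z ^ k w ^ l` in `∑ᵢ z ^ i w ^ (N - i) t i`. -/
noncomputable def shiftedSum (t : ℤ → TwoVar) (N k l : ℤ) : ℂ :=
  ∑ i ∈ Icc (N - l) k, biCoeff (k - i).toNat (l - (N - i)).toNat (t i)

theorem shiftedSum_eq (t : ℤ → TwoVar) {N k l : ℤ} {n : ℕ} (hn : k + l = N + n) :
    shiftedSum t N k l = ∑ p ∈ range (n + 1), (coeff n (t (k - p))).coeff p := by
  rw [shiftedSum]
  refine sum_nbij' (fun i => (k - i).toNat) (fun p => k - p) ?_ ?_ ?_ ?_ ?_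
  · intro i hi
    have := mem_Icc.1 hi
    simp only [mem_range]
    omega
  · intro p hp
    have := mem_range.1 hp
    rw [mem_Icc]
    omega
  · intro i hi
    have := mem_Icc.1 hi
    omega
  · intro p hp
    have := mem_range.1 hp
    simp
  · intro i hi
    have := mem_Icc.1 hi
    have h1 : (k - i).toNat + (l - (N - i)).toNat = n := by omega
    have h2 : k - ((k - i).toNat : ℤ) = i := by omega
    rw [biCoeff_apply, h1, h2]

theorem shiftedSum_of_lt (t : ℤ → TwoVar) {N k l : ℤ} (h : k + l < N) :
    shiftedSum t N k l = 0 := by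
  rw [shiftedSum, Icc_eq_empty (by omega), sum_empty]

theorem sum_coeff_telescope (K : ℤ → Polynomial ℂ) (n : ℕ) (hK : ∀ i, (K i).coeff n = 0) (k : ℤ) :
    ∑ p ∈ range (n + 1), (K (k - p - 1) - Polynomial.X * K (k - p)).coeff p = 0 := by
  have h : ∀ m : ℕ, ∑ p ∈ range (m + 1), (K (k - p - 1) - Polynomial.X * K (k - p)).coeff p
      = (K (k - m - 1)).coeff m := by
    intro m
    induction m with
    | zero => simp
    | succ m ih =>
      rw [sum_range_succ, ih, Polynomial.coeff_sub, Polynomial.coeff_X_mul]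
      have : k - ((m + 1 : ℕ) : ℤ) = k - m - 1 := by push_cast; ring
      rw [this]
      ring
  rw [h, hK]

/-- A sum of terms `(K (i - 1) - (z / w) K i) / (1 + z / w)` telescopes, except that the values of
the `K i` at `z = -w` contribute. -/
theorem sum_coeff_residue (t K : ℤ → Polynomial ℂ) (n : ℕ) (hK : ∀ i, (K i).natDegree ≤ n)
    (ht : ∀ i, (1 + Polynomial.X) * t i = K (i - 1) - Polynomial.X * K i) (k : ℤ) :
    ∑ p ∈ range (n + 1), (t (k - p)).coeff p = (-1) ^ (k - 1) * (K 0).eval (-1) := by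
  set e : ℤ → ℂ := fun i => (K i).eval (-1) with he
  have hstep : ∀ i, e (i - 1) = - e i := by
    intro i
    have := congrArg (Polynomial.eval (-1)) (ht i)
    simp only [Polynomial.eval_mul, Polynomial.eval_add, Polynomial.eval_one, Polynomial.eval_X,
      Polynomial.eval_sub] at this
    simp only [he]
    linear_combination -this
  have he0 : ∀ i, e i = (-1) ^ i * e 0 := by
    intro i
    induction i using Int.induction_on with
    | zero => simp
    | succ i ih =>
      have := hstep (i + 1)
      rw [add_sub_cancel_right] at this
      rw [zpow_add_one₀ (by norm_num), ← neg_eq_iff_eq_neg.2 this, ih]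
      ring
    | pred i ih =>
      rw [hstep, ih, zpow_sub_one₀ (by norm_num)]
      ring
  have hdvd : ∀ i, ∃ q, K i - Polynomial.C (e i) = (1 + Polynomial.X) * q := by
    intro i
    obtain ⟨q, hq⟩ := Polynomial.X_sub_C_dvd_sub_C_eval (a := (-1 : ℂ)) (p := K i)
    exact ⟨q, by
      rw [hq, Polynomial.C_neg, Polynomial.C_1, sub_neg_eq_add, add_comm]⟩
  choose q hq using hdvd
  have h1X : (1 + Polynomial.X : Polynomial ℂ) = Polynomial.X + Polynomial.C 1 := by
    rw [Polynomial.C_1, add_comm]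
  have h1X0 : (1 + Polynomial.X : Polynomial ℂ) ≠ 0 := by
    rw [h1X]; exact Polynomial.X_add_C_ne_zero 1
  have hqdeg : ∀ i, (q i).coeff n = 0 := by
    intro i
    by_cases h0 : q i = 0
    · simp [h0]
    apply Polynomial.coeff_eq_zero_of_natDegree_lt
    have h2 : (K i - Polynomial.C (e i)).natDegree ≤ n := by
      refine (Polynomial.natDegree_sub_le _ _).trans (max_le (hK i) (by simp))
    rw [hq, Polynomial.natDegree_mul h1X0 h0, h1X, Polynomial.natDegree_X_add_C] at h2
    omega
  have htq : ∀ i, t i = Polynomial.C (e (i - 1)) + (q (i - 1) - Polynomial.X * q i) := by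
    intro i
    apply mul_left_cancel₀ h1X0
    have h3 := hq i
    have h4 := hq (i - 1)
    have h5 : Polynomial.C (e i) = - Polynomial.C (e (i - 1)) := by rw [hstep, map_neg, neg_neg]
    rw [ht]
    rw [h5] at h3
    linear_combination h4 - Polynomial.X * h3
  have hsum : ∑ p ∈ range (n + 1), (t (k - p)).coeff p
      = ∑ p ∈ range (n + 1), (Polynomial.C (e (k - p - 1))).coeff p
        + ∑ p ∈ range (n + 1), (q (k - p - 1) - Polynomial.X * q (k - p)).coeff p := by
    rw [← sum_add_distrib]
    refine sum_congr rfl fun p _ => ?_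
    rw [htq, Polynomial.coeff_add]
  rw [hsum, sum_coeff_telescope q n hqdeg, add_zero, sum_eq_single 0]
  · rw [Polynomial.coeff_C_zero]
    rw [he0]
    simp [he]
  · intro p _ hp
    rw [Polynomial.coeff_C, if_neg hp]
  · simp

end TwoVariables

/-! ### The coefficients of the operators as power series -/

section OneVariable

/-- The series `1 / (x + 1)_i`. -/
noncomputable def pochInv (x : ℂ⟦X⟧) : ℤ → ℂ⟦X⟧
  | Int.ofNat n => ∏ j ∈ range n, (x + ((j + 1 : ℕ) : ℂ⟦X⟧))⁻¹
  | Int.negSucc n => ∏ j ∈ range (n + 1), (x - (j : ℂ⟦X⟧))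

theorem pochInv_sub_one {x : ℂ⟦X⟧} (hx : ∀ j : ℕ, constantCoeff x + ((j + 1 : ℕ) : ℂ) ≠ 0) (i : ℤ) :
    pochInv x (i - 1) = (x + (i : ℂ⟦X⟧)) * pochInv x i := by
  rcases i with n | n
  · cases n with
    | zero =>
      have : (Int.ofNat 0 - 1) = Int.negSucc 0 := rfl
      rw [this]
      simp [pochInv]
    | succ n =>
      have h1 : (Int.ofNat (n + 1) - 1) = Int.ofNat n := by
        simp only [Int.ofNat_eq_natCast]; push_cast; ring
      have h2 : (x + ((n + 1 : ℕ) : ℂ⟦X⟧)) * (x + ((n + 1 : ℕ) : ℂ⟦X⟧))⁻¹ = 1 := by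
        apply PowerSeries.mul_inv_cancel
        rw [map_add, map_natCast]
        exact hx n
      rw [h1]
      simp only [pochInv, prod_range_succ, Int.ofNat_eq_natCast, Int.cast_natCast]
      linear_combination (-(∏ j ∈ range n, (x + ((j + 1 : ℕ) : ℂ⟦X⟧))⁻¹)) * h2
  · have h1 : Int.negSucc n - 1 = Int.negSucc (n + 1) := by
      rw [Int.negSucc_eq, Int.negSucc_eq]; push_cast; ring
    rw [h1]
    simp only [pochInv]
    rw [prod_range_succ _ (n + 1), Int.negSucc_eq]
    push_cast
    ring

theorem coe_pochInv {x : ℂ⟦X⟧} (hx : ∀ j : ℕ, constantCoeff x + ((j + 1 : ℕ) : ℂ) ≠ 0) (i : ℤ) :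
    ((pochInv x i : ℂ⟦X⟧) : ℂ⸨X⸩) = (poch (x : ℂ⸨X⸩) i)⁻¹ := by
  rcases i with n | n
  · simp only [pochInv, poch]
    rw [map_prod, ← prod_inv_distrib]
    refine prod_congr rfl fun j _ => ?_
    have h2 : (x + ((j + 1 : ℕ) : ℂ⟦X⟧)) * (x + ((j + 1 : ℕ) : ℂ⟦X⟧))⁻¹ = 1 := by
      apply PowerSeries.mul_inv_cancel
      rw [map_add, map_natCast]
      exact hx j
    have h3 := congrArg (HahnSeries.ofPowerSeries ℤ ℂ) h2
    rw [map_mul, map_one, map_add, map_natCast] at h3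
    exact eq_inv_of_mul_eq_one_right h3
  · simp only [pochInv, poch]
    rw [map_prod, inv_inv]
    refine prod_congr rfl fun j _ => ?_
    rw [map_sub, map_natCast]

theorem constantCoeff_sSeries (c : ℂ) : constantCoeff (sSeries c) = 1 := by
  rw [← coeff_zero_eq_constantCoeff_apply, sSeries, coeff_rescale, coeff_mk, sigmaSeries, expSeries,
    expSeries, map_sub, coeff_rescale, coeff_rescale]
  simp
  norm_num

/-- `𝒮(-c z) = 𝒮(c z)`. -/
theorem rescale_neg_one_sSeries (c : ℂ) : rescale (-1) (sSeries c) = sSeries c := by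
  ext n
  rw [coeff_rescale, sSeries, coeff_rescale, coeff_mk, sigmaSeries, expSeries, expSeries, map_sub,
    coeff_rescale, coeff_rescale, neg_pow (1 / 2 : ℂ) (n + 1)]
  rcases Nat.even_or_odd n with h | h
  · rw [h.neg_one_pow]; ring
  · rw [h.neg_one_pow, pow_succ (-1 : ℂ) n, h.neg_one_pow]; ring

/-- The unit `𝒮(c z)`. -/
noncomputable def sUnit (c : ℂ) : ℂ⟦X⟧ˣ where
  val := sSeries c
  inv := (sSeries c)⁻¹
  val_inv := PowerSeries.mul_inv_cancel _ (by rw [constantCoeff_sSeries]; exact one_ne_zero)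
  inv_val := PowerSeries.inv_mul_cancel _ (by rw [constantCoeff_sSeries]; exact one_ne_zero)

/-- The unit `e ^ (c z)`. -/
noncomputable def expUnit (c : ℂ) : ℂ⟦X⟧ˣ where
  val := expSeries c
  inv := expSeries (-c)
  val_inv := by rw [expSeries_mul, add_neg_cancel, expSeries_zero]
  inv_val := by rw [expSeries_mul, neg_add_cancel, expSeries_zero]

theorem expUnit_mul (c d : ℂ) : expUnit c * expUnit d = expUnit (c + d) :=
  Units.ext (expSeries_mul c d)

theorem expUnit_zpow (c : ℂ) (i : ℤ) : expUnit c ^ i = expUnit (i * c) := by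
  have h0 : expUnit 0 = 1 := Units.ext expSeries_zero
  have hinv : ∀ d, (expUnit d)⁻¹ = expUnit (-d) := fun d => Units.ext rfl
  induction i using Int.induction_on with
  | zero => simp [h0]
  | succ i ih =>
    rw [zpow_add_one, ih, expUnit_mul]
    congr 1; push_cast; ring
  | pred i ih =>
    rw [zpow_sub_one, ih, hinv, expUnit_mul]
    congr 1; push_cast; ring

theorem expSeries_sub_one (c : ℂ) :
    expSeries c - 1 = C c * X * (sSeries c * expSeries (c / 2)) := by
  rw [← mul_assoc, X_mul_sSeries, sigmaSeries, sub_mul, expSeries_mul, expSeries_mul,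
    neg_add_cancel, expSeries_zero, add_halves]

theorem expSeries_neg_sub_one (c : ℂ) :
    expSeries (-c) - 1 = -(C c * X * (sSeries c * expSeries (-(c / 2)))) := by
  rw [← mul_assoc, X_mul_sSeries, sigmaSeries, sub_mul, expSeries_mul, expSeries_mul,
    add_neg_cancel, expSeries_zero, ← neg_add, add_halves]
  ring

/-- The exponent `(z + a) / r`. -/
noncomputable def expo (r a : ℕ) : ℂ⟦X⟧ := C ((r : ℂ)⁻¹) * (X + C (a : ℂ))

theorem constantCoeff_expo_add_ne_zero (r a : ℕ) (j : ℕ) :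
    constantCoeff (expo r a) + ((j + 1 : ℕ) : ℂ) ≠ 0 := by
  have h : constantCoeff (expo r a) + ((j + 1 : ℕ) : ℂ)
      = (((r : ℝ)⁻¹ * a + (j + 1 : ℕ) : ℝ) : ℂ) := by
    simp [expo]
  rw [h]
  have : (0 : ℝ) < (r : ℝ)⁻¹ * a + (j + 1 : ℕ) := by positivity
  exact_mod_cast this.ne'

/-- The series `z / (z + a)`. -/
noncomputable def zFrac (a : ℕ) : ℂ⟦X⟧ := if a = 0 then 1 else X * (X + C (a : ℂ))⁻¹

theorem coe_zFrac (a : ℕ) :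
    ((zFrac a : ℂ⟦X⟧) : ℂ⸨X⸩) = zVar / (zVar + const (a : ℂ)) := by
  have hz : zVar ≠ 0 := by
    rw [zVar, PowerSeries.coe_X]
    exact HahnSeries.single_ne_zero one_ne_zero
  rcases eq_or_ne a 0 with rfl | ha
  · simp [zFrac, const, hz]
  · have h2 : (X + C (a : ℂ) : ℂ⟦X⟧) * (X + C (a : ℂ))⁻¹ = 1 := by
      apply PowerSeries.mul_inv_cancel
      simp [ha]
    have h3 := congrArg (HahnSeries.ofPowerSeries ℤ ℂ) h2
    rw [map_mul, map_one, map_add] at h3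
    rw [zFrac, if_neg ha, map_mul, eq_inv_of_mul_eq_one_right h3]
    rfl

/-- The power series factor of the coefficient of `ℰ_{i r + a}` in `𝒜_{a / r}`: what remains after
a power of the chosen root and the factor `z ^ i` are taken out. -/
noncomputable def coeffA (r : ℕ) (c : ℂ) (a : ℕ) (i : ℤ) : ℂ⟦X⟧ :=
  zFrac a * formalPow (sSeries c) (expo r a) * ((sUnit c ^ i : ℂ⟦X⟧ˣ) : ℂ⟦X⟧) * pochInv (expo r a) i

end OneVariable

/-! ### Telescoping of the commutator -/

section Core

/-- The unit `(e ^ (c z) - 1) / (c z)`. -/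
noncomputable def xiUnit (c : ℂ) : ℂ⟦X⟧ˣ := sUnit c * expUnit (c / 2)

/-- The unit `(1 - e ^ (-c w)) / (c w)`. -/
noncomputable def etaUnit (c : ℂ) : ℂ⟦X⟧ˣ := sUnit c * expUnit (-(c / 2))

/-- The series `k i` whose differences `k (i - 1) - (z / w) k i` are, up to a common factor, the
terms of the commutator; see `modX_phiSeries`. The sum that defines it is truncated at `D`. -/
noncomputable def kSeries (r a b : ℕ) (c : ℂ) (D : ℕ) (N i : ℤ) : TwoVar :=
  C (Polynomial.C c) * X * inZ ((xiUnit c ^ (i + 1) : ℂ⟦X⟧ˣ) : ℂ⟦X⟧) *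
    inW ((etaUnit c ^ (N - i) : ℂ⟦X⟧ˣ) : ℂ⟦X⟧) *
    primitive (inZ (expSeries c) - 1) (inW (expSeries (-c)) - 1)
      (fun i => inZ (pochInv (expo r a) i)) (fun j => inW (pochInv (expo r b) j)) D N i

/-- The coefficient `ξ ^ i η ^ (N - i) p i q (N - i)` of the `i`-th term of the commutator. -/
noncomputable def phiSeries (r a b : ℕ) (c : ℂ) (N i : ℤ) : TwoVar :=
  inZ (((xiUnit c ^ i : ℂ⟦X⟧ˣ) : ℂ⟦X⟧) * pochInv (expo r a) i) *
    inW (((etaUnit c ^ (N - i) : ℂ⟦X⟧ˣ) : ℂ⟦X⟧) * pochInv (expo r b) (N - i))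

theorem pochInv_expo_sub_one (r a : ℕ) (a' : Polynomial ℂ) (i : ℤ) :
    substVar a' (pochInv (expo r a) (i - 1))
      = (substVar a' (expo r a) + (i : TwoVar)) * substVar a' (pochInv (expo r a) i) := by
  rw [pochInv_sub_one (constantCoeff_expo_add_ne_zero r a), map_mul, map_add, map_intCast]

theorem substVar_expo (r a : ℕ) (a' : Polynomial ℂ) :
    substVar a' (expo r a)
      = C (Polynomial.C ((r : ℂ)⁻¹)) * (C a' * X + C (Polynomial.C (a : ℂ))) := by
  rw [expo, map_mul, map_add, substVar_C, substVar_C, substVar_X]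

/-- The terms of the commutator are differences. -/
theorem modX_phiSeries (r : ℕ) [NeZero r] (a b : ℕ) (κ : ℂ) (D : ℕ) (N i : ℤ) :
    modX D (phiSeries r a b (r * κ) N i *
        (1 - inZ (expSeries (κ * ((N - i : ℤ) * r + b))) * inW (expSeries (-(κ * (i * r + a))))))
      = modX D (kSeries r a b (r * κ) D N (i - 1)
          - C Polynomial.X * kSeries r a b (r * κ) D N i) := by
  set c : ℂ := r * κ with hc
  have hr : (r : ℂ) ≠ 0 := Nat.cast_ne_zero.2 (NeZero.ne r)
  have hcr : c * (r : ℂ)⁻¹ = κ := by rw [hc]; field_simp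
  have hP : rescale (Polynomial.X * Polynomial.C c) (exp (Polynomial ℂ)) - 1
      = inZ (expSeries c) - 1 := by rw [substVar_expSeries]
  have hQ : rescale (Polynomial.C (-c)) (exp (Polynomial ℂ)) - 1
      = inW (expSeries (-c)) - 1 := by rw [substVar_expSeries, one_mul]
  have h := modX_sub_mul_exp_eq (fun i => inZ (pochInv (expo r a) i))
    (fun j => inW (pochInv (expo r b) j)) D (Polynomial.C (-c)) (Polynomial.X * Polynomial.C c)
    (inZ (expo r a)) (inW (expo r b)) (fun i => pochInv_expo_sub_one r a _ i)
    (fun i => pochInv_expo_sub_one r b _ i) N i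
  -- The terms `z w` of the exponent cancel.
  have hexp : C (Polynomial.C (-c)) * X * (inZ (expo r a) + (i : TwoVar))
        + C (Polynomial.X * Polynomial.C c) * X * (inW (expo r b) + ((N - i : ℤ) : TwoVar))
      = C (Polynomial.X * Polynomial.C (κ * ((N - i : ℤ) * r + b))
          + Polynomial.C (-(κ * (i * r + a)))) * X := by
    have h1 : ∀ m : ℤ, (m : TwoVar) = C (Polynomial.C (m : ℂ)) := by intro m; simp
    have h2 : C (Polynomial.C c) * C (Polynomial.C ((r : ℂ)⁻¹)) = C (Polynomial.C κ) := by
      rw [← map_mul, ← map_mul, hcr]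
    have h3 : C (Polynomial.C c) = C (Polynomial.C (r : ℂ)) * C (Polynomial.C κ) := by
      rw [← map_mul, ← map_mul]
    rw [substVar_expo, substVar_expo, h1, h1]
    simp only [map_mul, map_add, map_neg, map_one]
    linear_combination (C Polynomial.X * X * C (Polynomial.C (b : ℂ))
        - X * C (Polynomial.C (a : ℂ))) * h2 +
      (C Polynomial.X * X * C (Polynomial.C ((N - i : ℤ) : ℂ)) - X * C (Polynomial.C (i : ℂ))) * h3
  have hexp' : expOf (C (Polynomial.X * Polynomial.C (κ * ((N - i : ℤ) * r + b))
          + Polynomial.C (-(κ * (i * r + a)))) * X)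
      = inZ (expSeries (κ * ((N - i : ℤ) * r + b))) * inW (expSeries (-(κ * (i * r + a)))) := by
    rw [expOf_C_mul_X, ← exp_mul_exp_eq_exp_add, substVar_expSeries, substVar_expSeries, one_mul]
  rw [hexp, hexp', hP, hQ] at h
  have hF : phiSeries r a b c N i = inZ ((xiUnit c ^ i : ℂ⟦X⟧ˣ) : ℂ⟦X⟧) *
      inW ((etaUnit c ^ (N - i) : ℂ⟦X⟧ˣ) : ℂ⟦X⟧) *
      (inZ (pochInv (expo r a) i) * inW (pochInv (expo r b) (N - i))) := by
    rw [phiSeries, map_mul, map_mul]; ring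
  rw [hF, mul_assoc, map_mul, h, ← map_mul]
  have hx : inZ (expSeries c) - 1
      = C Polynomial.X * C (Polynomial.C c) * X * inZ ((xiUnit c : ℂ⟦X⟧ˣ) : ℂ⟦X⟧) := by
    have := congrArg inZ (expSeries_sub_one c)
    rw [map_sub, map_one, map_mul, map_mul, substVar_C, substVar_X] at this
    rw [this]
    have h2 : ((xiUnit c : ℂ⟦X⟧ˣ) : ℂ⟦X⟧) = sSeries c * expSeries (c / 2) := rfl
    rw [h2]
    ring
  have hy : inW (expSeries (-c)) - 1
      = -(C (Polynomial.C c) * X * inW ((etaUnit c : ℂ⟦X⟧ˣ) : ℂ⟦X⟧)) := by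
    have := congrArg inW (expSeries_neg_sub_one c)
    rw [map_sub, map_one, map_neg, map_mul, map_mul, substVar_C, substVar_X] at this
    rw [this]
    have h2 : ((etaUnit c : ℂ⟦X⟧ˣ) : ℂ⟦X⟧) = sSeries c * expSeries (-(c / 2)) := rfl
    rw [h2, map_one, one_mul]
  have hk1 : N - (i - 1) = N - i + 1 := by ring
  refine congrArg (modX D) ?_
  rw [kSeries, kSeries, hk1, sub_add_cancel, zpow_add_one, zpow_add_one, Units.val_mul,
    Units.val_mul, map_mul inZ, map_mul inW]
  generalize primitive (inZ (expSeries c) - 1) (inW (expSeries (-c)) - 1) _ _ D N i = k1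
  generalize primitive (inZ (expSeries c) - 1) (inW (expSeries (-c)) - 1) _ _ D N (i - 1) = k0
  rw [hx, hy]
  clear_value c
  ring

end Core

/-! ### The terms of the commutator -/

section Vanishing

/-- The factor of `coeffA` that does not depend on `i`. -/
noncomputable def preA (r : ℕ) (c : ℂ) (a : ℕ) : ℂ⟦X⟧ :=
  zFrac a * formalPow (sSeries c) (expo r a)

theorem coe_zpow_mul (c d : ℂ) (i : ℤ) :
    (((sUnit c * expUnit d) ^ i : ℂ⟦X⟧ˣ) : ℂ⟦X⟧)
      = ((sUnit c ^ i : ℂ⟦X⟧ˣ) : ℂ⟦X⟧) * expSeries (i * d) := by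
  rw [mul_zpow, expUnit_zpow, Units.val_mul]
  rfl

/-- The summand with index `i` of the coefficient of `E_{n - M, n}` in the commutator
`[𝒜_{a/r}(z), 𝒜_{b/r}(w)]`, where `M = N r + a + b`, and where `h = n + 1 / 2 - M / 2` is the
midpoint of the two half-integers. Powers of `z`, `w` and of the chosen roots are left out. -/
noncomputable def termA (r a b : ℕ) (κ : ℂ) (N : ℤ) (h : ℂ) (i : ℤ) : TwoVar :=
  inZ (coeffA r (r * κ) a i * expSeries (κ * (h - ((N - i : ℤ) * r + b) / 2))) *
      inW (coeffA r (r * κ) b (N - i) * expSeries (κ * (h + (i * r + a) / 2))) -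
    inZ (coeffA r (r * κ) a i * expSeries (κ * (h + ((N - i : ℤ) * r + b) / 2))) *
      inW (coeffA r (r * κ) b (N - i) * expSeries (κ * (h - (i * r + a) / 2)))

/-- The factor of `termA` that does not depend on `i`. -/
noncomputable def commonFactor (r a b : ℕ) (κ : ℂ) (N : ℤ) (h : ℂ) : TwoVar :=
  inZ (preA r (r * κ) a * expSeries (κ * h - κ / 2 * (N * r + b))) *
    inW (preA r (r * κ) b * expSeries (κ * h + κ / 2 * (N * r + a)))

theorem termA_eq (r a b : ℕ) (κ : ℂ) (N : ℤ) (h : ℂ) (i : ℤ) :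
    termA r a b κ N h i = commonFactor r a b κ N h * (phiSeries r a b (r * κ) N i *
      (1 - inZ (expSeries (κ * ((N - i : ℤ) * r + b))) *
        inW (expSeries (-(κ * (i * r + a)))))) := by
  have e1 : expSeries (κ * (h - ((N - i : ℤ) * r + b) / 2))
      = expSeries (κ * h - κ / 2 * (N * r + b)) * expSeries (i * (r * κ / 2)) := by
    rw [expSeries_mul]; congr 1; push_cast; ring
  have e2 : expSeries (κ * (h + (i * r + a) / 2))
      = expSeries (κ * h + κ / 2 * (N * r + a)) * expSeries ((N - i : ℤ) * (-(r * κ / 2))) := by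
    rw [expSeries_mul]; congr 1; push_cast; ring
  have e3 : expSeries (κ * (h + ((N - i : ℤ) * r + b) / 2))
      = expSeries (κ * h - κ / 2 * (N * r + b)) * expSeries (i * (r * κ / 2))
        * expSeries (κ * ((N - i : ℤ) * r + b)) := by
    rw [expSeries_mul, expSeries_mul]; congr 1; push_cast; ring
  have e4 : expSeries (κ * (h - (i * r + a) / 2))
      = expSeries (κ * h + κ / 2 * (N * r + a)) * expSeries ((N - i : ℤ) * (-(r * κ / 2)))
        * expSeries (-(κ * (i * r + a))) := by
    rw [expSeries_mul, expSeries_mul]; congr 1; push_cast; ring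
  rw [termA, commonFactor, phiSeries, xiUnit, etaUnit, coe_zpow_mul, coe_zpow_mul, e1, e2, e3, e4,
    coeffA, coeffA, preA, preA]
  simp only [map_mul inZ, map_mul inW]
  ring

theorem binomPart_mem {P Q : TwoVar} {p q : ℤ → TwoVar} (hP : P ∈ polySeries)
    (hQ : Q ∈ polySeries) (hp : ∀ i, p i ∈ polySeries) (hq : ∀ i, q i ∈ polySeries) (L : ℕ)
    (i j : ℤ) : binomPart P Q p q L i j ∈ polySeries :=
  Subring.sum_mem _ fun _ _ => Subring.mul_mem _
    (Subring.mul_mem _ (Subring.mul_mem _ (C_mem_polySeries _) (Subring.pow_mem _ hQ _)) (hp _))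
    (Subring.mul_mem _ (Subring.mul_mem _ (C_mem_polySeries _) (Subring.pow_mem _ hP _)) (hq _))

/-- The series `k i` is `w` times a series in `z` and `w`, which makes the ends of the telescoping
sum vanish. -/
theorem kSeries_eq_X_mul (r a b : ℕ) (c : ℂ) (D : ℕ) (N i : ℤ) :
    ∃ F ∈ polySeries, kSeries r a b c D N i = X * F := by
  refine ⟨inZ (C c) * inZ ((xiUnit c ^ (i + 1) : ℂ⟦X⟧ˣ) : ℂ⟦X⟧) *
    inW ((etaUnit c ^ (N - i) : ℂ⟦X⟧ˣ) : ℂ⟦X⟧) *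
    primitive (inZ (expSeries c) - 1) (inW (expSeries (-c)) - 1)
      (fun i => inZ (pochInv (expo r a) i)) (fun j => inW (pochInv (expo r b) j)) D N i, ?_, ?_⟩
  · refine Subring.mul_mem _ (Subring.mul_mem _ (Subring.mul_mem _ (inZ_mem _) (inZ_mem _))
      (inW_mem _)) ?_
    refine Subring.sum_mem _ fun L _ => Subring.mul_mem _ (C_mem_polySeries _) ?_
    exact binomPart_mem (Subring.sub_mem _ (inZ_mem _) (Subring.one_mem _))
      (Subring.sub_mem _ (inW_mem _) (Subring.one_mem _)) (fun _ => inZ_mem _)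
      (fun _ => inW_mem _) L _ _
  · rw [kSeries, substVar_C]; ring

theorem natDegree_coeff_mul_kSeries {F : TwoVar} (hF : F ∈ polySeries) (r a b : ℕ) (c : ℂ) (D : ℕ)
    (N i : ℤ) (n : ℕ) : (coeff (n + 1) (F * kSeries r a b c D N i)).natDegree ≤ n := by
  obtain ⟨G, hG, hk⟩ := kSeries_eq_X_mul r a b c D N i
  have : F * (X * G) = X * (F * G) := by ring
  rw [hk, this, coeff_succ_X_mul]
  exact Subring.mul_mem _ hF hG n

theorem coeff_zero_mul_kSeries (F : TwoVar) (r a b : ℕ) (c : ℂ) (D : ℕ) (N i : ℤ) :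
    coeff 0 (F * kSeries r a b c D N i) = 0 := by
  obtain ⟨G, -, hk⟩ := kSeries_eq_X_mul r a b c D N i
  have : F * (X * G) = X * (F * G) := by ring
  rw [hk, this, coeff_zero_X_mul]

theorem commonFactor_mem (r a b : ℕ) (κ : ℂ) (N : ℤ) (h : ℂ) :
    commonFactor r a b κ N h ∈ polySeries :=
  Subring.mul_mem _ (inZ_mem _) (inW_mem _)

theorem modX_mul_termA (F : TwoVar) (r : ℕ) [NeZero r] (a b : ℕ) (κ : ℂ) (D : ℕ) (N : ℤ) (h : ℂ)
    (i : ℤ) :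
    modX D (F * termA r a b κ N h i)
      = modX D (F * commonFactor r a b κ N h * kSeries r a b (r * κ) D N (i - 1)
        - C Polynomial.X * (F * commonFactor r a b κ N h * kSeries r a b (r * κ) D N i)) := by
  rw [termA_eq, ← mul_assoc, map_mul, modX_phiSeries, ← map_mul]
  refine congrArg (modX D) ?_
  ring

/-- The coefficients of the operators `E_{n - M, n}` in the commutator vanish. -/
theorem shiftedSum_termA (r : ℕ) [NeZero r] (a b : ℕ) (κ : ℂ) (N : ℤ) (h : ℂ) (k l : ℤ) :
    shiftedSum (termA r a b κ N h) N k l = 0 := by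
  rcases lt_or_ge (k + l) N with hlt | hge
  · exact shiftedSum_of_lt _ hlt
  obtain ⟨n, hn⟩ := Int.eq_ofNat_of_zero_le (sub_nonneg.2 hge)
  rw [shiftedSum_eq (n := n) _ (by omega)]
  set K : ℤ → Polynomial ℂ := fun i =>
    coeff n (commonFactor r a b κ N h * kSeries r a b (r * κ) (n + 1) N i) with hK
  have hterm : ∀ i, coeff n (termA r a b κ N h i) = K (i - 1) - Polynomial.X * K i := by
    intro i
    have h1 := modX_mul_termA 1 r a b κ (n + 1) N h i
    rw [one_mul, one_mul] at h1
    rw [modX_eq_iff.1 h1 n (Nat.lt_succ_self n), map_sub, coeff_C_mul]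
  have hK0 : ∀ i, (K i).coeff n = 0 := by
    intro i
    cases n with
    | zero => simp only [hK]; rw [coeff_zero_mul_kSeries, Polynomial.coeff_zero]
    | succ n =>
      exact Polynomial.coeff_eq_zero_of_natDegree_lt (Nat.lt_succ_of_le
        (natDegree_coeff_mul_kSeries (commonFactor_mem r a b κ N h) r a b (r * κ) _ N i n))
  simp only [hterm]
  exact sum_coeff_telescope K n hK0 k

end Vanishing

section Central

/-- The sum of `g n` over the integers `n` with `-m ≤ n < 0`, or for `m < 0` minus the sum over
`0 ≤ n < -m`. -/
noncomputable def betweenSum {M : Type*} [AddCommGroup M] (m : ℤ) (g : ℤ → M) : M :=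
  ∑ n ∈ Ico (-m) 0, g n - ∑ n ∈ Ico 0 (-m), g n

theorem sum_Ico_int_telescope {M : Type*} [AddCommGroup M] (F : ℤ → M) (s : ℤ) (n : ℕ) :
    ∑ j ∈ Ico s (s + n), (F (j + 1) - F j) = F (s + n) - F s := by
  induction n with
  | zero => simp
  | succ n ih =>
    have h : Ico s (s + ((n + 1 : ℕ) : ℤ)) = insert (s + n : ℤ) (Ico s (s + n)) := by
      ext j; simp only [mem_Ico, mem_insert]; push_cast; omega
    rw [h, sum_insert (by simp), ih]
    push_cast
    rw [← add_assoc]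
    abel

theorem betweenSum_telescope {M : Type*} [AddCommGroup M] (F : ℤ → M) (m : ℤ) :
    betweenSum m (fun n => F (n + 1) - F n) = F 0 - F (-m) := by
  rw [betweenSum]
  rcases le_total 0 m with h | h
  · obtain ⟨n, rfl⟩ := Int.eq_ofNat_of_zero_le h
    have h1 := sum_Ico_int_telescope F (-n) n
    rw [neg_add_cancel] at h1
    rw [h1, Ico_eq_empty (by omega), sum_empty, sub_zero]
  · obtain ⟨n, hn⟩ := Int.eq_ofNat_of_zero_le (neg_nonneg.2 h)
    have h1 := sum_Ico_int_telescope F 0 n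
    rw [zero_add] at h1
    rw [hn, h1, Ico_eq_empty (by omega), sum_empty, zero_sub, neg_sub]

theorem map_betweenSum {M M' : Type*} [AddCommGroup M] [AddCommGroup M'] (f : M →+ M') (m : ℤ)
    (g : ℤ → M) : f (betweenSum m g) = betweenSum m (fun n => f (g n)) := by
  rw [betweenSum, betweenSum, map_sub, map_sum, map_sum]

theorem mul_betweenSum {M : Type*} [Ring M] (x : M) (m : ℤ)
    (g : ℤ → M) : x * betweenSum m g = betweenSum m (fun n => x * g n) :=
  map_betweenSum (AddMonoidHom.mulLeft x) m g

/-- The summand with index `i` of the central term of the commutator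
`[𝒜_{a/r}(z), 𝒜_{b/r}(w)]`, where `N r + a + b = 0`. -/
noncomputable def termB (r a b : ℕ) (κ : ℂ) (N i : ℤ) : TwoVar :=
  betweenSum (i * r + a) fun n =>
    inZ (coeffA r (r * κ) a i * expSeries (κ * (n + 1 / 2 + (i * r + a) / 2))) *
      inW (coeffA r (r * κ) b (N - i) * expSeries (κ * (n + 1 / 2 + (i * r + a) / 2)))

theorem inZ_mul_inW_expSeries (c : ℂ) :
    inZ (expSeries c) * inW (expSeries c) = substVar (1 + Polynomial.X) (expSeries c) := by
  rw [substVar_expSeries, substVar_expSeries, substVar_expSeries, exp_mul_exp_eq_exp_add,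
    ← add_mul, add_comm Polynomial.X]

/-- `ς(κ (z + w))` times the central term is a geometric sum. -/
theorem sigmaSeries_mul_termB (r a b : ℕ) (κ : ℂ) {N : ℤ} (hN : N * r + a + b = 0) (i : ℤ) :
    substVar (1 + Polynomial.X) (sigmaSeries κ) * termB r a b κ N i = termA r a b κ N 0 i := by
  have hN' : ((N - i : ℤ) : ℂ) * r + b = -(i * r + a) := by
    have : ((N * r + a + b : ℤ) : ℂ) = 0 := by rw [hN]; simp
    push_cast at this ⊢
    linear_combination this
  set E : ℂ → TwoVar := fun h => substVar (1 + Polynomial.X) (expSeries (κ * h)) with hE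
  have hEmul : ∀ h h' : ℂ, E h * E h' = E (h + h') := by
    intro h h'
    simp only [hE]
    rw [← map_mul, expSeries_mul, mul_add]
  have hsplit : ∀ h : ℂ, inZ (coeffA r (r * κ) a i * expSeries (κ * h)) *
      inW (coeffA r (r * κ) b (N - i) * expSeries (κ * h))
      = inZ (coeffA r (r * κ) a i) * inW (coeffA r (r * κ) b (N - i)) * E h := by
    intro h
    simp only [hE]
    rw [← inZ_mul_inW_expSeries, map_mul, map_mul]
    ring
  have hσ : substVar (1 + Polynomial.X) (sigmaSeries κ) = E (1 / 2) - E (-(1 / 2)) := by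
    rw [sigmaSeries, map_sub]
    simp only [hE]
    congr 3 <;> ring
  rw [termB, termA, hN', hσ, mul_betweenSum]
  have h1 : ∀ n : ℤ, (E (1 / 2) - E (-(1 / 2))) *
      (inZ (coeffA r (r * κ) a i * expSeries (κ * (n + 1 / 2 + (i * r + a) / 2))) *
      inW (coeffA r (r * κ) b (N - i) * expSeries (κ * (n + 1 / 2 + (i * r + a) / 2))))
      = inZ (coeffA r (r * κ) a i) * inW (coeffA r (r * κ) b (N - i)) *
          E (((n + 1 : ℤ) : ℂ) + (i * r + a) / 2)
        - inZ (coeffA r (r * κ) a i) * inW (coeffA r (r * κ) b (N - i)) *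
          E ((n : ℂ) + (i * r + a) / 2) := by
    intro n
    have h2 : E (((n + 1 : ℤ) : ℂ) + (i * r + a) / 2)
        = E (1 / 2) * E ((n : ℂ) + 1 / 2 + (i * r + a) / 2) := by
      rw [hEmul]; congr 1; push_cast; ring
    have h3 : E ((n : ℂ) + (i * r + a) / 2)
        = E (-(1 / 2)) * E ((n : ℂ) + 1 / 2 + (i * r + a) / 2) := by
      rw [hEmul]; congr 1; ring
    rw [hsplit, h2, h3]
    ring
  simp only [h1]
  rw [betweenSum_telescope (fun n : ℤ => inZ (coeffA r (r * κ) a i) *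
    inW (coeffA r (r * κ) b (N - i)) * E ((n : ℂ) + (i * r + a) / 2))]
  have h4 : κ * (0 - -((i : ℂ) * r + a) / 2) = κ * (0 + (i * r + a) / 2) := by ring
  have h5 : κ * (0 + -((i : ℂ) * r + a) / 2) = κ * (0 - (i * r + a) / 2) := by ring
  rw [h4, h5, hsplit, hsplit]
  congr 3
  · simp
  · push_cast; ring

end Central

/-! ### Restriction to the antidiagonal -/

section Evaluation

/-- The restriction of a series in `z` and `w` to the antidiagonal `z = -w`. -/
noncomputable def antidiag : TwoVar →+* ℂ⟦X⟧ := PowerSeries.map (Polynomial.evalRingHom (-1))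

theorem antidiag_substVar (a : Polynomial ℂ) (f : ℂ⟦X⟧) :
    antidiag (substVar a f) = rescale (a.eval (-1)) f := by
  ext n
  rw [antidiag, coeff_map, coeff_substVar, coeff_rescale]
  simp

theorem antidiag_inZ (f : ℂ⟦X⟧) : antidiag (inZ f) = rescale (-1) f := by
  rw [antidiag_substVar, Polynomial.eval_X]

theorem antidiag_inW (f : ℂ⟦X⟧) : antidiag (inW f) = f := by
  rw [antidiag_substVar, Polynomial.eval_one, rescale_one, RingHom.id_apply]

theorem map_invFact {A B : Type*} [CommRing A] [CommRing B] [Algebra ℚ A] [Algebra ℚ B]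
    (f : A →+* B) (n : ℕ) : PowerSeries.map f (invFact A n) = invFact B n := by
  rw [invFact, invFact, map_C]
  exact congrArg C (RingHom.congr_fun (RingHom.ext_rat (f.comp (algebraMap ℚ A)) _) _)

theorem map_invSucc {A B : Type*} [CommRing A] [CommRing B] [Algebra ℚ A] [Algebra ℚ B]
    (f : A →+* B) (n : ℕ) : PowerSeries.map f (invSucc A n) = invSucc B n := by
  rw [invSucc, invSucc, map_C]
  exact congrArg C (RingHom.congr_fun (RingHom.ext_rat (f.comp (algebraMap ℚ A)) _) _)

theorem map_primitive {A B : Type*} [CommRing A] [CommRing B] [Algebra ℚ A] [Algebra ℚ B]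
    (f : A →+* B) (P Q : A⟦X⟧) (p q : ℤ → A⟦X⟧) (D : ℕ) (N i : ℤ) :
    PowerSeries.map f (primitive P Q p q D N i)
      = primitive (PowerSeries.map f P) (PowerSeries.map f Q) (fun i => PowerSeries.map f (p i))
        (fun i => PowerSeries.map f (q i)) D N i := by
  simp only [primitive, binomPart, map_sum, map_mul, map_pow, map_invFact, map_invSucc]

theorem rescale_expSeries (a c : ℂ) : rescale a (expSeries c) = expSeries (a * c) := by
  rw [expSeries, expSeries, rescale_rescale, mul_comm]

theorem pochInv_expo_zero (r a : ℕ) : pochInv (expo r a) 0 = 1 := by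
  have : pochInv (expo r a) (Int.ofNat 0) = 1 := by simp [pochInv]
  exact this

/-- The value of `k 0` on the antidiagonal. -/
theorem modX_antidiag_kSeries (r : ℕ) [NeZero r] (a b : ℕ) (c : ℂ) (D : ℕ) {N : ℤ}
    (hN : N * r + a + b = 0) :
    modX D (antidiag (kSeries r a b c D N 0))
      = modX D (((etaUnit c ^ N : ℂ⟦X⟧ˣ) : ℂ⟦X⟧) * pochInv (expo r b) (N - 1) * (C c * X)) := by
  set Y : ℂ⟦X⟧ := 1 - expSeries (-c) with hY
  have hr : (r : ℂ) ≠ 0 := Nat.cast_ne_zero.2 (NeZero.ne r)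
  have hp : ∀ i, rescale (-1 : ℂ) (pochInv (expo r a) (i - 1))
      = (rescale (-1) (expo r a) + (i : ℂ⟦X⟧)) * rescale (-1) (pochInv (expo r a) i) := by
    intro i
    rw [pochInv_sub_one (constantCoeff_expo_add_ne_zero r a), map_mul, map_add, map_intCast]
  have hprim : antidiag (primitive (inZ (expSeries c) - 1) (inW (expSeries (-c)) - 1)
      (fun i => inZ (pochInv (expo r a) i)) (fun j => inW (pochInv (expo r b) j)) D N 0)
      = ∑ L ∈ range D, invSucc ℂ L * (Y ^ L * pochInv (expo r b) (N - 1)) := by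
    have e1 : PowerSeries.map (Polynomial.evalRingHom (-1)) (inZ (expSeries c) - 1) = -Y := by
      have := antidiag_inZ (expSeries c)
      rw [antidiag] at this
      rw [map_sub, map_one, this, rescale_expSeries, hY, neg_one_mul, neg_sub]
    have e2 : PowerSeries.map (Polynomial.evalRingHom (-1)) (inW (expSeries (-c)) - 1) = -Y := by
      have := antidiag_inW (expSeries (-c))
      rw [antidiag] at this
      rw [map_sub, map_one, this, hY, neg_sub]
    have e3 : (fun i => PowerSeries.map (Polynomial.evalRingHom (-1)) (inZ (pochInv (expo r a) i)))
        = fun i => rescale (-1) (pochInv (expo r a) i) := funext fun i => antidiag_inZ _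
    have e4 : (fun i => PowerSeries.map (Polynomial.evalRingHom (-1)) (inW (pochInv (expo r b) i)))
        = fun i => pochInv (expo r b) i := funext fun i => antidiag_inW _
    rw [antidiag, map_primitive, e1, e2, e3, e4, primitive]
    refine sum_congr rfl fun L _ => ?_
    rw [binomPart_neg_neg Y (rescale (-1) (expo r a)) (expo r b) _ _ hp
      (pochInv_sub_one (constantCoeff_expo_add_ne_zero r b)), pochInv_expo_zero, map_one,
      one_mul, sub_zero]
    have h1 : ((a : ℂ) + b) = -N * r := by
      have : ((N * r + a + b : ℤ) : ℂ) = 0 := by rw [hN]; simp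
      push_cast at this
      linear_combination this
    have h2 : C ((r : ℂ)⁻¹) * (C (a : ℂ) + C (b : ℂ)) = -(N : ℂ⟦X⟧) := by
      have h3 : (N : ℂ⟦X⟧) = C (N : ℂ) := by simp
      rw [h3, ← map_add, h1, ← map_mul, ← map_neg]
      congr 1
      field_simp
    have h4 : rescale (-1 : ℂ) (C (a : ℂ)) = C (a : ℂ) := by
      ext n; rw [coeff_rescale, coeff_C]; split_ifs with h <;> simp [h]
    have h5 : rescale (-1 : ℂ) (C ((r : ℂ)⁻¹)) = C ((r : ℂ)⁻¹) := by
      ext n; rw [coeff_rescale, coeff_C]; split_ifs with h <;> simp [h]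
    have h6 : rescale (-1 : ℂ) X = -X := by
      rw [rescale_X]; simp
    rw [expo, expo, map_mul, map_add, h4, h5, h6]
    push_cast
    linear_combination h2
  have hxi : rescale (-1) ((xiUnit c : ℂ⟦X⟧ˣ) : ℂ⟦X⟧) = ((etaUnit c : ℂ⟦X⟧ˣ) : ℂ⟦X⟧) := by
    have e1 : ((xiUnit c : ℂ⟦X⟧ˣ) : ℂ⟦X⟧) = sSeries c * expSeries (c / 2) := rfl
    have e2 : ((etaUnit c : ℂ⟦X⟧ˣ) : ℂ⟦X⟧) = sSeries c * expSeries (-(c / 2)) := rfl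
    rw [e1, e2, map_mul, rescale_neg_one_sSeries, rescale_expSeries, neg_one_mul]
  have hYeta : Y = C c * X * ((etaUnit c : ℂ⟦X⟧ˣ) : ℂ⟦X⟧) := by
    have e2 : ((etaUnit c : ℂ⟦X⟧ˣ) : ℂ⟦X⟧) = sSeries c * expSeries (-(c / 2)) := rfl
    rw [hY, e2]
    linear_combination -expSeries_neg_sub_one c
  have hCX : antidiag (C (Polynomial.C c) * X) = C c * X := by
    rw [map_mul, antidiag, map_C, map_X]
    simp
  rw [kSeries, map_mul antidiag, map_mul antidiag, map_mul antidiag (C (Polynomial.C c) * X),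
    hprim, hCX, antidiag_inZ, antidiag_inW, zero_add,
    zpow_one, hxi, sub_zero, ← hYeta]
  have hfin : Y * ((etaUnit c ^ N : ℂ⟦X⟧ˣ) : ℂ⟦X⟧) *
      ∑ L ∈ range D, invSucc ℂ L * (Y ^ L * pochInv (expo r b) (N - 1))
      = ((etaUnit c ^ N : ℂ⟦X⟧ˣ) : ℂ⟦X⟧) * pochInv (expo r b) (N - 1) *
        ∑ L ∈ range D, invSucc ℂ L * Y ^ (L + 1) := by
    rw [mul_sum, mul_sum]
    refine sum_congr rfl fun L _ => ?_
    ring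
  rw [hfin, map_mul, modX_sum_invSucc_mul_pow D c (Y := Y) hY, ← map_mul]

theorem rescale_logOf (a : ℂ) {f : ℂ⟦X⟧} (hf : constantCoeff f = 1) :
    rescale a (logOf f) = logOf (rescale a f) := by
  have hs : HasSubst (f - 1 : ℂ⟦X⟧) := HasSubst.of_constantCoeff_zero' (by simp [hf])
  rw [logOf_eq, logOf_eq, rescale_eq_subst, rescale_eq_subst,
    subst_comp_subst_apply hs (HasSubst.smul_X' a), subst_sub (HasSubst.smul_X' a)]
  congr 2
  rw [← coe_substAlgHom (HasSubst.smul_X' a), map_one]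

/-- The product of the powers of `𝒮(c z)` and `𝒮(c w)` at `z = -w`. -/
theorem rescale_formalPow_mul (r : ℕ) [NeZero r] (a b s : ℕ) (c : ℂ) (h : a + b = s * r) :
    rescale (-1) (formalPow (sSeries c) (expo r a)) * formalPow (sSeries c) (expo r b)
      = sSeries c ^ s := by
  have hr : (r : ℂ) ≠ 0 := Nat.cast_ne_zero.2 (NeZero.ne r)
  have h0 := constantCoeff_sSeries c
  have hl := constantCoeff_logOf h0
  have e : ∀ g : ℂ⟦X⟧, constantCoeff (g * logOf (sSeries c)) = 0 := by
    intro g; rw [map_mul, hl, mul_zero]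
  have hf : ∀ g, formalPow (sSeries c) g = expOf (g * logOf (sSeries c)) := fun g => rfl
  have hpow : ∀ s : ℕ, expOf ((s : ℂ⟦X⟧) * logOf (sSeries c)) = sSeries c ^ s := by
    intro s
    induction s with
    | zero => simp [expOf_zero]
    | succ s ih =>
      rw [Nat.cast_succ, add_mul, one_mul, expOf_add (e _) hl, ih, expOf_logOf h0, pow_succ]
  have hsum : rescale (-1) (expo r a) + expo r b = (s : ℂ⟦X⟧) := by
    have h4 : ∀ d : ℂ, rescale (-1 : ℂ) (C d) = C d := by
      intro d
      ext n; rw [coeff_rescale, coeff_C]; split_ifs with h <;> simp [h]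
    have h6 : rescale (-1 : ℂ) X = -X := by
      rw [rescale_X]; simp
    have h2 : C ((r : ℂ)⁻¹) * (C (a : ℂ) + C (b : ℂ)) = (s : ℂ⟦X⟧) := by
      have h3 : (s : ℂ⟦X⟧) = C (s : ℂ) := by simp
      have h1 : (a : ℂ) + b = s * r := by exact_mod_cast h
      rw [h3, ← map_add, h1, ← map_mul]
      congr 1
      field_simp
    rw [expo, expo, map_mul, map_add, h4, h4, h6]
    linear_combination h2
  rw [hf, hf, rescale_expOf _ (e _), map_mul, rescale_logOf _ h0, rescale_neg_one_sSeries,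
    ← expOf_add (by rw [map_mul, hl, mul_zero]) (e _), ← add_mul, hsum, hpow]

end Evaluation

/-! ### The value of the central term -/

section CentralValue

theorem zFrac_mul {a : ℕ} (ha : a ≠ 0) : zFrac a * (X + C (a : ℂ)) = X := by
  rw [zFrac, if_neg ha, mul_assoc, PowerSeries.inv_mul_cancel, mul_one]
  simp [ha]

/-- The residue of the central term on the antidiagonal. If `a + b = r`, then `1 / (1 + y)_{-2}`
is `(w + b) (w - a) / r ^ 2`, which at `z = -w` cancels the denominators of the prefactors
`z / (z + a)` and `w / (w + b)`. -/
theorem residue_eq (r : ℕ) [NeZero r] {a b : ℕ} (ha : a < r) (hb : b < r) {κ : ℂ} (hκ : κ ≠ 0)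
    {N : ℤ} (hN : N * r + a + b = 0) :
    C κ⁻¹ * (rescale (-1) (preA r (r * κ) a * expSeries (κ * 0 - κ / 2 * (N * r + b))) *
        (preA r (r * κ) b * expSeries (κ * 0 + κ / 2 * (N * r + a)))) *
      (((etaUnit (r * κ) ^ N : ℂ⟦X⟧ˣ) : ℂ⟦X⟧) * pochInv (expo r b) (N - 1) * (C (r * κ) * X))
      = if a + b = 0 then X ^ 2 else C ((r : ℂ)⁻¹) * X ^ 3 := by
  have hr : (r : ℂ) ≠ 0 := Nat.cast_ne_zero.2 (NeZero.ne r)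
  have hr0 : (0 : ℤ) < r := by have := NeZero.pos r; omega
  have hκ' : (C κ⁻¹ * C ((r : ℂ) * κ) : ℂ⟦X⟧) = C (r : ℂ) := by
    rw [← map_mul]; congr 1; field_simp
  have hr' : (C ((r : ℂ)⁻¹) * C (r : ℂ) : ℂ⟦X⟧) = 1 := by
    rw [← map_mul, inv_mul_cancel₀ hr, map_one]
  split_ifs with hab
  · obtain ⟨rfl, rfl⟩ : a = 0 ∧ b = 0 := by omega
    have hN0 : N = 0 := by
      rcases mul_eq_zero.1 (show N * (r : ℤ) = 0 by simpa using hN) with h | h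
      · exact h
      · omega
    subst hN0
    have hpow := rescale_formalPow_mul r 0 0 0 (r * κ) (by simp)
    have hpoch : pochInv (expo r 0) (0 - 1) = C ((r : ℂ)⁻¹) * X := by
      have : (0 - 1 : ℤ) = Int.negSucc 0 := rfl
      rw [this]
      simp [pochInv, expo]
    have hexp : expSeries (κ * 0 - κ / 2 * (((0 : ℤ) : ℂ) * r + ((0 : ℕ) : ℂ))) = 1 := by
      rw [← expSeries_zero]; congr 1; push_cast; ring
    have hexp' : expSeries (κ * 0 + κ / 2 * (((0 : ℤ) : ℂ) * r + ((0 : ℕ) : ℂ))) = 1 := by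
      rw [← expSeries_zero]; congr 1; push_cast; ring
    have hz : zFrac 0 = 1 := by simp [zFrac]
    rw [hexp, hexp', preA, hz, one_mul, mul_one, hpow, hpoch, zpow_zero, Units.val_one]
    linear_combination (C ((r : ℂ)⁻¹) * X ^ 2) * hκ' + X ^ 2 * hr'
  · have hN1 : N = -1 := by
      have h1 : N * (r : ℤ) < 0 := by omega
      have h2 : -2 * (r : ℤ) < N * r := by omega
      have h3 : -2 < N := lt_of_mul_lt_mul_right h2 hr0.le
      have h4 : N < 0 := by
        by_contra hcon
        have : 0 ≤ N * (r : ℤ) := mul_nonneg (by omega) hr0.le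
        omega
      omega
    subst hN1
    have hsum : a + b = r := by omega
    have hsumC : (a : ℂ) + b = r := by exact_mod_cast hsum
    have ha0 : a ≠ 0 := by omega
    have hb0 : b ≠ 0 := by omega
    have hpow := rescale_formalPow_mul r a b 1 (r * κ) (by omega)
    rw [pow_one] at hpow
    have hpoch : pochInv (expo r b) (-1 - 1)
        = C ((r : ℂ)⁻¹) * C ((r : ℂ)⁻¹) * ((X + C (b : ℂ)) * (X - C (a : ℂ))) := by
      have h1 : (-1 - 1 : ℤ) = Int.negSucc 1 := rfl
      have h2 : (C (b : ℂ) : ℂ⟦X⟧) = C (r : ℂ) - C (a : ℂ) := by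
        rw [← map_sub, ← hsumC]; congr 1; ring
      rw [h1]
      simp only [pochInv, expo, prod_range_succ, prod_range_zero, h2]
      push_cast
      linear_combination (C ((r : ℂ)⁻¹) * (X + (C (r : ℂ) - C (a : ℂ)))) * hr'
    have hexp : rescale (-1) (expSeries (κ * 0 - κ / 2 * (((-1 : ℤ) : ℂ) * r + b)))
        * expSeries (κ * 0 + κ / 2 * (((-1 : ℤ) : ℂ) * r + a)) = expSeries (-(r * κ / 2)) := by
      rw [rescale_expSeries, expSeries_mul]
      congr 1
      push_cast
      linear_combination (κ / 2) * hsumC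
    have heta : sSeries (r * κ) * expSeries (-(r * κ / 2)) *
        ((etaUnit (r * κ) ^ (-1 : ℤ) : ℂ⟦X⟧ˣ) : ℂ⟦X⟧) = 1 := by
      rw [zpow_neg_one]
      exact (etaUnit (r * κ)).mul_inv
    have h4 : rescale (-1 : ℂ) (C (a : ℂ)) = C (a : ℂ) := by
      ext n; rw [coeff_rescale, coeff_C]; split_ifs with h <;> simp [h]
    have h6 : rescale (-1 : ℂ) X = -X := by
      rw [rescale_X]; simp
    have hza := congrArg (rescale (-1 : ℂ)) (zFrac_mul ha0)
    rw [map_mul, map_add, h4, h6] at hza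
    have hzb := zFrac_mul hb0
    rw [hpoch, preA, preA, map_mul, map_mul]
    set Fa := rescale (-1) (formalPow (sSeries (r * κ)) (expo r a))
    set Fb := formalPow (sSeries (r * κ)) (expo r b)
    set Ea := rescale (-1) (expSeries (κ * 0 - κ / 2 * (((-1 : ℤ) : ℂ) * r + b)))
    set Eb := expSeries (κ * 0 + κ / 2 * (((-1 : ℤ) : ℂ) * r + a))
    set Za := rescale (-1) (zFrac a)
    set U := ((etaUnit (r * κ) ^ (-1 : ℤ) : ℂ⟦X⟧ˣ) : ℂ⟦X⟧)
    set R := (C ((r : ℂ)⁻¹) : ℂ⟦X⟧)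
    have hone : Fa * Fb * (Ea * Eb) * U = 1 := by rw [hpow, hexp, heta]
    calc _ = (C κ⁻¹ * C ((r : ℂ) * κ)) * R * R * X * (-(Za * (-X + C (a : ℂ)))) *
          (zFrac b * (X + C (b : ℂ))) * (Fa * Fb * (Ea * Eb) * U) := by ring
      _ = R * X ^ 3 * (R * C (r : ℂ)) := by rw [hκ', hza, hzb, hone]; ring
      _ = _ := by rw [hr', mul_one]

/-- The central term of the commutator. -/
theorem shiftedSum_termB (r : ℕ) [NeZero r] {a b : ℕ} (ha : a < r) (hb : b < r) {κ : ℂ}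
    (hκ : κ ≠ 0) {N : ℤ} (hN : N * r + a + b = 0) (k l : ℤ) :
    shiftedSum (termB r a b κ N) N k l
      = if k + l = 1 then (-1) ^ (k - 1) * (if a + b = 0 then 1 else (r : ℂ)⁻¹) else 0 := by
  have hN01 : (a + b = 0 ∧ N = 0) ∨ (a + b ≠ 0 ∧ N = -1) := by
    have hr0 : (0 : ℤ) < r := by have := NeZero.pos r; omega
    have h3 : -2 < N := lt_of_mul_lt_mul_right (by omega : -2 * (r : ℤ) < N * r) hr0.le
    have h4 : N ≤ 0 := by
      by_contra hcon
      have : 0 < N * (r : ℤ) := mul_pos (by omega) hr0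
      omega
    rcases (by omega : N = 0 ∨ N = -1) with rfl | rfl
    · left; exact ⟨by omega, rfl⟩
    · right; exact ⟨by omega, rfl⟩
  rcases lt_or_ge (k + l) N with hlt | hge
  · rw [shiftedSum_of_lt _ hlt, if_neg (by omega)]
  obtain ⟨n, hn⟩ := Int.eq_ofNat_of_zero_le (sub_nonneg.2 hge)
  rw [shiftedSum_eq (n := n) _ (by omega)]
  -- `W` is the power series `(z + w) / ς(κ (z + w))`.
  set W : TwoVar := substVar (1 + Polynomial.X) (C κ⁻¹ * (sSeries κ)⁻¹) with hW
  have hWσ : W * substVar (1 + Polynomial.X) (sigmaSeries κ) = C (1 + Polynomial.X) * X := by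
    rw [hW, ← map_mul, ← substVar_X]
    congr 1
    have h1 : (sSeries κ)⁻¹ * sSeries κ = 1 :=
      PowerSeries.inv_mul_cancel _ (by rw [constantCoeff_sSeries]; exact one_ne_zero)
    have h2 : (C κ⁻¹ * C κ : ℂ⟦X⟧) = 1 := by rw [← map_mul, inv_mul_cancel₀ hκ, map_one]
    rw [← X_mul_sSeries]
    linear_combination (C κ⁻¹ * C κ * X) * h1 + X * h2
  set K : ℤ → Polynomial ℂ := fun i =>
    coeff (n + 1) (W * commonFactor r a b κ N 0 * kSeries r a b (r * κ) (n + 2) N i) with hK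
  have hWmem : W ∈ polySeries := substVar_mem_polySeries
    ((Polynomial.natDegree_add_le _ _).trans (by simp)) _
  have hdeg : ∀ i, (K i).natDegree ≤ n := fun i => natDegree_coeff_mul_kSeries
    (Subring.mul_mem _ hWmem (commonFactor_mem r a b κ N 0)) r a b (r * κ) _ N i n
  have hstep : ∀ i, (1 + Polynomial.X) * coeff n (termB r a b κ N i)
      = K (i - 1) - Polynomial.X * K i := by
    intro i
    have h1 := modX_mul_termA W r a b κ (n + 2) N 0 i
    rw [← sigmaSeries_mul_termB r a b κ hN, ← mul_assoc, hWσ] at h1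
    have h2 := modX_eq_iff.1 h1 (n + 1) (by omega)
    rw [mul_assoc, coeff_C_mul, coeff_succ_X_mul, map_sub, coeff_C_mul] at h2
    exact h2
  rw [sum_coeff_residue _ K n hdeg hstep]
  have hval : (K 0).eval (-1) = coeff (n + 1)
      (if a + b = 0 then X ^ 2 else C ((r : ℂ)⁻¹) * X ^ 3 : ℂ⟦X⟧) := by
    rw [← residue_eq r ha hb hκ hN]
    have h1 : (K 0).eval (-1) = coeff (n + 1) (antidiag (W * commonFactor r a b κ N 0) *
        antidiag (kSeries r a b (r * κ) (n + 2) N 0)) := by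
      rw [← map_mul, antidiag, coeff_map]; rfl
    have h2 : antidiag W = C κ⁻¹ := by
      rw [hW, antidiag_substVar]
      have : (1 + Polynomial.X : Polynomial ℂ).eval (-1) = 0 := by simp
      rw [this, rescale_zero_apply, map_mul]
      congr 1
      rw [constantCoeff_inv, constantCoeff_sSeries]
      simp
    have h3 : antidiag (commonFactor r a b κ N 0)
        = rescale (-1) (preA r (r * κ) a * expSeries (κ * 0 - κ / 2 * (N * r + b))) *
          (preA r (r * κ) b * expSeries (κ * 0 + κ / 2 * (N * r + a))) := by
      rw [commonFactor, map_mul, antidiag_inZ, antidiag_inW]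
    rw [h1, map_mul antidiag, h2, h3]
    have h4 := modX_antidiag_kSeries r a b (r * κ) (n + 2) hN
    refine (modX_eq_iff (D := n + 2)).1 ?_ (n + 1) (by omega)
    rw [map_mul, h4, ← map_mul]
  rw [hval]
  rcases hN01 with ⟨hab, rfl⟩ | ⟨hab, rfl⟩
  · rw [if_pos hab, if_pos hab, coeff_X_pow]
    have : (n + 1 = 2) ↔ (k + l = 1) := by omega
    simp only [this]
    split_ifs <;> simp
  · rw [if_neg hab, if_neg hab, coeff_C_mul, coeff_X_pow]
    have : (n + 1 = 3) ↔ (k + l = 1) := by omega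
    simp only [this]
    split_ifs <;> simp

end CentralValue

/-! ### The algebra of fermions -/

section Wedge

namespace Wedge

theorem finite_above (S : Wedge) (j : ℤ) : {n ∈ S.occ | j < n}.Finite := by
  refine (S.finite_diff.union (Set.finite_Ico j 0)).subset ?_
  rintro n ⟨hn, hj⟩
  rcases lt_or_ge n 0 with h | h
  · right; exact ⟨hj.le, h⟩
  · left; left; exact ⟨hn, by simpa using h⟩

theorem mem_add {S : Wedge} {i j : ℤ} : i ∈ (S.add j).occ ↔ i = j ∨ i ∈ S.occ := Iff.rfl

theorem mem_remove {S : Wedge} {i j : ℤ} : i ∈ (S.remove j).occ ↔ i ∈ S.occ ∧ i ≠ j := Iff.rfl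

theorem sign_add {S : Wedge} {i j : ℤ} (hi : i ∉ S.occ) :
    (S.add i).sign j = S.sign j * (if j < i then -1 else 1) := by
  rw [sign, sign]
  split_ifs with h
  · have : {n ∈ (S.add i).occ | j < n} = insert i {n ∈ S.occ | j < n} := by
      ext n
      simp only [mem_add, Set.mem_sep_iff, Set.mem_insert_iff]
      constructor
      · rintro ⟨h1 | h1, h2⟩ <;> simp [h1, h2]
      · rintro (rfl | h1)
        · exact ⟨Or.inl rfl, h⟩
        · exact ⟨Or.inr h1.1, h1.2⟩
    rw [this, Set.ncard_insert_of_notMem (fun h' => hi h'.1) (S.finite_above j), pow_succ]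
  · have : {n ∈ (S.add i).occ | j < n} = {n ∈ S.occ | j < n} := by
      ext n
      simp only [mem_add, Set.mem_sep_iff]
      constructor
      · rintro ⟨rfl | h1, h2⟩
        · exact absurd h2 h
        · exact ⟨h1, h2⟩
      · rintro ⟨h1, h2⟩; exact ⟨Or.inr h1, h2⟩
    rw [this, mul_one]

theorem add_remove {S : Wedge} {i : ℤ} (hi : i ∈ S.occ) : (S.remove i).add i = S := by
  ext n
  simp only [mem_add, mem_remove]
  constructor
  · rintro (rfl | h)
    · exact hi
    · exact h.1
  · intro h
    by_cases hn : n = i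
    · exact Or.inl hn
    · exact Or.inr ⟨h, hn⟩

theorem remove_add {S : Wedge} {i : ℤ} (hi : i ∉ S.occ) : (S.add i).remove i = S := by
  ext n
  simp only [mem_add, mem_remove]
  constructor
  · rintro ⟨h | h, h'⟩
    · exact absurd h h'
    · exact h
  · intro h
    exact ⟨Or.inr h, fun h' => hi (h' ▸ h)⟩

theorem sign_remove {S : Wedge} {i j : ℤ} (hi : i ∈ S.occ) :
    (S.remove i).sign j = S.sign j * (if j < i then -1 else 1) := by
  have h := sign_add (S := S.remove i) (i := i) (j := j) (fun h => h.2 rfl)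
  rw [add_remove hi] at h
  rw [h]
  split_ifs <;> ring

theorem sign_mul_self (S : Wedge) (j : ℤ) : S.sign j * S.sign j = 1 := by
  rw [sign, ← mul_pow]; simp

theorem add_comm (S : Wedge) (i j : ℤ) : (S.add i).add j = (S.add j).add i := by
  ext n; simp only [mem_add]; tauto

theorem remove_comm (S : Wedge) (i j : ℤ) : (S.remove i).remove j = (S.remove j).remove i := by
  ext n; simp only [mem_remove]; tauto

theorem add_remove_comm (S : Wedge) {i j : ℤ} (hij : i ≠ j) :
    (S.add i).remove j = (S.remove j).add i := by
  ext n; simp only [mem_add, mem_remove]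
  constructor
  · tauto
  · rintro (rfl | h)
    · exact ⟨Or.inl rfl, hij⟩
    · exact ⟨Or.inr h.1, h.2⟩

end Wedge

theorem psi_single_of_mem {S : Wedge} {j : ℤ} (h : j ∈ S.occ) (c : ℂ) :
    psi j (Finsupp.single S c) = 0 := by
  rw [psi, Finsupp.linearCombination_single, if_pos h, smul_zero]

theorem psi_single_of_notMem {S : Wedge} {j : ℤ} (h : j ∉ S.occ) (c : ℂ) :
    psi j (Finsupp.single S c) = Finsupp.single (S.add j) (c * S.sign j) := by
  rw [psi, Finsupp.linearCombination_single, if_neg h, Finsupp.smul_single, smul_eq_mul]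

theorem psiStar_single_of_mem {S : Wedge} {j : ℤ} (h : j ∈ S.occ) (c : ℂ) :
    psiStar j (Finsupp.single S c) = Finsupp.single (S.remove j) (c * S.sign j) := by
  rw [psiStar, Finsupp.linearCombination_single, if_pos h, Finsupp.smul_single, smul_eq_mul]

theorem psiStar_single_of_notMem {S : Wedge} {j : ℤ} (h : j ∉ S.occ) (c : ℂ) :
    psiStar j (Finsupp.single S c) = 0 := by
  rw [psiStar, Finsupp.linearCombination_single, if_neg h, smul_zero]

theorem psi_psi (i j : ℤ) (v : InfWedge) : psi i (psi j v) = -psi j (psi i v) := by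
  induction v using Finsupp.induction_linear with
  | zero => simp
  | add v w hv hw => simp only [map_add, hv, hw, neg_add]
  | single S c =>
    by_cases hi : i ∈ S.occ
    · rw [psi_single_of_mem hi, map_zero, neg_zero]
      by_cases hj : j ∈ S.occ
      · rw [psi_single_of_mem hj, map_zero]
      · rw [psi_single_of_notMem hj, psi_single_of_mem (S := S.add j) (Or.inr hi)]
    by_cases hj : j ∈ S.occ
    · rw [psi_single_of_mem hj, map_zero, psi_single_of_notMem hi,
        psi_single_of_mem (S := S.add i) (Or.inr hj), neg_zero]
    rcases eq_or_ne i j with rfl | hij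
    · rw [psi_single_of_notMem hi, psi_single_of_mem (S := S.add i) (Or.inl rfl), neg_zero]
    have hi' : i ∉ (S.add j).occ := by rintro (h | h); exacts [hij h, hi h]
    have hj' : j ∉ (S.add i).occ := by rintro (h | h); exacts [hij h.symm, hj h]
    rw [psi_single_of_notMem hi, psi_single_of_notMem hj, psi_single_of_notMem hi',
      psi_single_of_notMem hj', Wedge.add_comm, ← Finsupp.single_neg, Wedge.sign_add hi,
      Wedge.sign_add hj]
    congr 1
    rcases lt_or_gt_of_ne hij with h | h
    · rw [if_pos h, if_neg h.asymm]; ring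
    · rw [if_neg h.asymm, if_pos h]; ring

theorem psiStar_psiStar (i j : ℤ) (v : InfWedge) :
    psiStar i (psiStar j v) = -psiStar j (psiStar i v) := by
  induction v using Finsupp.induction_linear with
  | zero => simp
  | add v w hv hw => simp only [map_add, hv, hw, neg_add]
  | single S c =>
    by_cases hi : i ∈ S.occ
    swap
    · rw [psiStar_single_of_notMem hi, map_zero, neg_zero]
      by_cases hj : j ∈ S.occ
      · rw [psiStar_single_of_mem hj,
          psiStar_single_of_notMem (S := S.remove j) (fun h => hi h.1)]
      · rw [psiStar_single_of_notMem hj, map_zero]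
    by_cases hj : j ∈ S.occ
    swap
    · rw [psiStar_single_of_notMem hj, map_zero, psiStar_single_of_mem hi,
        psiStar_single_of_notMem (S := S.remove i) (fun h => hj h.1), neg_zero]
    rcases eq_or_ne i j with rfl | hij
    · rw [psiStar_single_of_mem hi,
        psiStar_single_of_notMem (S := S.remove i) (fun h => h.2 rfl), neg_zero]
    have hi' : i ∈ (S.remove j).occ := ⟨hi, hij⟩
    have hj' : j ∈ (S.remove i).occ := ⟨hj, hij.symm⟩
    rw [psiStar_single_of_mem hi, psiStar_single_of_mem hj, psiStar_single_of_mem hi',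
      psiStar_single_of_mem hj', Wedge.remove_comm, ← Finsupp.single_neg, Wedge.sign_remove hi,
      Wedge.sign_remove hj]
    congr 1
    rcases lt_or_gt_of_ne hij with h | h
    · rw [if_pos h, if_neg h.asymm]; ring
    · rw [if_neg h.asymm, if_pos h]; ring

theorem psiStar_psi (i j : ℤ) (v : InfWedge) :
    psiStar j (psi i v) = (if i = j then v else 0) - psi i (psiStar j v) := by
  induction v using Finsupp.induction_linear with
  | zero => simp
  | add v w hv hw =>
    simp only [map_add, hv, hw]
    split_ifs <;> abel
  | single S c =>
    rcases eq_or_ne i j with rfl | hij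
    · rw [if_pos rfl]
      by_cases hi : i ∈ S.occ
      · rw [psi_single_of_mem hi, map_zero, psiStar_single_of_mem hi,
          psi_single_of_notMem (S := S.remove i) (fun h => h.2 rfl), Wedge.add_remove hi,
          Wedge.sign_remove hi, if_neg (lt_irrefl i), mul_one, mul_assoc, Wedge.sign_mul_self,
          mul_one, sub_self]
      · rw [psiStar_single_of_notMem hi, map_zero, psi_single_of_notMem hi,
          psiStar_single_of_mem (S := S.add i) (Or.inl rfl), Wedge.remove_add hi,
          Wedge.sign_add hi, if_neg (lt_irrefl i), mul_one, mul_assoc, Wedge.sign_mul_self,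
          mul_one, sub_zero]
    rw [if_neg hij, zero_sub]
    by_cases hi : i ∈ S.occ
    · rw [psi_single_of_mem hi, map_zero]
      by_cases hj : j ∈ S.occ
      · rw [psiStar_single_of_mem hj, psi_single_of_mem (S := S.remove j) ⟨hi, hij⟩, neg_zero]
      · rw [psiStar_single_of_notMem hj, map_zero, neg_zero]
    by_cases hj : j ∈ S.occ
    swap
    · rw [psiStar_single_of_notMem hj, map_zero, psi_single_of_notMem hi,
        psiStar_single_of_notMem (S := S.add i) (by rintro (h | h); exacts [hij h.symm, hj h]),
        neg_zero]
    rw [psi_single_of_notMem hi, psiStar_single_of_mem hj,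
      psi_single_of_notMem (S := S.remove j) (fun h => hi h.1),
      psiStar_single_of_mem (S := S.add i) (Or.inr hj), Wedge.add_remove_comm S hij,
      ← Finsupp.single_neg, Wedge.sign_add hi, Wedge.sign_remove hj]
    congr 1
    rcases lt_or_gt_of_ne hij with h | h
    · rw [if_pos h, if_neg h.asymm]; ring
    · rw [if_neg h.asymm, if_pos h]; ring

theorem normalE_apply (i j : ℤ) (v : InfWedge) :
    normalE i j v = psi i (psiStar j v) - (if i = j ∧ j < 0 then v else 0) := by
  rw [normalE]
  split_ifs with h1 h2 h2
  · omega
  · rw [sub_zero, LinearMap.comp_apply]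
  · rw [LinearMap.neg_apply, LinearMap.comp_apply, psiStar_psi, if_pos h2.1, neg_sub]
  · rw [LinearMap.neg_apply, LinearMap.comp_apply, psiStar_psi, if_neg (fun h => h2 ⟨h, by omega⟩),
      zero_sub, neg_neg, sub_zero]

/-- The commutation relations of the operators `E_{i,j}`, with their central term. -/
theorem normalE_commutator (i j k l : ℤ) (v : InfWedge) :
    normalE i j (normalE k l v) - normalE k l (normalE i j v)
      = (if j = k then normalE i l v else 0) - (if i = l then normalE k j v else 0)
        + (if i = l ∧ j = k then ((if 0 ≤ j then 1 else 0) - (if 0 ≤ l then 1 else 0) : ℂ) else 0)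
          • v := by
  have hite : ∀ (P : Prop) [Decidable P] (f : InfWedge →ₗ[ℂ] InfWedge) (w : InfWedge),
      f (if P then w else 0) = if P then f w else 0 := by
    intro P _ f w; split_ifs <;> simp
  have h0 : normalE i j (normalE k l v) - normalE k l (normalE i j v)
      = psi i (psiStar j (psi k (psiStar l v))) - psi k (psiStar l (psi i (psiStar j v))) := by
    rw [normalE_apply i j, normalE_apply k l, normalE_apply k l, normalE_apply i j]
    simp only [map_sub, hite]
    split_ifs <;> abel
  have h3 : psi i (psi k (psiStar j (psiStar l v))) = psi k (psi i (psiStar l (psiStar j v))) := by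
    rw [psi_psi, psiStar_psiStar, map_neg, map_neg, neg_neg]
  have h1 : psi i (psiStar j (psi k (psiStar l v))) - psi k (psiStar l (psi i (psiStar j v)))
      = (if j = k then psi i (psiStar l v) else 0) -
        (if i = l then psi k (psiStar j v) else 0) := by
    rw [psiStar_psi, psiStar_psi, map_sub, map_sub, h3, hite, hite]
    simp only [eq_comm (a := k) (b := j)]
    abel
  rw [h0, h1, normalE_apply, normalE_apply]
  by_cases h1 : j = k <;> by_cases h2 : i = l
  · subst h1 h2
    by_cases h3 : 0 ≤ j <;> by_cases h4 : 0 ≤ i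
    · simp [h3, h4, not_lt.2 h3, not_lt.2 h4]
    · simp [h3, h4, not_lt.2 h3, lt_of_not_ge h4]
      abel
    · simp [h3, h4, not_lt.2 h4, lt_of_not_ge h3]
      abel
    · simp [h3, h4, lt_of_not_ge h3, lt_of_not_ge h4]
  · simp [h1, h2]
  · have h4 : k ≠ j := fun h => h1 h.symm
    simp [h1, h2, h4]
  · simp [h1, h2]

end Wedge

/-! ### Charge and energy -/

section Grading

namespace Wedge

theorem charge_add {S : Wedge} {j : ℤ} (hj : j ∉ S.occ) : (S.add j).charge = S.charge + 1 := by
  have hf1 : (S.occ \ Set.Iio 0).Finite := S.finite_diff.subset fun x hx => Or.inl hx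
  have hf2 : (Set.Iio 0 \ (S.add j).occ).Finite :=
    (S.add j).finite_diff.subset fun x hx => Or.inr hx
  rw [charge, charge]
  rcases lt_or_ge j 0 with h | h
  · have h1 : (S.add j).occ \ Set.Iio 0 = S.occ \ Set.Iio 0 := by
      ext n
      simp only [Set.mem_sdiff, mem_add, Set.mem_Iio]
      constructor
      · rintro ⟨rfl | h1, h2⟩
        · exact absurd h h2
        · exact ⟨h1, h2⟩
      · rintro ⟨h1, h2⟩; exact ⟨Or.inr h1, h2⟩
    have h2 : Set.Iio 0 \ S.occ = insert j (Set.Iio 0 \ (S.add j).occ) := by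
      ext n
      simp only [Set.mem_sdiff, mem_add, Set.mem_Iio, Set.mem_insert_iff]
      constructor
      · rintro ⟨h1, h2⟩; tauto
      · rintro (rfl | h1)
        · exact ⟨h, hj⟩
        · tauto
    rw [h1, h2, Set.ncard_insert_of_notMem (fun h' => h'.2 (Or.inl rfl)) hf2]
    push_cast; ring
  · have h1 : (S.add j).occ \ Set.Iio 0 = insert j (S.occ \ Set.Iio 0) := by
      ext n
      simp only [Set.mem_sdiff, mem_add, Set.mem_Iio, Set.mem_insert_iff]
      constructor
      · rintro ⟨h1, h2⟩; tauto
      · rintro (rfl | h1)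
        · exact ⟨Or.inl rfl, by omega⟩
        · tauto
    have h2 : Set.Iio 0 \ (S.add j).occ = Set.Iio 0 \ S.occ := by
      ext n
      simp only [Set.mem_sdiff, mem_add, Set.mem_Iio]
      constructor
      · rintro ⟨h1, h2⟩; tauto
      · rintro ⟨h1, h2⟩
        refine ⟨h1, ?_⟩
        rintro (rfl | h3)
        · omega
        · exact h2 h3
    rw [h1, h2, Set.ncard_insert_of_notMem (fun h' => hj h'.1) hf1]
    push_cast; ring

open Classical in
/-- The occupation number of `n`, relative to the vacuum. -/
noncomputable def number (S : Wedge) (n : ℤ) : ℤ :=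
  (if n ∈ S.occ then 1 else 0) - (if n < 0 then 1 else 0)

theorem number_eq_zero {S : Wedge} {n : ℤ} (h : n ∉ symmDiff S.occ (Set.Iio 0)) :
    S.number n = 0 := by
  simp only [Set.mem_symmDiff, Set.mem_Iio] at h
  rw [number]
  by_cases h1 : n ∈ S.occ <;> by_cases h2 : n < 0 <;> simp_all

/-- The energy of a basis vector relative to the vacuum. Since the integer `n` stands for
`n + 1/2`, this differs from the usual energy by half of the charge. -/
noncomputable def energy (S : Wedge) : ℤ := ∑ᶠ n, n * S.number n

theorem finite_support_mul_number (S : Wedge) :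
    (Function.support fun n => n * S.number n).Finite := by
  refine S.finite_diff.subset fun n hn => ?_
  by_contra h
  exact hn (by simp only [number_eq_zero h, mul_zero])

theorem energy_add {S : Wedge} {j : ℤ} (hj : j ∉ S.occ) : (S.add j).energy = S.energy + j := by
  have h : ∀ n, n * (S.add j).number n = n * S.number n + if n = j then j else 0 := by
    intro n
    rw [number, number]
    by_cases hn : n = j
    · subst hn
      rw [if_pos (show n ∈ (S.add n).occ from Or.inl rfl), if_neg hj, if_pos rfl]; ring
    · have : n ∈ (S.add j).occ ↔ n ∈ S.occ := by rw [mem_add]; tauto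
      rw [if_neg hn, add_zero, propext this]
  rw [energy, finsum_congr h, finsum_add_distrib S.finite_support_mul_number
    ((Set.finite_singleton j).subset (by intro n; simp; tauto)), ← energy]
  congr 1
  rw [finsum_eq_single _ j (fun n hn => if_neg hn), if_pos rfl]

theorem charge_remove_add {S : Wedge} {i j : ℤ} (hj : j ∈ S.occ) (hi : i ∉ (S.remove j).occ) :
    ((S.remove j).add i).charge = S.charge := by
  have h := charge_add (S := S.remove j) (j := j) (fun h => h.2 rfl)
  rw [add_remove hj] at h
  rw [charge_add hi, h]

theorem energy_remove_add {S : Wedge} {i j : ℤ} (hj : j ∈ S.occ) (hi : i ∉ (S.remove j).occ) :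
    ((S.remove j).add i).energy = S.energy + i - j := by
  have h := energy_add (S := S.remove j) (j := j) (fun h => h.2 rfl)
  rw [add_remove hj] at h
  rw [energy_add hi, h]; ring

end Wedge

/-- The operator `E_{i,j}` preserves the charge, and changes the energy by `i - j`. -/
theorem grading_of_normalE_ne_zero {i j : ℤ} {S T : Wedge}
    (h : normalE i j (Finsupp.single S 1) T ≠ 0) :
    T.charge = S.charge ∧ T.energy = S.energy + i - j := by
  rw [normalE_apply, Finsupp.sub_apply] at h
  have key : psi i (psiStar j (Finsupp.single S 1)) T ≠ 0 →
      T.charge = S.charge ∧ T.energy = S.energy + i - j := by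
    intro h1
    by_cases hj : j ∈ S.occ
    swap
    · exact absurd (by rw [psiStar_single_of_notMem hj, map_zero, Finsupp.zero_apply]) h1
    rw [psiStar_single_of_mem hj] at h1
    by_cases hi : i ∈ (S.remove j).occ
    · exact absurd (by rw [psi_single_of_mem hi, Finsupp.zero_apply]) h1
    rw [psi_single_of_notMem hi] at h1
    obtain rfl : (S.remove j).add i = T := by
      by_contra hne
      exact h1 (Finsupp.single_eq_of_ne (Ne.symm hne))
    exact ⟨Wedge.charge_remove_add hj hi, Wedge.energy_remove_add hj hi⟩
  by_cases h1 : psi i (psiStar j (Finsupp.single S 1)) T = 0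
  · by_cases h2 : i = j ∧ j < 0
    · by_cases h3 : T = S
      · subst h3; exact ⟨rfl, by rw [h2.1]; ring⟩
      · rw [h1, if_pos h2, Finsupp.single_eq_of_ne h3, sub_zero] at h
        exact absurd rfl h
    · simp [h1, h2] at h
  · exact key h1

/-- On a given vector, only finitely many of the operators `E_{n-m,n}` are nonzero. -/
theorem exists_normalE_eq_zero (m : ℤ) (v : InfWedge) :
    ∃ B : ℤ, ∀ n, B < |n| → normalE (n - m) n v = 0 := by
  induction v using Finsupp.induction_linear with
  | zero => exact ⟨0, fun n _ => map_zero _⟩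
  | add v w hv hw =>
    obtain ⟨B, hB⟩ := hv
    obtain ⟨B', hB'⟩ := hw
    refine ⟨max B B', fun n hn => ?_⟩
    rw [map_add, hB n (lt_of_le_of_lt (le_max_left _ _) hn),
      hB' n (lt_of_le_of_lt (le_max_right _ _) hn), add_zero]
  | single S c =>
    obtain ⟨B, hB⟩ : ∃ B : ℤ, ∀ n ∈ symmDiff S.occ (Set.Iio 0), |n| ≤ B := by
      obtain ⟨B, hB⟩ := (S.finite_diff.image fun n => |n|).bddAbove
      exact ⟨B, fun n hn => hB ⟨n, hn, rfl⟩⟩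
    have hmem : ∀ n, B < |n| → (n ∈ S.occ ↔ n < 0) := by
      intro n hn
      have h := fun h => not_le.2 hn (hB n h)
      simp only [Set.mem_symmDiff, Set.mem_Iio] at h
      tauto
    refine ⟨max B 0 + |m|, fun n hn => ?_⟩
    have h0 : 0 ≤ |m| := abs_nonneg m
    have h1 : B < |n| := lt_of_le_of_lt (le_max_left B 0) (by omega)
    have h2 : B < |n - m| := by
      have := abs_sub_abs_le_abs_sub n m
      exact lt_of_le_of_lt (le_max_left B 0) (by omega)
    have hn' : |m| < |n| := by
      have := le_max_right B 0; omega
    rw [normalE_apply]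
    rcases lt_or_ge n 0 with h | h
    · have hS : n ∈ S.occ := (hmem n h1).2 h
      rw [psiStar_single_of_mem hS]
      by_cases hm : m = 0
      · subst hm
        rw [sub_zero, if_pos ⟨rfl, h⟩, psi_single_of_notMem (S := S.remove n) (fun h => h.2 rfl),
          Wedge.add_remove hS, Wedge.sign_remove hS, if_neg (lt_irrefl n), mul_one, mul_assoc,
          Wedge.sign_mul_self, mul_one, sub_self]
      · have hneg : n - m < 0 := by
          rw [abs_of_neg h] at hn'
          have := neg_abs_le m; omega
        have hm' : n - m ≠ n := by omega
        rw [if_neg (fun h => hm' h.1), psi_single_of_mem (S := S.remove n)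
          ⟨(hmem _ h2).2 hneg, hm'⟩, sub_zero]
    · rw [psiStar_single_of_notMem (fun h' => absurd ((hmem n h1).1 h') (not_lt.2 h)), map_zero,
        if_neg (fun h' => absurd h'.2 (not_lt.2 h)), sub_zero]

end Grading

/-! ### The operators `∑_n φ(n) E_{n-m,n}` -/

section DiagonalOperators

/-- The operator `∑_n φ(n) E_{n-m,n}` on the infinite wedge. The sum is infinite, but on each vector
only finitely many terms are nonzero, see `exists_normalE_eq_zero`. -/
noncomputable def diagOp (φ : ℤ → ℂ) (m : ℤ) : InfWedge →ₗ[ℂ] InfWedge :=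
  Finsupp.linearCombination ℂ fun S : Wedge =>
    ∑ᶠ n, φ n • normalE (n - m) n (Finsupp.single S 1)

theorem diagOp_apply_eq_sum (φ : ℤ → ℂ) (m : ℤ) (v : InfWedge) {B : ℤ}
    (hB : ∀ n, B < |n| → normalE (n - m) n v = 0) :
    diagOp φ m v = ∑ n ∈ Icc (-B) B, φ n • normalE (n - m) n v := by
  have hfin : ∀ w : InfWedge, (Function.support fun n => φ n • normalE (n - m) n w).Finite := by
    intro w
    obtain ⟨B, hB⟩ := exists_normalE_eq_zero m w
    refine (Set.finite_Icc (-B) B).subset fun n hn => ?_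
    rw [Set.mem_Icc, ← abs_le]
    by_contra h
    exact hn (by simp only [hB n (not_le.1 h), smul_zero])
  have hsum : diagOp φ m v = ∑ᶠ n, φ n • normalE (n - m) n v := by
    clear hB
    induction v using Finsupp.induction_linear with
    | zero => simp
    | add v w hv hw =>
      simp only [map_add, hv, hw, smul_add]
      rw [finsum_add_distrib (hfin v) (hfin w)]
    | single S c =>
      rw [diagOp, Finsupp.linearCombination_single, smul_finsum' _ (hfin _)]
      refine finsum_congr fun n => ?_
      rw [smul_comm, ← map_smul, Finsupp.smul_single, smul_eq_mul, mul_one]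
  rw [hsum]
  refine finsum_eq_sum_of_support_subset _ fun n hn => ?_
  rw [Finset.coe_Icc, Set.mem_Icc, ← abs_le]
  by_contra h
  exact hn (by simp only [hB n (not_le.1 h), smul_zero])

theorem sum_diagOp {ι : Type*} (s : Finset ι) (φ : ι → ℤ → ℂ) (m : ℤ) (v : InfWedge) :
    ∑ i ∈ s, diagOp (φ i) m v = diagOp (fun n => ∑ i ∈ s, φ i n) m v := by
  obtain ⟨B, hB⟩ := exists_normalE_eq_zero m v
  simp only [fun φ => diagOp_apply_eq_sum φ m v hB, Finset.sum_smul]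
  exact Finset.sum_comm

theorem diagOp_zero (m : ℤ) (v : InfWedge) : diagOp (fun _ => 0) m v = 0 := by
  simpa using (sum_diagOp (∅ : Finset ℕ) (fun _ _ => 0) m v).symm

/-- The operator `∑_n φ(n) E_{n-m,n}` preserves the charge, and lowers the energy by `m`. -/
theorem grading_of_diagOp_ne_zero {φ : ℤ → ℂ} {m : ℤ} {S T : Wedge}
    (h : diagOp φ m (Finsupp.single S 1) T ≠ 0) :
    T.charge = S.charge ∧ T.energy = S.energy - m := by
  obtain ⟨B, hB⟩ := exists_normalE_eq_zero m (Finsupp.single S 1)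
  rw [diagOp_apply_eq_sum φ m _ hB, Finsupp.finsetSum_apply] at h
  obtain ⟨n, -, hn⟩ := Finset.exists_ne_zero_of_sum_ne_zero h
  rw [Finsupp.smul_apply, smul_eq_mul] at hn
  obtain ⟨h1, h2⟩ := grading_of_normalE_ne_zero (right_ne_zero_of_mul hn)
  exact ⟨h1, by rw [h2]; ring⟩

/-- The central term of the commutator comes from the change of normal ordering between `k` and
`k + m`. -/
theorem sum_sign_change_eq_betweenSum (g : ℤ → ℂ) {m B : ℤ} (hB : |m| ≤ B) :
    ∑ k ∈ Icc (-B) B, g k * ((if 0 ≤ k + m then 1 else 0) - (if 0 ≤ k then 1 else 0))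
      = betweenSum m g := by
  have h1 : Ico (-m) 0 ⊆ Icc (-B) B := by
    intro n; simp only [mem_Ico, mem_Icc]; have := abs_le.1 hB; omega
  have h2 : Ico 0 (-m) ⊆ Icc (-B) B := by
    intro n; simp only [mem_Ico, mem_Icc]; have := abs_le.1 hB; omega
  rw [betweenSum, ← inter_eq_right.2 h1, ← inter_eq_right.2 h2, ← Finset.sum_ite_mem,
    ← Finset.sum_ite_mem, ← Finset.sum_sub_distrib]
  refine Finset.sum_congr rfl fun k _ => ?_
  simp only [mem_Ico]
  by_cases h3 : 0 ≤ k <;> by_cases h4 : 0 ≤ k + m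
  · rw [if_pos h3, if_pos h4, if_neg (by omega), if_neg (by omega)]; ring
  · rw [if_pos h3, if_neg h4, if_neg (by omega), if_pos (by omega)]; ring
  · rw [if_neg h3, if_pos h4, if_pos (by omega), if_neg (by omega)]; ring
  · rw [if_neg h3, if_neg h4, if_neg (by omega), if_neg (by omega)]; ring

/-- The commutation relations of the operators `∑_n φ(n) E_{n-m,n}`. On a given vector all sums may
be restricted to one large interval, where the relations of the `E_{i,j}` apply term by term. -/
theorem diagOp_commutator (φ χ : ℤ → ℂ) (m m' : ℤ) (v : InfWedge) :
    diagOp φ m (diagOp χ m' v) - diagOp χ m' (diagOp φ m v)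
      = diagOp (fun n => φ (n - m') * χ n - φ n * χ (n - m)) (m + m') v
        + (if m + m' = 0 then betweenSum m (fun n => φ (n + m) * χ n) else 0) • v := by
  obtain ⟨B₁, h₁⟩ := exists_normalE_eq_zero m v
  obtain ⟨B₂, h₂⟩ := exists_normalE_eq_zero m' v
  obtain ⟨B₃, h₃⟩ := exists_normalE_eq_zero (m + m') v
  obtain ⟨B₄, h₄⟩ := exists_normalE_eq_zero m (diagOp χ m' v)
  obtain ⟨B₅, h₅⟩ := exists_normalE_eq_zero m' (diagOp φ m v)
  obtain ⟨B, hB⟩ : ∃ B : ℤ, B = |B₁| + |B₂| + |B₃| + |B₄| + |B₅| + |m| + |m'| := ⟨_, rfl⟩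
  have a1 := le_abs_self B₁
  have a2 := le_abs_self B₂
  have a3 := le_abs_self B₃
  have a4 := le_abs_self B₄
  have a5 := le_abs_self B₅
  have b1 := abs_nonneg B₁
  have b2 := abs_nonneg B₂
  have b3 := abs_nonneg B₃
  have b4 := abs_nonneg B₄
  have b5 := abs_nonneg B₅
  have c1 := abs_nonneg m
  have c2 := abs_nonneg m'
  have hin : ∀ n, ¬ |n| ≤ B → ∀ j, |j| ≤ |m| + |m'| → B₃ < |n + j| := by
    intro n hn j hj
    have := abs_sub_abs_le_abs_sub n (-j)
    rw [abs_neg, sub_neg_eq_add] at this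
    omega
  have e1 : diagOp φ m (diagOp χ m' v) = ∑ n ∈ Icc (-B) B, ∑ k ∈ Icc (-B) B,
      (φ n * χ k) • normalE (n - m) n (normalE (k - m') k v) := by
    rw [diagOp_apply_eq_sum φ m _ (B := B) (fun n hn => h₄ n (by omega)),
      diagOp_apply_eq_sum χ m' v (B := B) (fun n hn => h₂ n (by omega))]
    simp only [map_sum, map_smul, Finset.smul_sum, smul_smul]
  have e2 : diagOp χ m' (diagOp φ m v) = ∑ n ∈ Icc (-B) B, ∑ k ∈ Icc (-B) B,
      (φ n * χ k) • normalE (k - m') k (normalE (n - m) n v) := by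
    rw [diagOp_apply_eq_sum χ m' _ (B := B) (fun n hn => h₅ n (by omega)),
      diagOp_apply_eq_sum φ m v (B := B) (fun n hn => h₁ n (by omega))]
    simp only [map_sum, map_smul, Finset.smul_sum, smul_smul]
    rw [Finset.sum_comm]
    simp only [mul_comm]
  have e3 : diagOp (fun n => φ (n - m') * χ n - φ n * χ (n - m)) (m + m') v
      = ∑ n ∈ Icc (-B) B, ∑ k ∈ Icc (-B) B,
        ((φ n * χ k) • (if n = k - m' then normalE (n - m) k v else 0)
          - (φ n * χ k) • (if n - m = k then normalE (k - m') n v else 0)) := by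
    rw [diagOp_apply_eq_sum _ _ v (B := B) (fun n hn => h₃ n (by omega))]
    simp only [sub_smul, Finset.sum_sub_distrib]
    congr 1
    · rw [Finset.sum_comm]
      refine Finset.sum_congr rfl fun k hk => ?_
      by_cases hk' : k - m' ∈ Icc (-B) B
      · rw [Finset.sum_eq_single_of_mem _ hk' (fun n _ hn => by rw [if_neg hn, smul_zero]),
          if_pos rfl, show k - m' - m = k - (m + m') by ring]
      · rw [Finset.sum_eq_zero]
        · rw [h₃ k, smul_zero]
          rw [mem_Icc, ← abs_le] at hk'
          have := hin _ hk' m' (by omega)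
          rwa [sub_add_cancel] at this
        · intro n hn
          rw [if_neg (by rintro rfl; exact hk' hn), smul_zero]
    · refine Finset.sum_congr rfl fun n hn => ?_
      by_cases hn' : n - m ∈ Icc (-B) B
      · rw [Finset.sum_eq_single_of_mem _ hn'
          (fun k _ hk => by rw [if_neg (Ne.symm hk), smul_zero]),
          if_pos rfl, show n - m - m' = n - (m + m') by ring]
      · rw [Finset.sum_eq_zero]
        · rw [h₃ n, smul_zero]
          rw [mem_Icc, ← abs_le] at hn'
          have := hin _ hn' m (by omega)
          rwa [sub_add_cancel] at this
        · intro k hk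
          rw [if_neg (by rintro rfl; exact hn' hk), smul_zero]
  have e4 : (if m + m' = 0 then betweenSum m (fun n => φ (n + m) * χ n) else 0)
      = ∑ n ∈ Icc (-B) B, ∑ k ∈ Icc (-B) B, (φ n * χ k) *
        (if n - m = k ∧ n = k - m' then ((if 0 ≤ n then 1 else 0) - (if 0 ≤ k then 1 else 0) : ℂ)
          else 0) := by
    split_ifs with h
    · rw [← sum_sign_change_eq_betweenSum _ (show |m| ≤ B by omega), Finset.sum_comm]
      refine Finset.sum_congr rfl fun k hk => ?_
      by_cases hk' : k + m ∈ Icc (-B) B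
      · rw [Finset.sum_eq_single_of_mem _ hk' (fun n _ hn => by rw [if_neg (by omega), mul_zero]),
          if_pos (show k + m - m = k ∧ k + m = k - m' from ⟨by omega, by omega⟩)]
      · rw [Finset.sum_eq_zero]
        · rw [mem_Icc] at hk' hk
          have := abs_le.1 (show |m| ≤ B by omega)
          by_cases h0 : 0 ≤ k
          · rw [if_pos h0, if_pos (by omega), sub_self, mul_zero]
          · rw [if_neg h0, if_neg (by omega), sub_self, mul_zero]
        · intro n hn
          rw [if_neg (by rintro ⟨rfl, -⟩; exact hk' (by rwa [sub_add_cancel])), mul_zero]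
    · refine (Finset.sum_eq_zero fun n _ => Finset.sum_eq_zero fun k _ => ?_).symm
      rw [if_neg (by omega), mul_zero]
  rw [e1, e2, e3, e4, Finset.sum_smul, ← Finset.sum_sub_distrib, ← Finset.sum_add_distrib]
  refine Finset.sum_congr rfl fun n _ => ?_
  rw [Finset.sum_smul, ← Finset.sum_sub_distrib, ← Finset.sum_add_distrib]
  refine Finset.sum_congr rfl fun k _ => ?_
  rw [← smul_sub, normalE_commutator, smul_add, smul_sub, smul_smul]

end DiagonalOperators

/-! ### Coefficients of the powers of `z` -/

section Coefficients

theorem coeff_const_mul_zVar_zpow_mul (x : ℂ) (i k : ℤ) (f : ℂ⟦X⟧) :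
    (const x * zVar ^ i * (f : ℂ⸨X⸩)).coeff k = x * intCoeff f (k - i) := by
  have h : zVar ^ i = HahnSeries.single i (1 : ℂ) := by
    rw [RatFunc.single_zpow, zVar, PowerSeries.coe_X]
  have hc : const x = HahnSeries.C x := HahnSeries.ofPowerSeries_C x
  rw [h, hc, mul_assoc, HahnSeries.C_mul_eq_smul, HahnSeries.coeff_smul, smul_eq_mul,
    HahnSeries.coeff_single_mul, one_mul, intCoeff]

theorem const_mul (x y : ℂ) : const x * const y = const (x * y) := by
  rw [const, const, const, ← map_mul, ← map_mul]

theorem inv_coe_sigmaSeries (κ : ℂ) :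
    ((sigmaSeries κ : ℂ⟦X⟧) : ℂ⸨X⸩)⁻¹
      = const κ⁻¹ * zVar ^ (-1 : ℤ) * ((((sUnit κ)⁻¹ : ℂ⟦X⟧ˣ) : ℂ⟦X⟧) : ℂ⸨X⸩) := by
  have h1 : (const κ)⁻¹ = const κ⁻¹ := by
    rw [const, const, PowerSeries.coe_C, PowerSeries.coe_C, map_inv₀]
  have h2 : ((sSeries κ : ℂ⟦X⟧) : ℂ⸨X⸩)⁻¹ = ((((sUnit κ)⁻¹ : ℂ⟦X⟧ˣ) : ℂ⟦X⟧) : ℂ⸨X⸩) := by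
    refine inv_eq_of_mul_eq_one_right ?_
    rw [← map_mul, ← map_one (HahnSeries.ofPowerSeries ℤ ℂ)]
    exact congrArg _ (sUnit κ).mul_inv
  rw [← X_mul_sSeries, map_mul, map_mul, mul_inv, mul_inv, h2, zpow_neg_one, ← h1]
  rfl

open Classical in
/-- The coefficient of `z ^ k` in an entry of `x z ^ i f(z) ℰ_m(κ z)`. -/
theorem coeff_mul_opE (x κ : ℂ) (i k m : ℤ) (f : ℂ⟦X⟧) (T S : State) :
    (const x * zVar ^ i * (f : ℂ⸨X⸩) * opE m κ T S).coeff k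
      = diagOp (fun n => x * intCoeff (f * expSeries (κ * ((n : ℂ) + 1 / 2 - (m : ℂ) / 2))) (k - i))
          m (Finsupp.single (S : Wedge) 1) (T : Wedge)
        + if m = 0 ∧ T = S then
          x * κ⁻¹ * intCoeff (f * (((sUnit κ)⁻¹ : ℂ⟦X⟧ˣ) : ℂ⟦X⟧)) (k - i + 1) else 0 := by
  obtain ⟨B, hB⟩ := exists_normalE_eq_zero m (Finsupp.single (S : Wedge) 1)
  have h0 : const 0 = 0 := by rw [const, map_zero, map_zero]
  rw [opE, mul_add, HahnSeries.coeff_add, finsum_eq_sum_of_support_subset (s := Icc (-B) B)]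
  swap
  · intro n hn
    rw [Finset.coe_Icc, Set.mem_Icc, ← abs_le]
    by_contra h
    exact hn (by simp only [hB n (not_le.1 h), Finsupp.zero_apply, h0, mul_zero])
  congr 1
  · rw [diagOp_apply_eq_sum _ m _ hB, Finset.mul_sum, HahnSeries.coeff_sum,
      Finsupp.finsetSum_apply]
    refine Finset.sum_congr rfl fun n _ => ?_
    have h1 : ∀ y w : ℂ, const x * zVar ^ i * (f : ℂ⸨X⸩) * ((expSeries w : ℂ⟦X⟧) * const y)
        = const (x * y) * zVar ^ i * ((f * expSeries w : ℂ⟦X⟧) : ℂ⸨X⸩) := by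
      intro y w
      rw [← const_mul, map_mul]
      ring
    rw [Finsupp.smul_apply, smul_eq_mul, mul_right_comm x, ← coeff_const_mul_zVar_zpow_mul, h1]
  · split_ifs with h
    · have hz : zVar ≠ 0 := by
        rw [zVar, PowerSeries.coe_X]
        exact HahnSeries.single_ne_zero one_ne_zero
      have h1 : ∀ g : ℂ⟦X⟧, const x * zVar ^ i * (f : ℂ⸨X⸩) * (const κ⁻¹ * zVar ^ (-1 : ℤ) * g)
          = const (x * κ⁻¹) * zVar ^ (i + -1) * ((f * g : ℂ⟦X⟧) : ℂ⸨X⸩) := by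
        intro g
        rw [← const_mul, map_mul, zpow_add₀ hz]
        ring
      rw [inv_coe_sigmaSeries, show k - i + 1 = k - (i + -1) by ring,
        ← coeff_const_mul_zVar_zpow_mul, h1]
    · rw [mul_zero, HahnSeries.coeff_zero]

/-- The operator `ℰ_m` lowers the energy by `m`. -/
theorem opE_eq_zero {m : ℤ} {κ : ℂ} {T S : State}
    (h : (T : Wedge).energy ≠ (S : Wedge).energy - m) : opE m κ T S = 0 := by
  ext k
  have h1 := coeff_mul_opE 1 κ 0 k m 1 T S
  rw [show const 1 = 1 by rw [const, map_one, map_one], zpow_zero, map_one, one_mul, one_mul,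
    one_mul] at h1
  rw [h1, HahnSeries.coeff_zero, if_neg, add_zero]
  · by_contra h2
    exact h (grading_of_diagOp_ne_zero h2).2
  · rintro ⟨rfl, rfl⟩
    exact h (by ring)

/-- The operator on one tensor factor that is the `i`-th summand of the coefficient of `z ^ k` in
`𝒜_{a / r}`, where `x` is the power of the chosen root. -/
noncomputable def summandOp (r a : ℕ) (κ x : ℂ) (k i : ℤ) : InfWedge →ₗ[ℂ] InfWedge :=
  diagOp (fun n => x * intCoeff
      (coeffA r (r * κ) a i *
        expSeries (κ * ((n : ℂ) + 1 / 2 - ((i * r + a : ℤ) : ℂ) / 2))) (k - i))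
    (i * r + a) +
  (if i * r + a = 0 then
    x * κ⁻¹ * intCoeff (coeffA r (r * κ) a i * (((sUnit κ)⁻¹ : ℂ⟦X⟧ˣ) : ℂ⟦X⟧)) (k - i + 1)
    else 0) • LinearMap.id

theorem summandOp_apply (r a : ℕ) (κ x : ℂ) (k i : ℤ) (v : InfWedge) :
    summandOp r a κ x k i v = diagOp (fun n => x * intCoeff
      (coeffA r (r * κ) a i *
        expSeries (κ * ((n : ℂ) + 1 / 2 - ((i * r + a : ℤ) : ℂ) / 2))) (k - i))
    (i * r + a) v +
  (if i * r + a = 0 then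
    x * κ⁻¹ * intCoeff (coeffA r (r * κ) a i * (((sUnit κ)⁻¹ : ℂ⟦X⟧ˣ) : ℂ⟦X⟧)) (k - i + 1)
    else 0) • v := rfl

theorem summandOp_eq_zero {r a : ℕ} {κ x : ℂ} {k i : ℤ} (h : k + 1 < i) (v : InfWedge) :
    summandOp r a κ x k i v = 0 := by
  rw [summandOp_apply]
  simp only [intCoeff_of_neg _ (show k - i < 0 by omega),
    intCoeff_of_neg _ (show k - i + 1 < 0 by omega), mul_zero, diagOp_zero, ite_self, zero_smul,
    add_zero]

theorem grading_of_summandOp_ne_zero {r a : ℕ} {κ x : ℂ} {k i : ℤ} {S T : Wedge}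
    (h : summandOp r a κ x k i (Finsupp.single S 1) T ≠ 0) :
    T.charge = S.charge ∧ T.energy = S.energy - (i * r + a) := by
  rw [summandOp_apply, Finsupp.add_apply, Finsupp.smul_apply] at h
  by_cases h1 : diagOp (fun n => x * intCoeff (coeffA r (r * κ) a i *
      expSeries (κ * ((n : ℂ) + 1 / 2 - ((i * r + a : ℤ) : ℂ) / 2))) (k - i))
        (i * r + a) (Finsupp.single S 1) T = 0
  · rw [h1, zero_add] at h
    have h2 : i * (r : ℤ) + a = 0 := by
      by_contra h2
      exact h (by rw [if_neg h2, zero_smul])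
    have h3 : T = S := by
      by_contra h3
      exact h (by rw [Finsupp.single_eq_of_ne h3, smul_zero])
    subst h3
    exact ⟨rfl, by rw [h2, sub_zero]⟩
  · exact grading_of_diagOp_ne_zero h1

end Coefficients

/-! ### Products of infinite matrices -/

section GradedMatrices

/-- A family of operators on the infinite wedge, the `i`-th of which preserves the charge, lowers
the energy by `i r + a`, and vanishes for `i > k`. -/
structure IsGradedFamily (r a : ℕ) (k : ℤ) (P : ℤ → InfWedge →ₗ[ℂ] InfWedge) : Prop where
  eq_zero : ∀ i, k < i → ∀ v, P i v = 0
  grading : ∀ i (S T : Wedge), P i (Finsupp.single S 1) T ≠ 0 →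
    T.charge = S.charge ∧ T.energy = S.energy - (i * r + a)

theorem isGradedFamily_summandOp (r a : ℕ) (κ x : ℂ) (k : ℤ) :
    IsGradedFamily r a (k + 1) (summandOp r a κ x k) where
  eq_zero _ h v := summandOp_eq_zero h v
  grading _ _ _ h := grading_of_summandOp_ne_zero h

/-- The matrix of the sum of a family of operators on the charge zero part of the infinite wedge.
-/
noncomputable def familyMatrix (P : ℤ → InfWedge →ₗ[ℂ] InfWedge) : Matrix State State ℂ :=
  fun T S => ∑ᶠ i, P i (Finsupp.single (S : Wedge) 1) (T : Wedge)

variable {r a b : ℕ} [NeZero r] {k l : ℤ} {P Q : ℤ → InfWedge →ₗ[ℂ] InfWedge}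

theorem eq_of_mul_add_eq {i j : ℤ} {e : ℤ} (h : e - (i * r + a) = e - (j * r + a)) : i = j := by
  have hr : (r : ℤ) ≠ 0 := by exact_mod_cast NeZero.ne r
  exact mul_right_cancel₀ hr (by linarith)

theorem IsGradedFamily.familyMatrix_apply (hP : IsGradedFamily r a k P) {T S : State} {i : ℤ}
    (h : (T : Wedge).energy = (S : Wedge).energy - (i * r + a)) :
    familyMatrix P T S = P i (Finsupp.single (S : Wedge) 1) (T : Wedge) := by
  refine finsum_eq_single _ i fun j hj => ?_
  by_contra h1
  exact hj (eq_of_mul_add_eq ((hP.grading j _ _ h1).2.symm.trans h))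

omit [NeZero r] in
theorem IsGradedFamily.familyMatrix_eq_zero (hP : IsGradedFamily r a k P) {T S : State}
    (h : ∀ i : ℤ, (T : Wedge).energy ≠ (S : Wedge).energy - (i * r + a)) :
    familyMatrix P T S = 0 := by
  refine finsum_eq_zero_of_forall_eq_zero fun j => ?_
  by_contra h1
  exact h j (hP.grading j _ _ h1).2

/-- The value of an operator on a vector of charge zero is computed by its matrix on the charge zero
states. -/
theorem apply_eq_finsum (L : InfWedge →ₗ[ℂ] InfWedge) {v : InfWedge}
    (hv : ∀ W, v W ≠ 0 → W.charge = 0) (T : Wedge) :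
    (Function.support fun U : State => L (Finsupp.single (U : Wedge) 1) T * v U).Finite ∧
      ∑ᶠ U : State, L (Finsupp.single (U : Wedge) 1) T * v U = L v T := by
  classical
  have hsub : (Function.support fun U : State => L (Finsupp.single (U : Wedge) 1) T * v U) ⊆
      (v.support.subtype fun S => S.charge = 0 : Finset State) := by
    intro U hU
    rw [Finset.mem_coe, Finset.mem_subtype, Finsupp.mem_support_iff]
    exact right_ne_zero_of_mul hU
  refine ⟨(Finset.finite_toSet _).subset hsub, ?_⟩
  rw [finsum_eq_sum_of_support_subset _ hsub,
    Finset.sum_subtype_of_mem (fun W => L (Finsupp.single W 1) T * v W)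
      (fun W hW => hv W (Finsupp.mem_support_iff.1 hW))]
  conv_rhs => rw [← Finsupp.sum_single v, Finsupp.sum, map_sum, Finsupp.finsetSum_apply]
  refine Finset.sum_congr rfl fun W _ => ?_
  rw [← mul_one (v W), ← smul_eq_mul (v W) 1, ← Finsupp.smul_single, map_smul, Finsupp.smul_apply,
    smul_eq_mul, smul_eq_mul, mul_one, mul_comm]

omit [NeZero r] in
theorem IsGradedFamily.mul_eq_zero (hP : IsGradedFamily r a k P) (hQ : IsGradedFamily r b l Q)
    {T S : State} (h : ∀ N : ℤ, (T : Wedge).energy ≠ (S : Wedge).energy - (N * r + a + b))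
    (U : State) : familyMatrix P T U * familyMatrix Q U S = 0 := by
  by_cases h1 : ∃ i : ℤ, (T : Wedge).energy = (U : Wedge).energy - (i * r + a)
  · obtain ⟨i, hi⟩ := h1
    rw [hQ.familyMatrix_eq_zero, mul_zero]
    intro j hj
    exact h (i + j) (by rw [hi, hj]; ring)
  · rw [hP.familyMatrix_eq_zero (fun i hi => h1 ⟨i, hi⟩), zero_mul]

/-- In a product of matrices, the energies of the outer states fix the sum `N` of the two indices,
and the vanishing for large indices leaves finitely many pairs. -/
theorem IsGradedFamily.mul_eq_sum (hP : IsGradedFamily r a k P) (hQ : IsGradedFamily r b l Q)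
    {T S : State} {N : ℤ} (h : (T : Wedge).energy = (S : Wedge).energy - (N * r + a + b))
    (U : State) : familyMatrix P T U * familyMatrix Q U S =
      ∑ i ∈ Icc (N - l) k, P i (Finsupp.single (U : Wedge) 1) (T : Wedge) *
        Q (N - i) (Finsupp.single (S : Wedge) 1) (U : Wedge) := by
  by_cases h1 : ∃ j : ℤ, (U : Wedge).energy = (S : Wedge).energy - (j * r + b)
  · obtain ⟨j, hj⟩ := h1
    have hi : (T : Wedge).energy = (U : Wedge).energy - ((N - j : ℤ) * r + a) := by
      rw [h, hj]; ring
    rw [hQ.familyMatrix_apply hj, hP.familyMatrix_apply hi]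
    by_cases hmem : N - j ∈ Icc (N - l) k
    · rw [Finset.sum_eq_single_of_mem _ hmem, sub_sub_cancel]
      intro i _ hij
      by_contra h2
      have := eq_of_mul_add_eq ((hQ.grading _ _ _ (right_ne_zero_of_mul h2)).2.symm.trans hj)
      exact hij (by omega)
    · rw [Finset.sum_eq_zero]
      · rw [mem_Icc, not_and_or, not_le, not_le] at hmem
        rcases hmem with h2 | h2
        · rw [hQ.eq_zero j (by omega), Finsupp.zero_apply, mul_zero]
        · rw [hP.eq_zero _ h2, Finsupp.zero_apply, zero_mul]
      · intro i hi
        by_contra h2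
        have := eq_of_mul_add_eq ((hQ.grading _ _ _ (right_ne_zero_of_mul h2)).2.symm.trans hj)
        exact hmem (by rwa [show N - j = i by omega])
  · rw [hQ.familyMatrix_eq_zero (fun i hi => h1 ⟨i, hi⟩), mul_zero, Finset.sum_eq_zero]
    intro i _
    by_contra h2
    exact h1 ⟨_, (hQ.grading _ _ _ (right_ne_zero_of_mul h2)).2⟩

theorem IsGradedFamily.composable (hP : IsGradedFamily r a k P) (hQ : IsGradedFamily r b l Q) :
    Composable (familyMatrix P) (familyMatrix Q) := by
  intro T S
  by_cases h : ∃ N : ℤ, (T : Wedge).energy = (S : Wedge).energy - (N * r + a + b)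
  · obtain ⟨N, hN⟩ := h
    simp only [hP.mul_eq_sum hQ hN]
    refine Set.Finite.subset (Set.Finite.biUnion (Icc (N - l) k).finite_toSet fun i _ =>
      (apply_eq_finsum (P i) (v := Q (N - i) (Finsupp.single (S : Wedge) 1))
        (fun W hW => ((hQ.grading _ _ _ hW).1.trans S.2)) (T : Wedge)).1) ?_
    intro U hU
    obtain ⟨i, hi, hi'⟩ := Finset.exists_ne_zero_of_sum_ne_zero hU
    exact Set.mem_biUnion (Finset.mem_coe.2 hi) hi'
  · have : (Function.support fun U => familyMatrix P T U * familyMatrix Q U S) = ∅ := by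
      rw [Function.support_eq_empty_iff]
      funext U
      exact hP.mul_eq_zero hQ (fun N hN => h ⟨N, hN⟩) U
    rw [this]
    exact Set.finite_empty

omit [NeZero r] in
theorem IsGradedFamily.comp_eq_zero (hP : IsGradedFamily r a k P) (hQ : IsGradedFamily r b l Q)
    {T S : State} (h : ∀ N : ℤ, (T : Wedge).energy ≠ (S : Wedge).energy - (N * r + a + b)) :
    comp (familyMatrix P) (familyMatrix Q) T S = 0 :=
  finsum_eq_zero_of_forall_eq_zero (hP.mul_eq_zero hQ h)

theorem IsGradedFamily.comp_eq_sum (hP : IsGradedFamily r a k P) (hQ : IsGradedFamily r b l Q)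
    {T S : State} {N : ℤ} (h : (T : Wedge).energy = (S : Wedge).energy - (N * r + a + b)) :
    comp (familyMatrix P) (familyMatrix Q) T S =
      ∑ i ∈ Icc (N - l) k, P i (Q (N - i) (Finsupp.single (S : Wedge) 1)) (T : Wedge) := by
  have h1 := fun i => apply_eq_finsum (P i) (v := Q (N - i) (Finsupp.single (S : Wedge) 1))
    (fun W hW => ((hQ.grading _ _ _ hW).1.trans S.2)) (T : Wedge)
  rw [comp, finsum_congr (hP.mul_eq_sum hQ h), finsum_sum_comm _ _ (fun i _ => (h1 i).1)]
  exact Finset.sum_congr rfl fun i _ => (h1 i).2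

end GradedMatrices

section Factors

variable {K : Type*} [AddCommGroup K]

open Classical in
/-- The operator on the tensor product that is `M` on the factor labelled `γ` and the identity on
the other factors. -/
noncomputable def onFactor (γ : AddChar K ℂ) (M : Matrix State State ℂ) :
    Matrix (FockBasis K) (FockBasis K) ℂ := fun T S =>
  if ∀ γ', γ' ≠ γ → T γ' = S γ' then M (T γ) (S γ) else 0

variable {M N : Matrix State State ℂ} {γ γ' : AddChar K ℂ}

open Classical in
theorem onFactor_mul_onFactor (T S : FockBasis K) (U : FockBasis K) :
    onFactor γ M T U * onFactor γ N U S =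
      if U = Function.update S γ (U γ) ∧ ∀ δ, δ ≠ γ → T δ = S δ then M (T γ) (U γ) * N (U γ) (S γ)
      else 0 := by
  rw [onFactor, onFactor]
  have hU : U = Function.update S γ (U γ) ↔ ∀ δ, δ ≠ γ → U δ = S δ := by
    rw [Function.eq_update_iff]
    simp
  rw [hU]
  by_cases h1 : ∀ δ, δ ≠ γ → U δ = S δ
  · rw [if_pos h1]
    have h2 : (∀ δ, δ ≠ γ → T δ = U δ) ↔ ∀ δ, δ ≠ γ → T δ = S δ :=
      forall_congr' fun δ => imp_congr_right fun hδ => by rw [h1 δ hδ]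
    rw [propext h2]
    by_cases h3 : ∀ δ, δ ≠ γ → T δ = S δ
    · rw [if_pos h3, if_pos ⟨h1, h3⟩]
    · rw [if_neg h3, if_neg (fun h => h3 h.2), zero_mul]
  · rw [if_neg h1, mul_zero, if_neg (fun h => h1 h.1)]

theorem support_onFactor_mul_onFactor (T S : FockBasis K) [DecidableEq (AddChar K ℂ)] :
    (Function.support fun U => onFactor γ M T U * onFactor γ N U S) ⊆
      Function.update S γ '' Function.support fun V => M (T γ) V * N V (S γ) := by
  intro U hU
  rw [Function.mem_support, onFactor_mul_onFactor] at hU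
  have h : U = Function.update S γ (U γ) := by
    by_contra h
    refine hU (if_neg fun h' => h ?_)
    convert h'.1
  refine ⟨U γ, fun h0 => hU ?_, h.symm⟩
  have h1 : M (T γ) (U γ) * N (U γ) (S γ) = 0 := h0
  rw [h1, ite_self]

theorem composable_onFactor (h : Composable M N) :
    Composable (onFactor γ M) (onFactor γ N) := by
  classical
  exact fun T S => ((h (T γ) (S γ)).image _).subset (support_onFactor_mul_onFactor T S)

theorem comp_onFactor :
    comp (onFactor γ M) (onFactor γ N) = onFactor γ (comp M N) := by
  classical
  ext T S
  rw [comp, onFactor]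
  split_ifs with h
  · have h1 : ∀ V, onFactor γ M T (Function.update S γ V) * onFactor γ N (Function.update S γ V) S
        = M (T γ) V * N V (S γ) := by
      intro V
      rw [onFactor_mul_onFactor, Function.update_self, if_pos ⟨rfl, h⟩]
    have h2 := finsum_mem_range (f := fun U => onFactor γ M T U * onFactor γ N U S)
      (Function.update_injective S γ)
    rw [finsum_congr h1] at h2
    refine Eq.trans ?_ h2
    rw [← finsum_mem_univ]
    refine finsum_mem_inter_support_eq' _ _ _ fun U hU => ⟨fun _ => ?_, fun _ => Set.mem_univ U⟩
    obtain ⟨V, -, hV⟩ := support_onFactor_mul_onFactor T S hU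
    exact ⟨V, hV⟩
  · refine finsum_eq_zero_of_forall_eq_zero fun U => ?_
    rw [onFactor_mul_onFactor, if_neg (fun h' => h h'.2)]

open Classical in
theorem onFactor_mul_onFactor_of_ne (hγ : γ ≠ γ') (T S U : FockBasis K) :
    onFactor γ M T U * onFactor γ' N U S =
      if U = Function.update S γ' (T γ') then
        if ∀ δ, δ ≠ γ → δ ≠ γ' → T δ = S δ then M (T γ) (S γ) * N (T γ') (S γ') else 0
      else 0 := by
  rw [onFactor, onFactor]
  by_cases hU : U = Function.update S γ' (T γ')
  · rw [if_pos hU]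
    obtain ⟨h2, h3⟩ := Function.eq_update_iff.1 hU
    rw [if_pos h3, h2, h3 γ hγ]
    have h4 : (∀ δ, δ ≠ γ → T δ = U δ) ↔ ∀ δ, δ ≠ γ → δ ≠ γ' → T δ = S δ := by
      refine ⟨fun h δ h5 h6 => (h δ h5).trans (h3 δ h6), fun h δ h5 => ?_⟩
      by_cases h6 : δ = γ'
      · rw [h6, h2]
      · rw [h δ h5 h6, h3 δ h6]
    rw [propext h4, ite_mul, zero_mul]
  · rw [if_neg hU]
    by_cases h1 : ∀ δ, δ ≠ γ → T δ = U δ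
    · rw [if_neg (c := ∀ δ, δ ≠ γ' → U δ = S δ), mul_zero]
      intro h2
      exact hU (Function.eq_update_iff.2 ⟨(h1 γ' hγ.symm).symm, h2⟩)
    · rw [if_neg h1, zero_mul]

/-- Operators on different tensor factors commute. -/
theorem comp_onFactor_comm (hγ : γ ≠ γ') :
    comp (onFactor γ M) (onFactor γ' N) = comp (onFactor γ' N) (onFactor γ M) := by
  classical
  have h : ∀ (γ γ' : AddChar K ℂ) (M N : Matrix State State ℂ), γ ≠ γ' → ∀ T S : FockBasis K,
      comp (onFactor γ M) (onFactor γ' N) T S =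
        if ∀ δ, δ ≠ γ → δ ≠ γ' → T δ = S δ then M (T γ) (S γ) * N (T γ') (S γ') else 0 := by
    intro γ γ' M N hγ T S
    rw [comp, finsum_congr (onFactor_mul_onFactor_of_ne hγ T S),
      finsum_eq_single _ (Function.update S γ' (T γ')) (fun U hU => if_neg hU), if_pos rfl]
  ext T S
  rw [h _ _ _ _ hγ, h _ _ _ _ hγ.symm, mul_comm]
  exact if_congr ⟨fun h δ h1 h2 => h δ h2 h1, fun h δ h1 h2 => h δ h2 h1⟩ rfl rfl

theorem composable_onFactor_of_ne (hγ : γ ≠ γ') :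
    Composable (onFactor γ M) (onFactor γ' N) := by
  classical
  intro T S
  refine (Set.finite_singleton (Function.update S γ' (T γ'))).subset fun U hU => ?_
  rw [Function.mem_support, onFactor_mul_onFactor_of_ne hγ] at hU
  by_contra h
  exact hU (if_neg h)

end Factors

/-! ### The commutator on one tensor factor -/

section Commutator

theorem coe_coeffA (r : ℕ) (c : ℂ) (a : ℕ) (i : ℤ) :
    ((coeffA r c a i : ℂ⟦X⟧) : ℂ⸨X⸩) =
      zVar / (zVar + const (a : ℂ)) * ((formalPow (sSeries c) (expo r a) : ℂ⟦X⟧) : ℂ⸨X⸩) *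
        ((sSeries c : ℂ⟦X⟧) : ℂ⸨X⸩) ^ i / poch ((expo r a : ℂ⟦X⟧) : ℂ⸨X⸩) i := by
  have h : (((sUnit c ^ i : ℂ⟦X⟧ˣ) : ℂ⟦X⟧) : ℂ⸨X⸩) = ((sSeries c : ℂ⟦X⟧) : ℂ⸨X⸩) ^ i := by
    have h1 := congrArg Units.val
      (map_zpow (Units.map (HahnSeries.ofPowerSeries ℤ ℂ : ℂ⟦X⟧ →* ℂ⸨X⸩)) (sUnit c) i)
    rw [Units.val_zpow_eq_zpow_val] at h1
    exact h1
  rw [coeffA, map_mul, map_mul, map_mul, coe_zFrac, h,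
    coe_pochInv (constantCoeff_expo_add_ne_zero r a), div_eq_mul_inv _ (poch _ i)]

variable {K : Type*} [AddCommGroup K] [Finite K]

/-- The coefficient of `z ^ k` in `𝒜^γ_{a/r}(z)`. In each entry at most one `i` contributes, on both
sides. -/
theorem coeffOp_opA (r : ℕ) [NeZero r] (ρ u : ℂ) (γ : AddChar K ℂ) (a : ℕ) (k : ℤ) :
    coeffOp (opA r ρ u γ a) k =
      onFactor γ (familyMatrix (summandOp r a ((Nat.card K : ℂ) * u) (ρ ^ a) k)) := by
  classical
  obtain ⟨κ, hκ⟩ : ∃ κ, κ = (Nat.card K : ℂ) * u := ⟨_, rfl⟩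
  have hgr := isGradedFamily_summandOp r a κ (ρ ^ a) k
  ext T S
  have key : ∀ i : ℤ, zVar * const (ρ ^ a) / (zVar + const (a : ℂ)) *
      ((formalPow (sSeries (r * κ)) (expo r a) : ℂ⟦X⟧) : ℂ⸨X⸩) *
      (zVar ^ i * ((sSeries (r * κ) : ℂ⟦X⟧) : ℂ⸨X⸩) ^ i / poch ((expo r a : ℂ⟦X⟧) : ℂ⸨X⸩) i *
        opE (i * (r : ℤ) + (a : ℤ)) κ (T γ) (S γ)) =
      const (ρ ^ a) * zVar ^ i * ((coeffA r (r * κ) a i : ℂ⟦X⟧) : ℂ⸨X⸩) *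
        opE (i * (r : ℤ) + (a : ℤ)) κ (T γ) (S γ) := by
    intro i
    rw [coe_coeffA]
    ring
  have hop : opA r ρ u γ a T S = zVar * const (ρ ^ a) / (zVar + const (a : ℂ)) *
      ((formalPow (sSeries (r * κ)) (expo r a) : ℂ⟦X⟧) : ℂ⸨X⸩) *
      ∑ᶠ i : ℤ, zVar ^ i * ((sSeries (r * κ) : ℂ⟦X⟧) : ℂ⸨X⸩) ^ i /
        poch ((expo r a : ℂ⟦X⟧) : ℂ⸨X⸩) i *
          onComponent γ (opE (i * (r : ℤ) + (a : ℤ)) κ) T S := by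
    rw [hκ, ← mul_assoc]
    rfl
  rw [coeffOp, hop, onFactor, ← hκ]
  by_cases h : ∀ γ', γ' ≠ γ → T γ' = S γ'
  · rw [if_pos h]
    have hon : ∀ m, onComponent γ (opE m κ) T S = opE m κ (T γ) (S γ) := fun m => if_pos h
    simp only [hon]
    by_cases h1 : ∃ i : ℤ, (T γ : Wedge).energy = (S γ : Wedge).energy - (i * r + a)
    · obtain ⟨i, hi⟩ := h1
      rw [finsum_eq_single _ i, key, coeff_mul_opE, hgr.familyMatrix_apply hi, summandOp_apply,
        Finsupp.add_apply, Finsupp.smul_apply, smul_eq_mul]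
      · congr 1
        by_cases h2 : i * (r : ℤ) + a = 0
        · by_cases h3 : T γ = S γ
          · rw [if_pos ⟨h2, h3⟩, if_pos h2, h3, Finsupp.single_eq_same, mul_one]
          · rw [if_neg (fun h => h3 h.2), Finsupp.single_eq_of_ne (fun h => h3 (Subtype.ext h)),
              mul_zero]
        · rw [if_neg (fun h => h2 h.1), if_neg h2, zero_mul]
      · intro j hj
        rw [opE_eq_zero, mul_zero]
        intro hj'
        exact hj (eq_of_mul_add_eq (hj'.symm.trans hi))
    · rw [finsum_eq_zero_of_forall_eq_zero, mul_zero, HahnSeries.coeff_zero,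
        hgr.familyMatrix_eq_zero (fun i hi => h1 ⟨i, hi⟩)]
      intro i
      rw [opE_eq_zero (fun hi => h1 ⟨i, hi⟩), mul_zero]
  · rw [if_neg h]
    have hon : ∀ m, onComponent γ (opE m κ) T S = 0 := fun m => if_neg h
    simp only [hon, mul_zero, finsum_zero, HahnSeries.coeff_zero]

/-- The commutator of two summands is an operator of the same kind and a scalar. The scalar parts of
the two summands themselves, which come from `1 / ς`, cancel. -/
theorem summandOp_commutator (r a b : ℕ) (κ x y : ℂ) (k l i N : ℤ) (v : InfWedge) :
    summandOp r a κ x k i (summandOp r b κ y l (N - i) v)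
        - summandOp r b κ y l (N - i) (summandOp r a κ x k i v)
      = diagOp (fun n => x * y * if i ∈ Icc (N - l) k then
          biCoeff (k - i).toNat (l - (N - i)).toNat
            (termA r a b κ N ((n : ℂ) + 1 / 2 - ((N * r + a + b : ℤ) : ℂ) / 2) i) else 0)
          (N * r + a + b) v
        + (if N * r + a + b = 0 then x * y * if i ∈ Icc (N - l) k then
            biCoeff (k - i).toNat (l - (N - i)).toNat (termB r a b κ N i) else 0 else 0) • v := by
  have hco : ∀ f g : ℂ⟦X⟧, x * intCoeff f (k - i) * (y * intCoeff g (l - (N - i))) =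
      x * y * if i ∈ Icc (N - l) k then
        biCoeff (k - i).toNat (l - (N - i)).toNat (inZ f * inW g) else 0 := by
    intro f g
    split_ifs with h
    · rw [mem_Icc] at h
      obtain ⟨p, hp⟩ := Int.eq_ofNat_of_zero_le (show 0 ≤ k - i by omega)
      obtain ⟨q, hq⟩ := Int.eq_ofNat_of_zero_le (show 0 ≤ l - (N - i) by omega)
      rw [hp, hq, intCoeff_natCast, intCoeff_natCast, Int.toNat_natCast, Int.toNat_natCast,
        biCoeff_mul]
      ring
    · rw [mem_Icc, not_and_or] at h
      rcases h with h | h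
      · rw [intCoeff_of_neg g (show l - (N - i) < 0 by omega)]; ring
      · rw [intCoeff_of_neg f (show k - i < 0 by omega)]; ring
  rw [summandOp_apply, summandOp_apply, summandOp_apply, summandOp_apply]
  have hcomm := diagOp_commutator
    (fun n => x * intCoeff (coeffA r (r * κ) a i *
      expSeries (κ * ((n : ℂ) + 1 / 2 - ((i * r + a : ℤ) : ℂ) / 2))) (k - i))
    (fun n => y * intCoeff (coeffA r (r * κ) b (N - i) *
      expSeries (κ * ((n : ℂ) + 1 / 2 - (((N - i) * r + b : ℤ) : ℂ) / 2))) (l - (N - i)))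
    (i * r + a) ((N - i) * r + b) v
  simp only [hco] at hcomm
  rw [show i * (r : ℤ) + a + ((N - i) * r + b) = N * r + a + b by ring] at hcomm
  have hsplit : ∀ (D D' : InfWedge →ₗ[ℂ] InfWedge) (s t : ℂ),
      D (D' v + t • v) + s • (D' v + t • v) - (D' (D v + s • v) + t • (D v + s • v))
        = D (D' v) - D' (D v) := by
    intro D D' s t
    simp only [map_add, map_smul, smul_add, smul_comm t s]
    abel
  rw [hsplit, hcomm]
  congr 2
  · congr 1
    funext n
    have e1 : κ * (((n - ((N - i) * r + b) : ℤ) : ℂ) + 1 / 2 - ((i * r + a : ℤ) : ℂ) / 2) =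
        κ * ((n : ℂ) + 1 / 2 - ((N * r + a + b : ℤ) : ℂ) / 2 - ((N - i : ℤ) * r + b) / 2) := by
      push_cast; ring
    have e2 : κ * ((n : ℂ) + 1 / 2 - (((N - i) * r + b : ℤ) : ℂ) / 2) =
        κ * ((n : ℂ) + 1 / 2 - ((N * r + a + b : ℤ) : ℂ) / 2 + (i * r + a) / 2) := by
      push_cast; ring
    have e3 : κ * ((n : ℂ) + 1 / 2 - ((i * r + a : ℤ) : ℂ) / 2) =
        κ * ((n : ℂ) + 1 / 2 - ((N * r + a + b : ℤ) : ℂ) / 2 + ((N - i : ℤ) * r + b) / 2) := by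
      push_cast; ring
    have e4 : κ * (((n - (i * r + a) : ℤ) : ℂ) + 1 / 2 - (((N - i) * r + b : ℤ) : ℂ) / 2) =
        κ * ((n : ℂ) + 1 / 2 - ((N * r + a + b : ℤ) : ℂ) / 2 - (i * r + a) / 2) := by
      push_cast; ring
    rw [← mul_sub, termA, e1, e2, e3, e4]
    split_ifs with h
    · rw [map_sub]
    · rw [sub_zero]
  · split_ifs with h1 h2
    · have e0 : (N : ℂ) * r + a + b = 0 := by exact_mod_cast h1
      have e1 : ∀ n : ℤ, κ * (((n + (i * r + a) : ℤ) : ℂ) + 1 / 2 - ((i * r + a : ℤ) : ℂ) / 2) =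
          κ * ((n : ℂ) + 1 / 2 + (i * r + a) / 2) := by
        intro n; push_cast; ring
      have e2 : ∀ n : ℤ, κ * ((n : ℂ) + 1 / 2 - (((N - i) * r + b : ℤ) : ℂ) / 2) =
          κ * ((n : ℂ) + 1 / 2 + (i * r + a) / 2) := by
        intro n; push_cast; linear_combination (-κ / 2) * e0
      simp only [e1, e2]
      rw [termB, map_betweenSum, ← mul_betweenSum]
    · simp only [betweenSum, Finset.sum_const_zero, mul_zero, sub_zero]
    · rfl

theorem shiftedSum_eq_sum_ite (t : ℤ → TwoVar) (N k l : ℤ) :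
    shiftedSum t N k l = ∑ i ∈ Icc (N - (l + 1)) (k + 1),
      if i ∈ Icc (N - l) k then biCoeff (k - i).toNat (l - (N - i)).toNat (t i) else 0 := by
  rw [shiftedSum, Finset.sum_ite_mem, inter_eq_right.2]
  exact Icc_subset_Icc (by omega) (by omega)

open Classical in
/-- The commutator of the coefficients of `z ^ k` and `w ^ l` on one tensor factor. -/
theorem familyMatrix_commutator (r : ℕ) [NeZero r] {a b : ℕ} (ha : a < r) (hb : b < r) {κ : ℂ}
    (hκ : κ ≠ 0) (x y : ℂ) (k l : ℤ) :
    comp (familyMatrix (summandOp r a κ x k)) (familyMatrix (summandOp r b κ y l)) -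
        comp (familyMatrix (summandOp r b κ y l)) (familyMatrix (summandOp r a κ x k)) =
      ((if r ∣ a + b then 1 else 0) * (x * y * if k + l = 1 then
        (-1) ^ (k - 1) * (if a + b = 0 then 1 else (r : ℂ)⁻¹) else 0)) •
          (1 : Matrix State State ℂ) := by
  have hP := isGradedFamily_summandOp r a κ x k
  have hQ := isGradedFamily_summandOp r b κ y l
  ext T S
  rw [Matrix.sub_apply, Matrix.smul_apply, smul_eq_mul]
  by_cases h : ∃ N : ℤ, (T : Wedge).energy = (S : Wedge).energy - (N * r + a + b)
  · obtain ⟨N, hN⟩ := h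
    have hN' : (T : Wedge).energy = (S : Wedge).energy - (N * r + b + a) := by rw [hN]; ring
    have hre : ∑ j ∈ Icc (N - (k + 1)) (l + 1), summandOp r b κ y l j
          (summandOp r a κ x k (N - j) (Finsupp.single (S : Wedge) 1)) (T : Wedge)
        = ∑ i ∈ Icc (N - (l + 1)) (k + 1), summandOp r b κ y l (N - i)
          (summandOp r a κ x k i (Finsupp.single (S : Wedge) 1)) (T : Wedge) := by
      refine Finset.sum_nbij' (fun j => N - j) (fun i => N - i) ?_ ?_ ?_ ?_ ?_
      · intro j hj; rw [mem_Icc] at hj ⊢; omega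
      · intro j hj; rw [mem_Icc] at hj ⊢; omega
      · intro j _; exact sub_sub_cancel N j
      · intro j _; exact sub_sub_cancel N j
      · intro j _; rw [sub_sub_cancel]
    rw [hP.comp_eq_sum hQ hN, hQ.comp_eq_sum hP hN', hre, ← Finset.sum_sub_distrib]
    simp only [← Finsupp.sub_apply, summandOp_commutator]
    rw [← Finsupp.finsetSum_apply, Finset.sum_add_distrib, sum_diagOp, ← Finset.sum_smul]
    simp only [← Finset.mul_sum, ← shiftedSum_eq_sum_ite, shiftedSum_termA, mul_zero, diagOp_zero,
      zero_add, Finsupp.smul_apply, smul_eq_mul]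
    by_cases h0 : N * (r : ℤ) + a + b = 0
    · have hdvd : r ∣ a + b := by
        have : (r : ℤ) ∣ ((a + b : ℕ) : ℤ) := ⟨-N, by push_cast; linarith⟩
        exact_mod_cast this
      simp only [if_pos h0]
      rw [← Finset.mul_sum, ← shiftedSum_eq_sum_ite, shiftedSum_termB r ha hb hκ h0, if_pos hdvd,
        one_mul]
      congr 1
      by_cases hTS : T = S
      · rw [hTS, Finsupp.single_eq_same, Matrix.one_apply_eq]
      · rw [Matrix.one_apply_ne hTS, Finsupp.single_eq_of_ne (fun h => hTS (Subtype.ext h))]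
    · simp only [if_neg h0, Finset.sum_const_zero, zero_mul]
      rw [Matrix.one_apply_ne, mul_zero]
      rintro rfl
      exact h0 (by linarith)
  · have h' : ∀ N : ℤ, (T : Wedge).energy ≠ (S : Wedge).energy - (N * r + a + b) :=
      fun N hN => h ⟨N, hN⟩
    rw [hP.comp_eq_zero hQ h', hQ.comp_eq_zero hP (fun N hN => h ⟨N, by rw [hN]; ring⟩), sub_zero]
    by_cases hTS : T = S
    · subst hTS
      rw [if_neg, zero_mul, zero_mul]
      rintro ⟨n, hn⟩
      refine h ⟨-n, ?_⟩
      have : (a : ℤ) + b = r * n := by exact_mod_cast hn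
      linear_combination this
    · rw [Matrix.one_apply_ne hTS, mul_zero]

end Commutator

/-! ### Bilinearity and characters -/

section Assembly

section Bilinear

variable {ι α : Type*} [Fintype α]

theorem comp_sum_smul {M N : α → Matrix ι ι ℂ} (c d : α → ℂ)
    (h : ∀ γ γ', Composable (M γ) (N γ')) :
    Composable (∑ γ, c γ • M γ) (∑ γ, d γ • N γ) ∧
      comp (∑ γ, c γ • M γ) (∑ γ, d γ • N γ) =
        ∑ γ, ∑ γ', (c γ * d γ') • comp (M γ) (N γ') := by
  have hterm : ∀ T S U, (∑ γ, c γ • M γ) T U * (∑ γ, d γ • N γ) U S =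
      ∑ p : α × α, (c p.1 * d p.2) * (M p.1 T U * N p.2 U S) := by
    intro T S U
    rw [Matrix.sum_apply, Matrix.sum_apply, Finset.sum_mul_sum, ← Finset.univ_product_univ,
      Finset.sum_product]
    refine Finset.sum_congr rfl fun γ _ => Finset.sum_congr rfl fun γ' _ => ?_
    rw [Matrix.smul_apply, Matrix.smul_apply, smul_eq_mul, smul_eq_mul]
    ring
  have hfin : ∀ T S (p : α × α),
      (Function.support fun U => (c p.1 * d p.2) * (M p.1 T U * N p.2 U S)).Finite :=
    fun T S p => (h p.1 p.2 T S).subset fun U hU => right_ne_zero_of_mul hU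
  constructor
  · intro T S
    simp only [hterm]
    refine (Set.finite_iUnion (hfin T S)).subset fun U hU => ?_
    obtain ⟨p, -, hp⟩ := Finset.exists_ne_zero_of_sum_ne_zero hU
    exact Set.mem_iUnion.2 ⟨p, hp⟩
  · ext T S
    rw [comp, finsum_congr (hterm T S), finsum_sum_comm _ _ (fun p _ => hfin T S p),
      ← Finset.univ_product_univ, Finset.sum_product, Matrix.sum_apply]
    refine Finset.sum_congr rfl fun γ _ => ?_
    rw [Matrix.sum_apply]
    refine Finset.sum_congr rfl fun γ' _ => ?_
    exact (mul_finsum (fun U => M γ T U * N γ' U S) (c γ * d γ')).symm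

/-- Commutators that are scalars are bilinear. -/
theorem HasCommutator.sum_smul {M N : α → Matrix ι ι ℂ⸨X⸩} {f : α → α → BiSeries} (c d : α → ℂ)
    (h : ∀ γ γ', HasCommutator (M γ) (N γ') (f γ γ')) :
    HasCommutator (∑ γ, c γ • M γ) (∑ γ, d γ • N γ)
      (∑ γ, ∑ γ', (c γ * d γ') • f γ γ') := by
  have hco : ∀ (c : α → ℂ) (M : α → Matrix ι ι ℂ⸨X⸩) (k : ℤ),
      coeffOp (∑ γ, c γ • M γ) k = ∑ γ, c γ • coeffOp (M γ) k := by
    intro c M k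
    ext T S
    rw [coeffOp, Matrix.sum_apply, Matrix.sum_apply, HahnSeries.coeff_sum]
    rfl
  intro k l
  obtain ⟨h1, h2⟩ := comp_sum_smul c d fun γ γ' => (h γ γ' k l).1
  obtain ⟨h3, h4⟩ := comp_sum_smul d c fun γ γ' => (h γ' γ k l).2.1
  rw [hco, hco]
  refine ⟨h1, h3, ?_⟩
  rw [h2, h4, Finset.sum_comm (f := fun γ γ' => (d γ * c γ') • _), ← Finset.sum_sub_distrib]
  simp only [Finset.sum_apply, Pi.smul_apply, Finset.sum_smul]
  refine Finset.sum_congr rfl fun γ _ => ?_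
  rw [← Finset.sum_sub_distrib]
  refine Finset.sum_congr rfl fun γ' _ => ?_
  rw [mul_comm (d γ'), ← smul_sub, (h γ γ' k l).2.2, smul_smul, smul_eq_mul]

end Bilinear

variable {K : Type*} [AddCommGroup K]

open Classical in
theorem onFactor_smul_one (γ : AddChar K ℂ) (c : ℂ) :
    onFactor γ (c • (1 : Matrix State State ℂ)) =
      c • (1 : Matrix (FockBasis K) (FockBasis K) ℂ) := by
  ext T S
  rw [onFactor, Matrix.smul_apply, Matrix.smul_apply]
  by_cases h : T = S
  · subst h
    rw [if_pos (fun _ _ => rfl), Matrix.one_apply_eq, Matrix.one_apply_eq]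
  · rw [Matrix.one_apply_ne h, smul_zero]
    split_ifs with h1
    · rw [Matrix.one_apply_ne, smul_zero]
      intro h2
      refine h (funext fun δ => ?_)
      by_cases hδ : δ = γ
      · rw [hδ, h2]
      · exact h1 δ hδ
    · rfl

theorem onFactor_sub (γ : AddChar K ℂ) (M N : Matrix State State ℂ) :
    onFactor γ M - onFactor γ N = onFactor γ (M - N) := by
  ext T S
  rw [Matrix.sub_apply, onFactor, onFactor, onFactor]
  split_ifs
  · rfl
  · rw [sub_zero]

theorem CocycleExt.eq_neg_iff (r : ℕ) [NeZero r] {𝕜 : K} (x y : CocycleExt r 𝕜) :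
    x = -y ↔ r ∣ x.fst.val + y.fst.val ∧
      x.snd + y.snd + ((x.fst.val + y.fst.val) / r) • 𝕜 = 0 := by
  have h1 : x.fst + y.fst = 0 ↔ r ∣ x.fst.val + y.fst.val := by
    rw [← ZMod.natCast_eq_zero_iff]
    push_cast
    rw [ZMod.natCast_zmod_val, ZMod.natCast_zmod_val]
  have hr0 : 0 < r := Nat.pos_of_ne_zero (NeZero.ne r)
  have hx := ZMod.val_lt x.fst
  have hy := ZMod.val_lt y.fst
  have h2 : cocycle 𝕜 x.fst y.fst = ((x.fst.val + y.fst.val) / r) • 𝕜 := by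
    rw [cocycle]
    split_ifs with h
    · rw [Nat.div_eq_of_lt_le (k := 1) (by omega) (by omega), one_smul]
    · rw [Nat.div_eq_of_lt (by omega), zero_smul]
  rw [eq_neg_iff_add_eq_zero, CocycleExt.add_def, CocycleExt.zero_def, CocycleExt.mk.injEq, h1, h2]

variable [Finite K]

open Classical in
/-- The commutation relations of the operators `𝒜^γ_{a/r}`. -/
theorem hasCommutator_opA (r : ℕ) [NeZero r] (𝕜 : K) (ρ : AddChar K ℂ → ℂ)
    (hρ : ∀ γ : AddChar K ℂ, ρ γ ^ r = γ (-𝕜) * (r : ℂ)) (u : ℂ) (hu : u ≠ 0)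
    (γ γ' : AddChar K ℂ) (a b : ℕ) (ha : a < r) (hb : b < r) :
    HasCommutator (opA r (ρ γ) u γ a) (opA r (ρ γ') u γ' b)
        (((if γ = γ' then 1 else 0) * (if r ∣ a + b then 1 else 0) *
          γ 𝕜 ^ (-(((a + b) / r : ℕ) : ℤ))) • mulZW deltaSeries) := by
  intro k l
  have hP := fun k => isGradedFamily_summandOp r a ((Nat.card K : ℂ) * u) (ρ γ ^ a) k
  have hQ := fun l => isGradedFamily_summandOp r b ((Nat.card K : ℂ) * u) (ρ γ' ^ b) l
  rw [coeffOp_opA, coeffOp_opA]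
  by_cases h : γ = γ'
  swap
  · refine ⟨composable_onFactor_of_ne h, composable_onFactor_of_ne (Ne.symm h), ?_⟩
    rw [comp_onFactor_comm h, sub_self, if_neg h, zero_mul, zero_mul, zero_smul, Pi.zero_apply,
      Pi.zero_apply, zero_smul]
  subst h
  refine ⟨composable_onFactor ((hP k).composable (hQ l)),
    composable_onFactor ((hQ l).composable (hP k)), ?_⟩
  have hκ : (Nat.card K : ℂ) * u ≠ 0 := mul_ne_zero (by exact_mod_cast Nat.card_pos.ne') hu
  rw [comp_onFactor, comp_onFactor, onFactor_sub, familyMatrix_commutator r ha hb hκ,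
    onFactor_smul_one]
  congr 1
  have hdelta : mulZW deltaSeries k l = if k + l = 1 then (-1) ^ (k - 1) else 0 := by
    rw [mulZW, deltaSeries]
    exact if_congr (by omega) rfl rfl
  rw [if_pos rfl, one_mul, Pi.smul_apply, Pi.smul_apply, smul_eq_mul, hdelta]
  by_cases hd : r ∣ a + b
  swap
  · rw [if_neg hd, zero_mul, zero_mul, zero_mul]
  rw [if_pos hd, one_mul, one_mul, ← pow_add]
  by_cases hkl : k + l = 1
  swap
  · rw [if_neg hkl, if_neg hkl, mul_zero, mul_zero]
  rw [if_pos hkl, if_pos hkl]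
  have hr0 : 0 < r := Nat.pos_of_ne_zero (NeZero.ne r)
  by_cases h0 : a + b = 0
  · rw [if_pos h0, h0, Nat.zero_div]
    simp
  · have hab : a + b = r := by
      obtain ⟨n, hn⟩ := hd
      have h1 : n < 2 := by
        by_contra h1
        have : r * 2 ≤ r * n := Nat.mul_le_mul_left r (by omega)
        omega
      interval_cases n
      · omega
      · omega
    have hrC : (r : ℂ) ≠ 0 := by exact_mod_cast hr0.ne'
    rw [if_neg h0, hab, hρ, Nat.div_self hr0, AddChar.map_neg_eq_inv, Nat.cast_one, zpow_neg_one]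
    field_simp

open Classical in
theorem sum_addChar_eq_ite (k : K) [Fintype (AddChar K ℂ)] :
    ∑ γ : AddChar K ℂ, γ k = if k = 0 then (Nat.card K : ℂ) else 0 := by
  have := Fintype.ofFinite K
  rw [Nat.card_eq_fintype_card, ← AddChar.sum_apply_eq_ite]
  exact Finset.sum_congr (by ext; simp) fun _ _ => rfl

end Assembly

end OrbifoldFock

open Classical in
theorem mainTheorem8 {K : Type*} [AddCommGroup K] [Finite K] (r : ℕ) [NeZero r] (𝕜 : K)
    (ρ : AddChar K ℂ → ℂ) (hρ : ∀ γ : AddChar K ℂ, ρ γ ^ r = γ (-𝕜) * (r : ℂ))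
    (u : ℂ) (hu : u ≠ 0) :
    (∀ (γ γ' : AddChar K ℂ) (a b : ℕ), a < r → b < r →
      HasCommutator (opA r (ρ γ) u γ a) (opA r (ρ γ') u γ' b)
        (((if γ = γ' then 1 else 0) * (if r ∣ a + b then 1 else 0) *
          γ 𝕜 ^ (-(((a + b) / r : ℕ) : ℤ))) • mulZW deltaSeries)) ∧
    (∀ x y : CocycleExt r 𝕜,
      HasCommutator (opAR ρ u x) (opAR ρ u y)
        (((if x = -y then 1 else 0) * (Nat.card K : ℂ)) • mulZW deltaSeries)) := by
  refine ⟨hasCommutator_opA r 𝕜 ρ hρ u hu, fun x y => ?_⟩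
  have h := HasCommutator.sum_smul (fun γ : AddChar K ℂ => γ (-x.snd))
    (fun γ : AddChar K ℂ => γ (-y.snd))
    (fun γ γ' => hasCommutator_opA r 𝕜 ρ hρ u hu γ γ' _ _ (ZMod.val_lt x.fst) (ZMod.val_lt y.fst))
  rw [← opAR, ← opAR] at h
  convert h using 1
  simp only [smul_smul, ← Finset.sum_smul]
  congr 1
  obtain ⟨n, hn⟩ : ∃ n, n = (x.fst.val + y.fst.val) / r := ⟨_, rfl⟩
  have hterm : ∀ γ : AddChar K ℂ, γ (-x.snd) * γ (-y.snd) * γ 𝕜 ^ (-(n : ℤ))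
      = γ (-(x.snd + y.snd + n • 𝕜)) := by
    intro γ
    rw [neg_add, neg_add, AddChar.map_add_eq_mul, AddChar.map_add_eq_mul,
      AddChar.map_neg_eq_inv γ (n • 𝕜), AddChar.map_nsmul_eq_pow, zpow_neg, zpow_natCast]
  have hinner : ∀ γ : AddChar K ℂ, ∑ γ' : AddChar K ℂ, γ (-x.snd) * γ' (-y.snd) *
      ((if γ = γ' then 1 else 0) * (if r ∣ x.fst.val + y.fst.val then 1 else 0) *
        γ 𝕜 ^ (-(n : ℤ))) =
      (if r ∣ x.fst.val + y.fst.val then 1 else 0) * γ (-(x.snd + y.snd + n • 𝕜)) := by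
    intro γ
    rw [Finset.sum_eq_single γ, if_pos rfl, ← hterm]
    · ring
    · intro γ' _ hne
      rw [if_neg (Ne.symm hne), zero_mul, zero_mul, mul_zero]
    · intro h
      exact absurd (Finset.mem_univ γ) h
  rw [← hn]
  simp only [hinner]
  rw [← Finset.mul_sum, sum_addChar_eq_ite, CocycleExt.eq_neg_iff r x y, ← hn, neg_eq_zero]
  by_cases h1 : r ∣ x.fst.val + y.fst.val <;>
    by_cases h2 : x.snd + y.snd + n • 𝕜 = 0 <;> simp [h1, h2]
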